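/- Let $\mathbb{K}$ be a commutative ring, and let dg $\mathbb{K}$-modules $V=\bigoplus_{k\in\mathbb{Z}}V^k$ be cohomologically graded, with the Koszul sign rule for the actions of the symmetric groups on the tensor powers $V^{\otimes n}$. **Algebras.** Let $\mathcal{P}re\mathcal{L}ie$ be the operad of rooted trees: $\mathcal{P}re\mathcal{L}ie(n)$ is the free $\mathbb{K}$-module on the set of rooted trees with vertices labelled by $1,\dots,n$, and the composite $T(Q_1,\dots,Q_n)$ is the sum of all trees obtained from $T$ by inserting the trees $Q_i$ at the vertices $i$ and attaching the incoming edges of the vertex $i$ of $T$ to vertices of $Q_i$ in all possible ways. Let $\Gamma(\mathcal{P}re\mathcal{L}ie,V)=\bigoplus_{n}(\mathcal{P}re\mathcal{L}ie(n)\otimes V^{\otimes n})^{\Sigma_n}$, with its usual structure of a monad on dg $\mathbb{K}$-modules induced by the operadic composition. A *dg pre-Lie algebra with divided powers* $L$ is an algebra over this monad, with structure morphism $l:\Gamma(\mathcal{P}re\mathcal{L}ie,L)\to L$. For $x,y_1,\dots,y_p\in L$ and weights $r_1,\dots,r_p\ge 0$ (when $2\neq 0$ in $\mathbb{K}$, only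 elements $y_i\in\bigoplus_k L^{2k}$ are allowed to have a weight $r_i>1$), the *weighted brace* $x\{y_1,\dots,y_p\}_{r_1,\dots,r_p}\in L$ is the image under $l$ of the element obtained from $$\sum_{\sigma\in Sh(1,r_1,\dots,r_p)}\sigma\cdot\bigl(F_r\otimes e\otimes e_1^{\otimes r_1}\otimes\cdots\otimes e_p^{\otimes r_p}\bigr),\qquad r=r_1+\cdots+r_p,$$ by the substitution $e\mapsto x$, $e_i\mapsto y_i$, where the $e,e_i$ are distinct variables of the same degrees as the $x,y_i$, where $F_r$ is the corolla with root $1$ and leaves $2,\dots,r+1$, and where $\sigma$ runs through the shuffles of blocks of sizes $1,r_1,\dots,r_p$ (for non-homogeneous entries the same formula applies, with the Koszul signs taken componentwise). **Completeness.** $L$ is *complete* if it is equipped with a filtration $\cdots\subset F_nL\subset F_{n-1}L\subset\cdots\subset F_1L=L$ by sub-dg-modules such that $F_kL\{F_{k_1}L,\dots,F_{k_p}L\}_{r_1,\dots,r_p}\subset F_{k+k_1r_1+\cdots+k_pr_p}L$ for all weighted braces, and such that the morphism $L\to\lim_{n\ge1}L/F_nL$ of dg $\mathbb{K}$-modules is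 an isomorphism (in every degree). **Circular product.** Let $L_+=\mathbb{K}1\oplus L$, and extend the weighted braces to $L_+\times L^{\times p}$, linearly in the first variable, by setting $1\{y_1,\dots,y_p\}_{r_1,\dots,r_p}$ equal to $1$ if all $r_i=0$, to $y_i$ if $r_i=1$ and all other weights are $0$, and to $0$ if $r_1+\cdots+r_p>1$. For $a\in L_+$ and $\mu\in L^0$ set $$a\circledcirc(1+\mu)=\sum_{n=0}^{\infty}a\{\mu\}_n .$$ **Theorem.** Let $L$ be a complete dg pre-Lie algebra with divided powers over $\mathbb{K}$, with differential $d$. (i) For all $a\in L_+$ and $\mu\in L^0$ the series $\sum_n a\{\mu\}_n$ converges in $L_+$, to a unique sum. The set $1+L^0$ is a group for the product $\circledcirc$, with unit element $1$. It is called the gauge group of $L$. (ii) The gauge group acts (from the left) on the Maurer–Cartan set $\mathcal{MC}(L)=\{\alpha\in L^1 : d\alpha+\alpha\{\alpha\}_1=0\}$ by $$(1+\mu)\cdot\alpha=(\alpha+\mu\{\alpha\}_1-d\mu)\circledcirc(1+\mu)^{\circledcirc -1},$$ where $(1+\mu)^{\circledcirc-1}$ is the inverse of $1+\mu$ in the gauge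 group. -/

import Mathlib

open scoped TensorProduct

universe u v w

/-! ### Graded signs -/

namespace Koszul

/-- The sign `(-1)^(a * b)` of the exchange of two elements of degrees `a` and `b`. -/
def swapSign (a b : ℤ) : ℤˣ := (a * b).negOnePow

/-- The Koszul sign attached to a map `p : I → J` between finite linearly ordered sets and to
degrees `q : I → ℤ`: a factor `(-1)^(q i * q i')` for every inversion `i < i'`, `p i' < p i`.
When `p` is a bijection this is the sign of the permutation of a tensor `⨂ v i`, `|v i| = q i`. -/
def sign {I J : Type} [Fintype I] [LinearOrder I] [LinearOrder J] (p : I → J) (q : I → ℤ) : ℤˣ :=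
  ∏ i, ∏ i', if i < i' ∧ p i' < p i then swapSign (q i) (q i') else 1

theorem swapSign_comm (a b : ℤ) : swapSign a b = swapSign b a := by
  rw [swapSign, swapSign, mul_comm]

theorem swapSign_add_left (a b c : ℤ) :
    swapSign (a + b) c = swapSign a c * swapSign b c := by
  simp [swapSign, add_mul, Int.negOnePow_add]

theorem swapSign_add_right (a b c : ℤ) :
    swapSign a (b + c) = swapSign a b * swapSign a c := by
  simp [swapSign, mul_add, Int.negOnePow_add]

theorem swapSign_sum_left {ι : Type} (s : Finset ι) (f : ι → ℤ) (c : ℤ) :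
    swapSign (∑ i ∈ s, f i) c = ∏ i ∈ s, swapSign (f i) c := by
  classical
  induction s using Finset.induction_on with
  | empty => simp [swapSign]
  | insert a s ha ih => rw [Finset.sum_insert ha, Finset.prod_insert ha, swapSign_add_left, ih]

theorem swapSign_sum_right {ι : Type} (s : Finset ι) (f : ι → ℤ) (c : ℤ) :
    swapSign c (∑ i ∈ s, f i) = ∏ i ∈ s, swapSign c (f i) := by
  rw [swapSign_comm, swapSign_sum_left]
  exact Finset.prod_congr rfl fun i _ => swapSign_comm _ _

theorem swapSign_mul_self (a b : ℤ) : swapSign a b * swapSign a b = 1 :=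
  Int.units_mul_self _

/-- The product of a symmetric function over unordered pairs does not depend on the way in which
the pairs are oriented. -/
theorem prod_orient {I : Type} [Fintype I] (F : I → I → ℤˣ) (hF : ∀ a b, F a b = F b a)
    (r s : I → I → Prop) [∀ a b, Decidable (r a b)] [∀ a b, Decidable (s a b)]
    (hr : ∀ a b, r a b → ¬ r b a) (hs : ∀ a b, s a b → ¬ s b a)
    (hrs : ∀ a b, F a b ≠ 1 → ((r a b ∨ r b a) ∧ (s a b ∨ s b a))) :
    (∏ a, ∏ b, if r a b then F a b else 1) = ∏ a, ∏ b, if s a b then F a b else 1 := by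
  have h1 : (∏ a, ∏ b, if r a b then F a b else 1) =
      (∏ a, ∏ b, if r a b ∧ s a b then F a b else 1) *
        ∏ a, ∏ b, if r a b ∧ ¬ s a b then F a b else 1 := by
    rw [← Finset.prod_mul_distrib]
    refine Finset.prod_congr rfl fun a _ => ?_
    rw [← Finset.prod_mul_distrib]
    refine Finset.prod_congr rfl fun b _ => ?_
    by_cases h : r a b <;> by_cases h' : s a b <;> simp [h, h']
  have h2 : (∏ a, ∏ b, if s a b then F a b else 1) =
      (∏ a, ∏ b, if r a b ∧ s a b then F a b else 1) *
        ∏ a, ∏ b, if s a b ∧ ¬ r a b then F a b else 1 := by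
    rw [← Finset.prod_mul_distrib]
    refine Finset.prod_congr rfl fun a _ => ?_
    rw [← Finset.prod_mul_distrib]
    refine Finset.prod_congr rfl fun b _ => ?_
    by_cases h : r a b <;> by_cases h' : s a b <;> simp [h, h']
  rw [h1, h2]
  congr 1
  rw [Finset.prod_comm]
  refine Finset.prod_congr rfl fun a _ => Finset.prod_congr rfl fun b _ => ?_
  by_cases h : F a b = 1
  · simp [h, hF b a]
  · have h3 := hrs a b h
    have h4 := hr a b
    have h5 := hs a b
    have h6 : (r b a ∧ ¬ s b a) ↔ (s a b ∧ ¬ r a b) := by tauto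
    simp only [h6, hF b a]

theorem prod_fiber {I J : Type} [Fintype I] [Fintype J] [DecidableEq J] (p : I → J)
    (f : J → I → I → ℤˣ) :
    (∏ j, ∏ a : {i // p i = j}, ∏ b : {i // p i = j}, f j a b) =
      ∏ a, ∏ b, if p b = p a then f (p a) a b else 1 := by
  have h : ∀ j, (∏ a : {i // p i = j}, ∏ b : {i // p i = j}, f j a b) =
      ∏ a : {i // p i = j}, ∏ b, if p b = p a then f (p a) a b else 1 := by
    intro j
    refine Finset.prod_congr rfl fun a _ => ?_
    obtain ⟨a, rfl⟩ := a
    simp only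
    rw [← Finset.prod_filter]
    refine (Finset.prod_subtype _ (fun x => ?_) _).symm
    simp
  rw [Finset.prod_congr rfl fun j _ => h j]
  exact Fintype.prod_fiberwise p fun a => ∏ b, if p b = p a then f (p a) a b else 1

/-- Compatibility of the Koszul sign of a bijection `e` with those of the bijection `t` which it
induces on a set of blocks and of its restrictions to the blocks. -/
theorem sign_blocks {I I' J J' : Type} [Fintype I] [LinearOrder I] [Fintype I'] [LinearOrder I']
    [Fintype J] [LinearOrder J] [LinearOrder J'] (e : I ≃ I') (t : J ≃ J')
    (p : I → J) (p' : I' → J') (h : ∀ i, p' (e i) = t (p i)) (q : I → ℤ) :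
    sign p q * sign e q =
      sign t (fun j => ∑ i : {i // p i = j}, q i) *
        (∏ j, sign (fun i : {i // p i = j} => e i) (fun i => q i)) *
        sign p' (fun i' => q (e.symm i')) := by
  set A : I → I → ℤˣ := fun a b =>
    if (a < b ∧ p b < p a) ∨ (b < a ∧ p a < p b) then swapSign (q a) (q b) else 1 with hA
  set B : I → I → ℤˣ := fun a b =>
    if (a < b ∧ e b < e a) ∨ (b < a ∧ e a < e b) then swapSign (q a) (q b) else 1 with hB
  set C : I → I → ℤˣ := fun a b =>
    if (p a < p b ∧ t (p b) < t (p a)) ∨ (p b < p a ∧ t (p a) < t (p b)) then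
      swapSign (q a) (q b) else 1 with hC
  set D : I → I → ℤˣ := fun a b => if p b = p a ∧ ((a < b ∧ e b < e a) ∨ (b < a ∧ e a < e b)) then
      swapSign (q a) (q b) else 1 with hD
  set E : I → I → ℤˣ := fun a b =>
    if (e a < e b ∧ t (p b) < t (p a)) ∨ (e b < e a ∧ t (p a) < t (p b)) then
      swapSign (q a) (q b) else 1 with hE
  have hlt : ∀ a b : I, a < b → ¬ b < a := fun a b => lt_asymm
  have e1 : sign p q = ∏ a, ∏ b, if a < b then A a b else 1 := by
    refine Finset.prod_congr rfl fun a _ => Finset.prod_congr rfl fun b _ => ?_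
    by_cases hab : a < b
    · simp [hA, hab, hab.not_gt]
    · simp [hA, hab]
  have e2 : sign e q = ∏ a, ∏ b, if a < b then B a b else 1 := by
    refine Finset.prod_congr rfl fun a _ => Finset.prod_congr rfl fun b _ => ?_
    by_cases hab : a < b
    · simp [hB, hab, hab.not_gt]
    · simp [hB, hab]
  have e3 : sign t (fun j => ∑ i : {i // p i = j}, q i) = ∏ a, ∏ b, if a < b then C a b else 1 := by
    have : sign t (fun j => ∑ i : {i // p i = j}, q i) =
        ∏ a, ∏ b, if p a < p b then C a b else 1 := by
      rw [← Fintype.prod_fiberwise p]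
      refine Finset.prod_congr rfl fun j _ => ?_
      have : ∀ a : {i // p i = j}, (∏ b, if p a < p b then C a b else 1) =
          ∏ j', ∏ b : {i // p i = j'}, if j < j' ∧ t j' < t j then swapSign (q a) (q b) else 1 := by
        rintro ⟨a, rfl⟩
        rw [← Fintype.prod_fiberwise p]
        refine Finset.prod_congr rfl fun j' _ => Finset.prod_congr rfl fun b _ => ?_
        obtain ⟨b, rfl⟩ := b
        by_cases hab : p a < p b
        · simp [hC, hab, hab.not_gt]
        · simp [hC, hab]
      rw [Finset.prod_congr rfl fun a _ => this a, Finset.prod_comm]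
      refine Finset.prod_congr rfl fun j' _ => ?_
      by_cases hj : j < j' ∧ t j' < t j
      · simp only [hj, and_self, if_true]
        rw [swapSign_sum_left]
        exact Finset.prod_congr rfl fun a _ => swapSign_sum_right _ _ _
      · simp [hj]
    rw [this]
    refine prod_orient C ?_ (fun a b => p a < p b) (fun a b => a < b)
      (fun a b => lt_asymm) hlt ?_
    · intro a b
      simp only [hC, swapSign_comm (q a) (q b)]
      congr 1
      exact propext or_comm
    · intro a b hab
      have h1 : p a ≠ p b := by
        intro h0
        simp [hC, h0] at hab
      have h2 : a ≠ b := fun h0 => h1 (by rw [h0])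
      exact ⟨lt_or_gt_of_ne h1, lt_or_gt_of_ne h2⟩
  have e4 : (∏ j, sign (fun i : {i // p i = j} => e i) (fun i => q i)) =
      ∏ a, ∏ b, if a < b then D a b else 1 := by
    have := prod_fiber p fun j a b => if a < b ∧ e b < e a then swapSign (q a) (q b) else 1
    simp only [sign]
    refine Eq.trans this ?_
    refine Finset.prod_congr rfl fun a _ => Finset.prod_congr rfl fun b _ => ?_
    by_cases hab : a < b
    · by_cases hp : p b = p a <;> simp [hD, hab, hab.not_gt, hp]
    · by_cases hp : p b = p a <;> simp [hD, hab, hp]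
  have e5 : sign p' (fun i' => q (e.symm i')) = ∏ a, ∏ b, if a < b then E a b else 1 := by
    have : sign p' (fun i' => q (e.symm i')) = ∏ a, ∏ b, if e a < e b then E a b else 1 := by
      rw [sign, ← Equiv.prod_comp e]
      refine Finset.prod_congr rfl fun a _ => ?_
      rw [← Equiv.prod_comp e]
      refine Finset.prod_congr rfl fun b _ => ?_
      by_cases hab : e a < e b
      · simp [hE, hab, hab.not_gt, h]
      · simp [hE, hab, h]
    rw [this]
    refine prod_orient E ?_ (fun a b => e a < e b) (fun a b => a < b)
      (fun a b => lt_asymm) hlt ?_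
    · intro a b
      simp only [hE, swapSign_comm (q a) (q b)]
      congr 1
      exact propext or_comm
    · intro a b hab
      have h2 : a ≠ b := by
        rintro rfl
        simp [hE] at hab
      exact ⟨lt_or_gt_of_ne (fun h0 => h2 (e.injective h0)), lt_or_gt_of_ne h2⟩
  rw [e1, e2, e3, e4, e5]
  simp only [← Finset.prod_mul_distrib]
  refine Finset.prod_congr rfl fun a _ => Finset.prod_congr rfl fun b _ => ?_
  by_cases hab : a < b
  swap
  · simp [hab]
  simp only [hab, if_true]
  have hne : e a ≠ e b := fun h0 => hab.ne (e.injective h0)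
  have hs := swapSign_mul_self (q a) (q b)
  simp only [hA, hB, hC, hD, hE, hab, hab.not_gt, true_and, false_and, or_false]
  rcases lt_trichotomy (p a) (p b) with hp | hp | hp
  · have ht : t (p a) ≠ t (p b) := fun h0 => hp.ne (t.injective h0)
    rcases lt_or_gt_of_ne hne with he | he <;> rcases lt_or_gt_of_ne ht with ht | ht <;>
      simp [hp, hp.not_gt, hp.ne', he, he.not_gt, ht, ht.not_gt, hs]
  · rcases lt_or_gt_of_ne hne with he | he <;> simp [hp, he, he.not_gt]
  · have ht : t (p a) ≠ t (p b) := fun h0 => hp.ne' (t.injective h0)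
    rcases lt_or_gt_of_ne hne with he | he <;> rcases lt_or_gt_of_ne ht with ht | ht <;>
      simp [hp, hp.not_gt, hp.ne, he, he.not_gt, ht, ht.not_gt, hs]

/-- Multiplicativity of the Koszul sign; elements with the same image under `f` must have
commuting degrees. -/
theorem sign_comp {I I' J : Type} [Fintype I] [LinearOrder I] [Fintype I'] [LinearOrder I']
    [LinearOrder J] (e : I ≃ I') (f : I' → J) (q : I → ℤ)
    (h : ∀ a b, a ≠ b → f (e a) = f (e b) → swapSign (q a) (q b) = 1) :
    sign (fun i => f (e i)) q = sign e q * sign f (fun i' => q (e.symm i')) := by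
  set E : I → I → ℤˣ := fun a b =>
    if (e a < e b ∧ f (e b) < f (e a)) ∨ (e b < e a ∧ f (e a) < f (e b)) then
      swapSign (q a) (q b) else 1 with hE
  have e5 : sign f (fun i' => q (e.symm i')) = ∏ a, ∏ b, if a < b then E a b else 1 := by
    have : sign f (fun i' => q (e.symm i')) = ∏ a, ∏ b, if e a < e b then E a b else 1 := by
      rw [sign, ← Equiv.prod_comp e]
      refine Finset.prod_congr rfl fun a _ => ?_
      rw [← Equiv.prod_comp e]
      refine Finset.prod_congr rfl fun b _ => ?_
      by_cases hab : e a < e b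
      · simp [hE, hab, hab.not_gt]
      · simp [hE, hab]
    rw [this]
    refine prod_orient E ?_ (fun a b => e a < e b) (fun a b => a < b)
      (fun a b => lt_asymm) (fun a b => lt_asymm) ?_
    · intro a b
      simp only [hE, swapSign_comm (q a) (q b)]
      congr 1
      exact propext or_comm
    · intro a b hab
      have h2 : a ≠ b := by
        rintro rfl
        simp [hE] at hab
      exact ⟨lt_or_gt_of_ne (fun h0 => h2 (e.injective h0)), lt_or_gt_of_ne h2⟩
  rw [e5]
  simp only [sign, ← Finset.prod_mul_distrib]
  refine Finset.prod_congr rfl fun a _ => Finset.prod_congr rfl fun b _ => ?_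
  by_cases hab : a < b
  swap
  · simp [hab]
  have hne : e a ≠ e b := fun h0 => hab.ne (e.injective h0)
  have hs := swapSign_mul_self (q a) (q b)
  simp only [hE, hab, true_and, if_true]
  rcases lt_trichotomy (f (e a)) (f (e b)) with hp | hp | hp
  · rcases lt_or_gt_of_ne hne with he | he <;> simp [hp, hp.not_gt, he, he.not_gt, hs]
  · have := h a b hab.ne hp
    rcases lt_or_gt_of_ne hne with he | he <;> simp [hp, he, he.not_gt, this]
  · rcases lt_or_gt_of_ne hne with he | he <;> simp [hp, hp.not_gt, he, he.not_gt]

theorem sign_of_monotone {I J : Type} [Fintype I] [LinearOrder I] [LinearOrder J] (p : I → J)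
    (hp : Monotone p) (q : I → ℤ) : sign p q = 1 := by
  refine Finset.prod_eq_one fun a _ => Finset.prod_eq_one fun b _ => ?_
  rw [if_neg]
  rintro ⟨h1, h2⟩
  exact absurd (hp h1.le) h2.not_ge

/-- The effect on a Koszul sign of raising one degree by one. -/
theorem sign_update {I J : Type} [Fintype I] [LinearOrder I] [LinearOrder J] (e : I → J)
    (he : Function.Injective e) (q : I → ℤ) (i : I) :
    (∏ a, if a < i then (q a).negOnePow else 1) * sign e (Function.update q i (q i + 1)) =
      sign e q * ∏ a, if e a < e i then (q a).negOnePow else 1 := by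
  have h1 : sign e (Function.update q i (q i + 1)) = sign e q *
      ∏ a, if (i < a ∧ e a < e i) ∨ (a < i ∧ e i < e a) then (q a).negOnePow else 1 := by
    have h2 : (∏ a, if (i < a ∧ e a < e i) ∨ (a < i ∧ e i < e a) then (q a).negOnePow else 1) =
        ∏ a, ∏ b, (if a < b ∧ e b < e a then
          ((if a = i then (q b).negOnePow else 1) * if b = i then (q a).negOnePow else 1) else 1)
        := by
      have : ∀ a b, (if a < b ∧ e b < e a then
          ((if a = i then (q b).negOnePow else 1) * if b = i then (q a).negOnePow else 1) else 1)
          = (if a = i then (if i < b ∧ e b < e i then (q b).negOnePow else 1) else 1) *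
            (if b = i then (if a < i ∧ e i < e a then (q a).negOnePow else 1) else 1) := by
        intro a b
        by_cases ha : a = i <;> by_cases hb : b = i
        · subst ha; subst hb; simp
        · subst ha; simp [hb]
        · subst hb; simp [ha]
        · simp [ha, hb]
      simp only [this, Finset.prod_mul_distrib]
      rw [Finset.prod_comm (f := fun a b => if a = i then _ else _)]
      simp only [Finset.prod_ite_eq', Finset.mem_univ, if_true]
      rw [← Finset.prod_mul_distrib]
      refine Finset.prod_congr rfl fun a _ => ?_
      rcases lt_trichotomy a i with h | h | h
      · simp [h, h.not_gt]
      · simp [h]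
      · simp [h, h.not_gt]
    rw [h2]
    simp only [sign, ← Finset.prod_mul_distrib]
    refine Finset.prod_congr rfl fun a _ => Finset.prod_congr rfl fun b _ => ?_
    by_cases hab : a < b ∧ e b < e a
    swap
    · simp [hab]
    simp only [hab, and_self, if_true]
    by_cases ha : a = i
    · have hb : b ≠ i := fun hb => hab.1.ne (by rw [ha, hb])
      subst ha
      simp [hb, swapSign, add_mul, Int.negOnePow_add]
    · by_cases hb : b = i
      · subst hb
        simp [ha, swapSign, mul_add, Int.negOnePow_add]
      · simp [ha, hb]
  rw [h1, mul_left_comm, ← Finset.prod_mul_distrib]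
  congr 1
  refine Finset.prod_congr rfl fun a _ => ?_
  have hs : (q a).negOnePow * (q a).negOnePow = 1 := Int.units_mul_self _
  rcases lt_trichotomy a i with h | h | h
  · rcases lt_or_gt_of_ne (fun h0 => h.ne (he h0)) with h' | h' <;>
      simp [h, h.not_gt, h', h'.not_gt, hs]
  · simp [h]
  · rcases lt_or_gt_of_ne (fun h0 => h.ne' (he h0)) with h' | h' <;>
      simp [h, h.not_gt, h', h'.not_gt]

end Koszul

/-! ### Differential graded modules and their tensor powers -/

/-- A differential graded `K`-module `L = ⨁ L^k`, with cohomological grading. -/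
structure DGModule (K : Type u) [CommRing K] where
  /-- The underlying module. -/
  carrier : Type v
  [addCommGroup : AddCommGroup carrier]
  [module : Module K carrier]
  /-- The homogeneous components. -/
  gr : ℤ → Submodule K carrier
  isInternal : DirectSum.IsInternal gr
  /-- The differential. -/
  d : carrier →ₗ[K] carrier
  d_mem : ∀ {k : ℤ} {x : carrier}, x ∈ gr k → d x ∈ gr (k + 1)
  d_d : ∀ x : carrier, d (d x) = 0

namespace DGModule

instance (K : Type u) [CommRing K] : CoeSort (DGModule.{u, v} K) (Type v) := ⟨DGModule.carrier⟩

attribute [instance] DGModule.addCommGroup DGModule.module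

section

variable {K : Type u} [CommRing K] (V : DGModule.{u, v} K) {W : DGModule.{u, w} K}

/-- The decomposition of elements into homogeneous components. -/
noncomputable def decomp : V ≃ₗ[K] DirectSum ℤ fun k => V.gr k :=
  (LinearEquiv.ofBijective (DirectSum.coeLinearMap V.gr) V.isInternal).symm

theorem decomp_of_mem {k : ℤ} {x : V} (hx : x ∈ V.gr k) :
    V.decomp x = DirectSum.lof K ℤ (fun k => V.gr k) k ⟨x, hx⟩ := by
  rw [decomp, LinearEquiv.symm_apply_eq]
  exact (DirectSum.coeLinearMap_lof (A := V.gr) k ⟨x, hx⟩).symm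

theorem coe_decomp (x : V) : DirectSum.coeLinearMap V.gr (V.decomp x) = x :=
  (LinearEquiv.ofBijective (DirectSum.coeLinearMap V.gr) V.isInternal).apply_symm_apply x

theorem span_homogeneous :
    Submodule.span K (Set.range fun x : {x : ℤ × V // x.2 ∈ V.gr x.1} => x.1.2) = ⊤ := by
  rw [eq_top_iff, ← V.isInternal.submodule_iSup_eq_top, iSup_le_iff]
  intro k x hx
  exact Submodule.subset_span ⟨⟨(k, x), hx⟩, rfl⟩

/-- The tensor power of `V` indexed by `I`. -/
abbrev Tens (I : Type) := PiTensorProduct K (fun _ : I => V.carrier)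

/-- The pure tensor `⨂ v i`. -/
noncomputable abbrev pure {I : Type} (v : I → V) : V.Tens I := PiTensorProduct.tprod K v

/-- Linear maps on a tensor power are determined by their values on homogeneous pure tensors. -/
theorem tens_ext {V : DGModule.{u, v} K} {I : Type} [Finite I] {E : Type*} [AddCommGroup E]
    [Module K E] {f g : V.Tens I →ₗ[K] E}
    (h : ∀ (q : I → ℤ) (v : I → V), (∀ i, v i ∈ V.gr (q i)) → f (V.pure v) = g (V.pure v)) :
    f = g :=
  PiTensorProduct.ext_of_span_eq_top (γ := fun _ => {x : ℤ × V // x.2 ∈ V.gr x.1})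
    (g := fun _ x => x.1.2) (fun _ => V.span_homogeneous)
    fun j => h (fun i => (j i).1.1) (fun i => (j i).1.2) fun i => (j i).2

theorem tens_induction {I : Type} [Finite I] {P : V.Tens I → Prop} (h0 : P 0)
    (hadd : ∀ x y, P x → P y → P (x + y)) (hsmul : ∀ (c : K) x, P x → P (c • x))
    (h : ∀ (q : I → ℤ) (v : I → V), (∀ i, v i ∈ V.gr (q i)) → P (V.pure v)) (t : V.Tens I) :
    P t := by
  have hs : Submodule.span K {x : V.Tens I | P x} = ⊤ := by
    have h2 : (Submodule.span K {x : V.Tens I | P x}).mkQ = 0 := tens_ext fun q v hv =>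
      (Submodule.Quotient.mk_eq_zero _).2 (Submodule.subset_span (h q v hv))
    rw [← Submodule.ker_mkQ (Submodule.span K {x : V.Tens I | P x}), h2, LinearMap.ker_zero]
  have ht : t ∈ Submodule.span K {x : V.Tens I | P x} := hs ▸ Submodule.mem_top
  induction ht using Submodule.span_induction with
  | mem x hx => exact hx
  | zero => exact h0
  | add x y _ _ hx hy => exact hadd x y hx hy
  | smul c x _ hx => exact hsmul c x hx

/-- The operator which multiplies `⨂ v i` by `c q` when the `v i` are homogeneous of degrees
`q i`. -/
noncomputable def diagOp {I : Type} [Finite I] [DecidableEq I] (c : (I → ℤ) → K) :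
    V.Tens I →ₗ[K] V.Tens I :=
  PiTensorProduct.lift
    ((MultilinearMap.fromDirectSumEquiv (R := K) (κ := fun _ : I => ℤ)
      (M := fun _ k => V.gr k) fun q =>
        c q • (PiTensorProduct.tprod K).compLinearMap fun i => (V.gr (q i)).subtype).compLinearMap
      fun _ => V.decomp.toLinearMap)

theorem diagOp_pure {I : Type} [Finite I] [DecidableEq I] (c : (I → ℤ) → K) {q : I → ℤ}
    {v : I → V} (hv : ∀ i, v i ∈ V.gr (q i)) : V.diagOp c (V.pure v) = c q • V.pure v := by
  have h : (fun i => V.decomp (v i)) =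
      fun i => DirectSum.lof K ℤ (fun k => V.gr k) (q i) ⟨v i, hv i⟩ :=
    funext fun i => V.decomp_of_mem (hv i)
  rw [diagOp, PiTensorProduct.lift.tprod, MultilinearMap.compLinearMap_apply]
  simp only [LinearEquiv.coe_coe]
  rw [h, MultilinearMap.fromDirectSumEquiv_lof]
  rfl

/-- Two diagonal operators agree on a pure tensor if their coefficients agree on the degrees which
occur in its factors. -/
theorem diagOp_congr {I : Type} [Fintype I] [DecidableEq I] (c c' : (I → ℤ) → K) (v : I → V)
    (h : ∀ q : I → ℤ, (∀ i, V.decomp (v i) (q i) ≠ 0) → c q = c' q) :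
    V.diagOp c (V.pure v) = V.diagOp c' (V.pure v) := by
  classical
  rw [diagOp, diagOp, PiTensorProduct.lift.tprod, PiTensorProduct.lift.tprod,
    MultilinearMap.compLinearMap_apply, MultilinearMap.compLinearMap_apply]
  have h1 := fun c : (I → ℤ) → K => MultilinearMap.fromDFinsuppEquiv_apply (R := K)
    (κ := fun _ : I => ℤ) (M := fun _ k => V.gr k) (fun q =>
        c q • (PiTensorProduct.tprod K).compLinearMap fun i => (V.gr (q i)).subtype)
        (fun i => V.decomp (v i))
  have h2 : ∀ c : (I → ℤ) → K, (MultilinearMap.fromDirectSumEquiv (R := K) (κ := fun _ : I => ℤ)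
      (M := fun _ k => V.gr k) fun q =>
        c q • (PiTensorProduct.tprod K).compLinearMap fun i => (V.gr (q i)).subtype)
        (fun i => V.decomp (v i)) = _ := fun c => Eq.trans (by
          rw [MultilinearMap.fromDirectSumEquiv]; convert! rfl) (h1 c)
  simp only [LinearEquiv.coe_coe]
  rw [h2, h2]
  refine Finset.sum_congr rfl fun q hq => ?_
  rw [h q fun i => DFinsupp.mem_support_iff.1 (Fintype.mem_piFinset.1 hq i)]

/-- The sign operator on `⨂_I V` which belongs to a map `p : I → J`. -/
noncomputable def signOp {I J : Type} [Fintype I] [LinearOrder I] [LinearOrder J] (p : I → J) :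
    V.Tens I →ₗ[K] V.Tens I :=
  V.diagOp fun q => ((Koszul.sign p q : ℤ) : K)

theorem signOp_pure {I J : Type} [Fintype I] [LinearOrder I] [LinearOrder J] (p : I → J)
    {q : I → ℤ} {v : I → V} (hv : ∀ i, v i ∈ V.gr (q i)) :
    V.signOp p (V.pure v) = ((Koszul.sign p q : ℤ) : K) • V.pure v :=
  V.diagOp_pure _ hv

/-- The action of a bijection `e : I ≃ I'` between finite linearly ordered sets on tensors,
with the Koszul sign: the factor at `i` is moved to `e i`. -/
noncomputable def perm {I I' : Type} [Fintype I] [LinearOrder I] [LinearOrder I'] (e : I ≃ I') :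
    V.Tens I →ₗ[K] V.Tens I' :=
  (PiTensorProduct.reindex K (fun _ : I => V.carrier) e).toLinearMap ∘ₗ V.signOp e

theorem perm_pure {I I' : Type} [Fintype I] [LinearOrder I] [LinearOrder I'] (e : I ≃ I')
    {q : I → ℤ} {v : I → V} (hv : ∀ i, v i ∈ V.gr (q i)) :
    V.perm e (V.pure v) = ((Koszul.sign e q : ℤ) : K) • V.pure fun i' => v (e.symm i') := by
  rw [perm, LinearMap.comp_apply, signOp_pure V e hv, map_smul]
  congr 1
  exact PiTensorProduct.reindex_tprod e v

theorem perm_of_monotone {I I' : Type} [Fintype I] [LinearOrder I] [LinearOrder I'] (e : I ≃ I')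
    (he : Monotone e) (v : I → V) : V.perm e (V.pure v) = V.pure fun i' => v (e.symm i') := by
  have h : V.perm e = (PiTensorProduct.reindex K (fun _ : I => V.carrier) e).toLinearMap := by
    refine tens_ext fun q v hv => ?_
    rw [perm_pure V e hv, Koszul.sign_of_monotone e he]
    simp
  rw [h]
  exact PiTensorProduct.reindex_tprod e v

theorem perm_trans {I I' I'' : Type} [Fintype I] [LinearOrder I] [Fintype I'] [LinearOrder I']
    [LinearOrder I''] (e : I ≃ I') (f : I' ≃ I'') (t : V.Tens I) :
    V.perm (e.trans f) t = V.perm f (V.perm e t) := by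
  have h : V.perm (e.trans f) = V.perm f ∘ₗ V.perm e := by
    refine tens_ext fun q v hv => ?_
    rw [LinearMap.comp_apply, perm_pure V e hv, perm_pure V _ hv, map_smul,
      perm_pure V f fun i => hv _, smul_smul]
    have := Koszul.sign_comp e f q fun a b hab h => absurd (e.injective (f.injective h)) hab
    have h2 : Koszul.sign (e.trans f) q = Koszul.sign (fun i => f (e i)) q := rfl
    rw [h2, this]
    push_cast
    rfl
  rw [h, LinearMap.comp_apply]

theorem perm_refl {I : Type} [Fintype I] [LinearOrder I] (t : V.Tens I) :
    V.perm (Equiv.refl I) t = t := by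
  have h : V.perm (Equiv.refl I) = LinearMap.id := by
    refine tens_ext fun q v hv => ?_
    rw [V.perm_of_monotone _ (fun a b h => h)]
    rfl
  rw [h, LinearMap.id_apply]

/-- The part of total degree `k` of a tensor power. -/
def degPart (I : Type) [Fintype I] (k : ℤ) : Submodule K (V.Tens I) :=
  Submodule.span K {t | ∃ (q : I → ℤ) (v : I → V),
    (∀ i, v i ∈ V.gr (q i)) ∧ ∑ i, q i = k ∧ t = V.pure v}

/-- The projection to the part of total degree `k`. -/
noncomputable def degProj (I : Type) [Fintype I] [DecidableEq I] (k : ℤ) :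
    V.Tens I →ₗ[K] V.Tens I :=
  V.diagOp fun q => if ∑ i, q i = k then 1 else 0

theorem degProj_pure {I : Type} [Fintype I] [DecidableEq I] (k : ℤ) {q : I → ℤ} {v : I → V}
    (hv : ∀ i, v i ∈ V.gr (q i)) :
    V.degProj I k (V.pure v) = if ∑ i, q i = k then V.pure v else 0 := by
  rw [degProj, V.diagOp_pure _ hv]
  split_ifs <;> simp

theorem degProj_mem {I : Type} [Fintype I] [DecidableEq I] (k : ℤ) (t : V.Tens I) :
    V.degProj I k t ∈ V.degPart I k := by
  refine V.tens_induction (P := fun t => V.degProj I k t ∈ V.degPart I k) ?_ ?_ ?_ ?_ t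
  · simp
  · intro x y hx hy
    rw [map_add]
    exact add_mem hx hy
  · intro c x hx
    rw [map_smul]
    exact Submodule.smul_mem _ _ hx
  · intro q v hv
    rw [degProj_pure V k hv]
    split_ifs with h
    · exact Submodule.subset_span ⟨q, v, hv, h, rfl⟩
    · exact zero_mem _

theorem degProj_of_mem {I : Type} [Fintype I] [DecidableEq I] {k : ℤ} {t : V.Tens I}
    (ht : t ∈ V.degPart I k) (l : ℤ) : V.degProj I l t = if k = l then t else 0 := by
  induction ht using Submodule.span_induction with
  | mem x hx =>
    obtain ⟨q, v, hv, hq, rfl⟩ := hx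
    rw [degProj_pure V l hv, hq]
  | zero => simp
  | add x y _ _ hx hy =>
    rw [map_add, hx, hy]
    split_ifs <;> simp
  | smul c x _ hx =>
    rw [map_smul, hx]
    split_ifs <;> simp

theorem sum_degProj {I : Type} [Fintype I] [DecidableEq I] (t : V.Tens I) :
    ∃ s : Finset ℤ, ∀ s', s ⊆ s' → ∑ k ∈ s', V.degProj I k t = t := by
  refine V.tens_induction (P := fun t => ∃ s : Finset ℤ, ∀ s', s ⊆ s' →
    ∑ k ∈ s', V.degProj I k t = t) ?_ ?_ ?_ ?_ t
  · exact ⟨∅, fun s' _ => by simp⟩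
  · rintro x y ⟨s, hs⟩ ⟨s2, hs2⟩
    refine ⟨s ∪ s2, fun s' h => ?_⟩
    simp only [map_add, Finset.sum_add_distrib]
    rw [hs s' (Finset.union_subset_left h), hs2 s' (Finset.union_subset_right h)]
  · rintro c x ⟨s, hs⟩
    refine ⟨s, fun s' h => ?_⟩
    simp only [map_smul, ← Finset.smul_sum]
    rw [hs s' h]
  · intro q v hv
    refine ⟨{∑ i, q i}, fun s' h => ?_⟩
    simp only [degProj_pure V _ hv]
    rw [Finset.sum_ite_eq, if_pos (h (Finset.mem_singleton_self _))]

theorem perm_degProj {I I' : Type} [Fintype I] [LinearOrder I] [Fintype I'] [LinearOrder I']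
    (e : I ≃ I') (k : ℤ) (t : V.Tens I) :
    V.perm e (V.degProj I k t) = V.degProj I' k (V.perm e t) := by
  have h : V.perm e ∘ₗ V.degProj I k = V.degProj I' k ∘ₗ V.perm e := by
    refine tens_ext fun q v hv => ?_
    rw [LinearMap.comp_apply, LinearMap.comp_apply, degProj_pure V k hv, perm_pure V e hv,
      map_smul, degProj_pure V k fun i => hv _, Equiv.sum_comp e.symm q]
    split_ifs
    · exact perm_pure V e hv
    · simp
  exact LinearMap.congr_fun h t

/-- The differential of a tensor power, with the Koszul sign:
`d (⨂ v i) = ∑ i, (-1)^(∑ j < i, |v j|) v ⊗ ⋯ ⊗ d (v i) ⊗ ⋯ ⊗ v`. -/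
noncomputable def tensD (I : Type) [Fintype I] [LinearOrder I] : V.Tens I →ₗ[K] V.Tens I :=
  ∑ i : I, PiTensorProduct.map (Function.update (fun _ => LinearMap.id) i V.d) ∘ₗ
    V.diagOp fun q => (((∏ j, if j < i then (q j).negOnePow else 1 : ℤˣ) : ℤ) : K)

theorem tensD_pure {I : Type} [Fintype I] [LinearOrder I] {q : I → ℤ} {v : I → V}
    (hv : ∀ i, v i ∈ V.gr (q i)) :
    V.tensD I (V.pure v) = ∑ i, (((∏ j, if j < i then (q j).negOnePow else 1 : ℤˣ) : ℤ) : K) •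
      V.pure (Function.update v i (V.d (v i))) := by
  rw [tensD, LinearMap.sum_apply]
  refine Finset.sum_congr rfl fun i _ => ?_
  rw [LinearMap.comp_apply, V.diagOp_pure _ hv, map_smul, PiTensorProduct.map_tprod]
  congr 2
  funext j
  by_cases h : j = i
  · subst h; simp
  · simp [h]

theorem update_mem {I : Type} [DecidableEq I] {q : I → ℤ} {v : I → V}
    (hv : ∀ i, v i ∈ V.gr (q i)) (i : I) (j : I) :
    Function.update v i (V.d (v i)) j ∈ V.gr (Function.update q i (q i + 1) j) := by
  by_cases h : j = i
  · subst h
    simpa using V.d_mem (hv j)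
  · simpa [h] using hv j

theorem tensD_mem {I : Type} [Fintype I] [LinearOrder I] {k : ℤ} {t : V.Tens I}
    (ht : t ∈ V.degPart I k) : V.tensD I t ∈ V.degPart I (k + 1) := by
  induction ht using Submodule.span_induction with
  | mem x hx =>
    obtain ⟨q, v, hv, hq, rfl⟩ := hx
    rw [tensD_pure V hv]
    refine sum_mem fun i _ => Submodule.smul_mem _ _ (Submodule.subset_span
      ⟨_, _, V.update_mem hv i, ?_, rfl⟩)
    rw [Finset.sum_update_of_mem (Finset.mem_univ i), ← hq,
      ← Finset.add_sum_erase Finset.univ q (Finset.mem_univ i), Finset.sdiff_singleton_eq_erase]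
    ring
  | zero => simp
  | add x y _ _ hx hy => rw [map_add]; exact add_mem hx hy
  | smul c x _ hx => rw [map_smul]; exact Submodule.smul_mem _ _ hx

theorem tensD_tensD {I : Type} [Fintype I] [LinearOrder I] (t : V.Tens I) :
    V.tensD I (V.tensD I t) = 0 := by
  have h : V.tensD I ∘ₗ V.tensD I = 0 := by
    refine tens_ext fun q v hv => ?_
    rw [LinearMap.comp_apply, tensD_pure V hv, map_sum]
    simp only [map_smul, tensD_pure V (V.update_mem hv _), Finset.smul_sum, smul_smul,
      LinearMap.zero_apply]
    rw [← Finset.sum_product']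
    refine Finset.sum_involution (fun x _ => (x.2, x.1)) ?_ ?_ (by simp) (by simp)
    · have key : ∀ i k : I, i < k →
          ((((∏ j, if j < i then (q j).negOnePow else 1 : ℤˣ) : ℤ) : K) *
            (((∏ j, if j < k then (Function.update q i (q i + 1) j).negOnePow else 1 : ℤˣ) : ℤ) :
              K)) =
          - ((((∏ j, if j < k then (q j).negOnePow else 1 : ℤˣ) : ℤ) : K) *
            (((∏ j, if j < i then (Function.update q k (q k + 1) j).negOnePow else 1 : ℤˣ) : ℤ) :
              K)) := by
        intro i k hik
        have h1 : (∏ j, if j < i then (Function.update q k (q k + 1) j).negOnePow else 1) =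
            ∏ j, if j < i then (q j).negOnePow else 1 := by
          refine Finset.prod_congr rfl fun j _ => ?_
          by_cases hj : j < i
          · rw [Function.update_of_ne (hj.trans hik).ne]
          · simp [hj]
        have h2 : (∏ j, if j < k then (Function.update q i (q i + 1) j).negOnePow else 1) =
            -∏ j, if j < k then (q j).negOnePow else 1 := by
          rw [← Finset.mul_prod_erase _ _ (Finset.mem_univ i),
            ← Finset.mul_prod_erase Finset.univ (fun j => if j < k then (q j).negOnePow else 1)
              (Finset.mem_univ i)]
          simp only [hik, if_true, Function.update_self, Int.negOnePow_succ, neg_mul]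
          congr 2
          refine Finset.prod_congr rfl fun j hj => ?_
          rw [Function.update_of_ne (Finset.ne_of_mem_erase hj)]
        rw [h1, h2]
        push_cast
        ring
      have hpure : ∀ i k : I, i ≠ k → V.pure (Function.update (Function.update v i (V.d (v i))) k
          (V.d (Function.update v i (V.d (v i)) k))) = V.pure (Function.update
          (Function.update v k (V.d (v k))) i (V.d (Function.update v k (V.d (v k)) i))) := by
        intro i k hik
        rw [Function.update_of_ne hik, Function.update_of_ne hik.symm,
          Function.update_comm hik]
      rintro ⟨i, k⟩ -
      rcases lt_trichotomy i k with h | h | h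
      · simp only [key i k h, hpure i k h.ne]
        rw [← add_smul, neg_add_cancel, zero_smul]
      · subst h
        have h0 : V.pure (Function.update (Function.update v i (V.d (v i))) i
          (V.d (Function.update v i (V.d (v i)) i))) = 0 :=
          MultilinearMap.map_coord_zero _ i (by simp [V.d_d])
        simp only [h0, smul_zero, add_zero]
      · simp only [key k i h, hpure k i h.ne]
        rw [← add_smul, add_neg_cancel, zero_smul]
    · rintro ⟨i, k⟩ - hne heq
      simp only [Prod.mk.injEq] at heq
      obtain ⟨h, -⟩ := heq
      subst h
      refine hne ?_
      have h0 : V.pure (Function.update (Function.update v k (V.d (v k))) k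
          (V.d (Function.update v k (V.d (v k)) k))) = 0 :=
          MultilinearMap.map_coord_zero _ k (by simp [V.d_d])
      simp only [h0, smul_zero]
  exact LinearMap.congr_fun h t

theorem perm_tensD {I I' : Type} [Fintype I] [LinearOrder I] [Fintype I'] [LinearOrder I']
    (e : I ≃ I') (t : V.Tens I) : V.perm e (V.tensD I t) = V.tensD I' (V.perm e t) := by
  have h : V.perm e ∘ₗ V.tensD I = V.tensD I' ∘ₗ V.perm e := by
    refine tens_ext fun q v hv => ?_
    rw [LinearMap.comp_apply, LinearMap.comp_apply, tensD_pure V hv, perm_pure V e hv, map_sum,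
      map_smul, tensD_pure V fun i => hv _, Finset.smul_sum, ← Equiv.sum_comp e]
    refine Finset.sum_congr rfl fun i _ => ?_
    rw [map_smul, perm_pure V e (V.update_mem hv i), smul_smul, smul_smul]
    have h1 := Koszul.sign_update e e.injective q i
    have h2 : (∏ j, if j < e i then (q (e.symm j)).negOnePow else 1) =
        ∏ a, if e a < e i then (q a).negOnePow else 1 := by
      rw [← Equiv.prod_comp e]
      simp
    rw [h2]
    congr 1
    · exact_mod_cast congrArg (fun z : ℤˣ => ((z : ℤ) : K)) h1
    · congr 1
      funext j
      by_cases hj : e.symm j = i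
      · subst hj
        simp
      · have : j ≠ e i := fun h0 => hj (by rw [h0, e.symm_apply_apply])
        rw [Function.update_of_ne hj, Function.update_of_ne this]
  exact LinearMap.congr_fun h t

end

end DGModule

/-! ### Rooted trees -/

/-- A rooted tree with set of vertices `I`: a root, and for every vertex the next vertex on the
path to the root (by convention the parent of the root is the root). -/
@[ext]
structure RTree (I : Type) where
  /-- The root. -/
  root : I
  /-- The parent of a vertex. -/
  parent : I → I
  parent_root : parent root = root
  reach : ∀ v, ∃ k : ℕ, parent^[k] v = root

namespace RTree

section

variable {I I' I'' : Type}

noncomputable instance [Fintype I] : Fintype (RTree I) := by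
  classical
  exact Fintype.ofInjective (fun T : RTree I => (T.root, T.parent)) fun T T' h =>
    RTree.ext (congrArg Prod.fst h) (congrArg Prod.snd h)

/-- Induction along the paths to the root. -/
theorem induct (T : RTree I) {P : I → Prop}
    (h : ∀ v, (v ≠ T.root → P (T.parent v)) → P v) (v : I) : P v := by
  obtain ⟨k, hk⟩ := T.reach v
  induction k generalizing v with
  | zero => exact h v fun hv => absurd hk hv
  | succ k ih => exact h v fun _ => ih _ hk

/-- Relabelling of the vertices. For permutations this is the action of the symmetric group. -/
def map (T : RTree I) (e : I ≃ I') : RTree I' where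
  root := e T.root
  parent v := e (T.parent (e.symm v))
  parent_root := by simp [T.parent_root]
  reach v := by
    obtain ⟨k, hk⟩ := T.reach (e.symm v)
    refine ⟨k, ?_⟩
    have h : Function.Semiconj e T.parent fun v => e (T.parent (e.symm v)) := fun x => by simp
    have := (h.iterate_right k) (e.symm v)
    rw [e.apply_symm_apply] at this
    rw [← this, hk]

theorem map_parent (T : RTree I) (e : I ≃ I') (v : I) :
    (T.map e).parent (e v) = e (T.parent v) := by simp [map]

theorem map_map (T : RTree I) (e : I ≃ I') (f : I' ≃ I'') :
    (T.map e).map f = T.map (e.trans f) := rfl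

theorem map_refl (T : RTree I) : T.map (Equiv.refl I) = T := rfl

/-- The tree is a corolla: all vertices other than the root are attached to the root. -/
def IsCorolla (T : RTree I) : Prop := ∀ v, T.parent v = T.root

theorem isCorolla_map (T : RTree I) (e : I ≃ I') : (T.map e).IsCorolla ↔ T.IsCorolla := by
  constructor
  · intro h v
    simpa [map] using h (e v)
  · intro h v
    simp [map, h (e.symm v)]

/-- A way to cut a tree into connected blocks, given by the set of the roots of the blocks, which
is an arbitrary set of vertices that contains the root of the tree: the edge from `v` to its parent
is cut when `v` is in this set and `v` is not the root. -/
def Cut (T : RTree I) : Type := {R : Finset I // T.root ∈ R}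

noncomputable instance [Fintype I] (T : RTree I) : Fintype T.Cut := by
  classical
  exact inferInstanceAs (Fintype {R : Finset I // T.root ∈ R})

/-- The set of the blocks of a cut; a block is represented by its root. -/
abbrev Cut.Blocks {T : RTree I} (R : T.Cut) : Type := {v : I // v ∈ R.1}

section

variable [DecidableEq I] [DecidableEq I'] (T : RTree I) (R : T.Cut)

theorem exists_mem {I : Type} (T : RTree I) (R : T.Cut) (v : I) : ∃ k : ℕ, T.parent^[k] v ∈ R.1 := by
  obtain ⟨k, hk⟩ := T.reach v
  exact ⟨k, by rw [hk]; exact R.2⟩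

/-- The block of a vertex, that is the first root of a block on the path to the root. -/
def block (v : I) : R.Blocks := ⟨T.parent^[Nat.find (T.exists_mem R v)] v,
  Nat.find_spec (T.exists_mem R v)⟩

theorem block_of_mem {v : I} (hv : v ∈ R.1) : T.block R v = ⟨v, hv⟩ := by
  have h : Nat.find (T.exists_mem R v) = 0 := (Nat.find_eq_zero _).2 hv
  refine Subtype.ext ?_
  simp only [block, h]
  rfl

theorem block_of_notMem {v : I} (hv : v ∉ R.1) : T.block R v = T.block R (T.parent v) := by
  refine Subtype.ext ?_
  simp only [block]
  rw [Nat.find_comp_succ (T.exists_mem R v) (T.exists_mem R (T.parent v)) hv]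
  rfl

/-- The tree of the blocks, which is obtained by contracting every block to a point. -/
def contract : RTree R.Blocks where
  root := ⟨T.root, R.2⟩
  parent r := T.block R (T.parent r.1)
  parent_root := by
    simp only [T.parent_root]
    exact T.block_of_mem R R.2
  reach := by
    have h : ∀ v, ∃ k : ℕ, (fun r : R.Blocks => T.block R (T.parent r.1))^[k] (T.block R v) =
        ⟨T.root, R.2⟩ := by
      refine T.induct fun v ih => ?_
      by_cases hv : v = T.root
      · subst hv
        exact ⟨0, T.block_of_mem R R.2⟩
      · obtain ⟨k, hk⟩ := ih hv
        by_cases hR : v ∈ R.1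
        · rw [T.block_of_mem R hR]
          exact ⟨k + 1, hk⟩
        · rw [T.block_of_notMem R hR]
          exact ⟨k, hk⟩
    intro r
    obtain ⟨k, hk⟩ := h r.1
    rw [T.block_of_mem R r.2] at hk
    exact ⟨k, hk⟩

/-- The subtree formed by a block. -/
def restrict (r : R.Blocks) : RTree {v : I // T.block R v = r} where
  root := ⟨r.1, T.block_of_mem R r.2⟩
  parent v := if h : v.1 ∈ R.1 then v else ⟨T.parent v.1, T.block_of_notMem R h ▸ v.2⟩
  parent_root := by simp [r.2]
  reach := by
    rintro ⟨v, hv⟩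
    induction v using T.induct with
    | h v ih =>
      by_cases hR : v ∈ R.1
      · refine ⟨0, Subtype.ext ?_⟩
        have h := hv
        rw [T.block_of_mem R hR] at h
        have h2 : v = r.1 := congrArg Subtype.val h
        exact h2
      · have h1 : v ≠ T.root := fun h => hR (h ▸ R.2)
        obtain ⟨k, hk⟩ := ih h1 (T.block_of_notMem R hR ▸ hv)
        refine ⟨k + 1, ?_⟩
        rw [Function.iterate_succ_apply]
        simpa [hR] using hk

theorem restrict_parent (r : R.Blocks) (v : {v : I // T.block R v = r}) :
    ((T.restrict R r).parent v).1 = if v.1 ∈ R.1 then v.1 else T.parent v.1 := by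
  by_cases h : v.1 ∈ R.1 <;> simp [restrict, h]

/-- Transport of a cut along a relabelling. -/
def Cut.map (e : I ≃ I') : (T.map e).Cut :=
  ⟨R.1.map e.toEmbedding, Finset.mem_map_of_mem e.toEmbedding R.2⟩

/-- Cuts of a tree and of a relabelling of it correspond to each other. -/
def cutEquiv (e : I ≃ I') : T.Cut ≃ (T.map e).Cut where
  toFun R := Cut.map T R e
  invFun R := ⟨R.1.map e.symm.toEmbedding, by
    have h := R.2
    simpa [RTree.map] using h⟩
  left_inv R := Subtype.ext (Finset.ext fun v => by simp [Cut.map])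
  right_inv R := Subtype.ext (Finset.ext fun v => by simp [Cut.map])

/-- Transport of the blocks of a cut. -/
def blocksEquiv (e : I ≃ I') : R.Blocks ≃ (Cut.map T R e).Blocks :=
  e.subtypeEquiv fun v => by simp [Cut.map]

theorem block_map (e : I ≃ I') (v : I) :
    (T.map e).block (Cut.map T R e) (e v) = T.blocksEquiv R e (T.block R v) := by
  induction v using T.induct with
  | h v ih =>
    by_cases hR : v ∈ R.1
    · rw [T.block_of_mem R hR,
        (T.map e).block_of_mem (Cut.map T R e) (v := e v) (by simpa [Cut.map] using hR)]
      rfl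
    · have h1 : v ≠ T.root := fun h => hR (h ▸ R.2)
      rw [T.block_of_notMem R hR, ← ih h1,
        (T.map e).block_of_notMem (Cut.map T R e) (v := e v) (by simpa [Cut.map] using hR)]
      simp [RTree.map]

theorem contract_map (e : I ≃ I') :
    (T.contract R).map (T.blocksEquiv R e) = (T.map e).contract (Cut.map T R e) := by
  refine RTree.ext rfl (funext fun r => ?_)
  obtain ⟨r, rfl⟩ := (T.blocksEquiv R e).surjective r
  have h : (T.map e).parent (T.blocksEquiv R e r).1 = e (T.parent r.1) := by
    simp [RTree.map, blocksEquiv]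
  simp only [contract, h, block_map]
  simp [RTree.map]

/-- Transport of the vertices of a block. -/
def fiberEquiv (e : I ≃ I') (r : (Cut.map T R e).Blocks) :
    {v // T.block R v = (T.blocksEquiv R e).symm r} ≃
      {v // (T.map e).block (Cut.map T R e) v = r} :=
  e.subtypeEquiv fun v => by rw [block_map, Equiv.eq_symm_apply]

theorem restrict_map (e : I ≃ I') (r : (Cut.map T R e).Blocks) :
    (T.restrict R ((T.blocksEquiv R e).symm r)).map (T.fiberEquiv R e r) =
      (T.map e).restrict (Cut.map T R e) r := by
  refine RTree.ext (Subtype.ext ?_) (funext fun v => Subtype.ext ?_)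
  · exact e.apply_symm_apply r.1
  · obtain ⟨v, rfl⟩ := (T.fiberEquiv R e r).surjective v
    have h0 : (T.fiberEquiv R e r v).1 = e v.1 := rfl
    have h1 : e v.1 ∈ (Cut.map T R e).1 ↔ v.1 ∈ R.1 := by simp [Cut.map]
    have h2 : (((T.restrict R ((T.blocksEquiv R e).symm r)).map (T.fiberEquiv R e r)).parent
        (T.fiberEquiv R e r v)).1 =
        e ((T.restrict R ((T.blocksEquiv R e).symm r)).parent v).1 := by
      rw [map_parent]
      rfl
    rw [h2, restrict_parent, restrict_parent, h0]
    simp only [h1]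
    split_ifs
    · rfl
    · simp [RTree.map]

end

end

end RTree

/-! ### Tensor products of tensor powers -/

namespace DGModule

section

variable {K : Type u} [CommRing K]

/-- Auxiliary construction for `joinAux`. -/
noncomputable def joinAux' (K : Type u) [CommRing K] (M : Type v) [AddCommGroup M] [Module K M]
    [Module Kᵐᵒᵖ M] [IsCentralScalar K M] {I J : Type} [Fintype J] [DecidableEq J] (p : I → J) :
    PiTensorProduct K (fun j : J => PiTensorProduct K fun _ : {i // p i = j} => M) →ₗ[K]
      PiTensorProduct K fun _ : I => M :=
  PiTensorProduct.map (fun _ : I => TrivSqZeroExt.sndHom K M) ∘ₗ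
    PiTensorProduct.lift
      ((MultilinearMap.mkPiAlgebra K J
        (PiTensorProduct K fun _ : I => TrivSqZeroExt K M)).compLinearMap fun j =>
          PiTensorProduct.lift
            (((PiTensorProduct.tprod K).domDomRestrict (fun i => p i = j) fun _ => 1).compLinearMap
              fun _ => TrivSqZeroExt.inrHom K M))

theorem joinAux'_tprod (M : Type v) [AddCommGroup M] [Module K M]
    [Module Kᵐᵒᵖ M] [IsCentralScalar K M]
    {I J : Type} [Fintype J] [DecidableEq J] (p : I → J) (v : I → M) :
    joinAux' K M p (PiTensorProduct.tprod K fun j =>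
      PiTensorProduct.tprod K fun i : {i // p i = j} => v i) = PiTensorProduct.tprod K v := by
  simp only [joinAux', LinearMap.comp_apply, PiTensorProduct.lift.tprod,
    MultilinearMap.compLinearMap_apply, MultilinearMap.mkPiAlgebra_apply,
    MultilinearMap.domDomRestrict_apply]
  rw [← PiTensorProduct.tprod_prod, PiTensorProduct.map_tprod]
  congr 1
  funext i
  simp only [Finset.prod_apply]
  rw [Finset.prod_eq_single (p i)]
  · simp
  · intro j _ hj
    simp [hj.symm]
  · simp

/-- The canonical linear map `⨂_j ⨂_{p i = j} M → ⨂_i M`, without signs. It is characterised by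
`joinAux_tprod`. (It is constructed by means of the products in the commutative ring
`⨂_i (K ⊕ M)`, where `K ⊕ M` is the square zero extension.) -/
noncomputable def joinAux (K : Type u) [CommRing K] (M : Type v) [AddCommGroup M] [Module K M]
    {I J : Type} [Fintype J] [DecidableEq J] (p : I → J) :
    PiTensorProduct K (fun j : J => PiTensorProduct K fun _ : {i // p i = j} => M) →ₗ[K]
      PiTensorProduct K fun _ : I => M :=
  letI : Module Kᵐᵒᵖ M := Module.compHom M ((RingHom.id K).fromOpposite fun _ _ => Commute.all _ _)
  haveI : IsCentralScalar K M := ⟨fun _ _ => rfl⟩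
  joinAux' K M p

theorem joinAux_tprod (M : Type v) [AddCommGroup M] [Module K M]
    {I J : Type} [Fintype J] [DecidableEq J] (p : I → J) (v : I → M) :
    joinAux K M p (PiTensorProduct.tprod K fun j =>
      PiTensorProduct.tprod K fun i : {i // p i = j} => v i) = PiTensorProduct.tprod K v := by
  let _ : Module Kᵐᵒᵖ M := Module.compHom M ((RingHom.id K).fromOpposite fun _ _ => Commute.all _ _)
  have _ : IsCentralScalar K M := ⟨fun _ _ => rfl⟩
  exact joinAux'_tprod M p v

variable (V : DGModule.{u, v} K)

/-- The canonical map `⨂_j ⨂_{p i = j} V → ⨂_i V`, with the Koszul sign which comes from the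
reordering of the factors: on the left hand side they are ordered lexicographically, first by
`p i`, then by `i`. -/
noncomputable def join {I J : Type} [Fintype I] [LinearOrder I] [Fintype J] [LinearOrder J]
    (p : I → J) : PiTensorProduct K (fun j : J => V.Tens {i // p i = j}) →ₗ[K] V.Tens I :=
  V.signOp p ∘ₗ joinAux K V.carrier p

theorem join_pure {I J : Type} [Fintype I] [LinearOrder I] [Fintype J] [LinearOrder J]
    (p : I → J) {q : I → ℤ} {v : I → V} (hv : ∀ i, v i ∈ V.gr (q i)) :
    V.join p (PiTensorProduct.tprod K fun j => V.pure fun i : {i // p i = j} => v i) =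
      ((Koszul.sign p q : ℤ) : K) • V.pure v := by
  rw [join, LinearMap.comp_apply, joinAux_tprod, signOp_pure V p hv]

/-- The homogeneous pure tensors span the part of a given total degree. -/
theorem span_degPart (I : Type) [Fintype I] (k : ℤ) :
    Submodule.span K (Set.range fun x : {x : (I → ℤ) × (I → V) // (∀ i, x.2 i ∈ V.gr (x.1 i)) ∧
      ∑ i, x.1 i = k} => (⟨V.pure x.1.2, Submodule.subset_span
        ⟨x.1.1, x.1.2, x.2.1, x.2.2, rfl⟩⟩ : V.degPart I k)) = ⊤ := by
  refine (Submodule.span_range_subtype_eq_top_iff (V.degPart I k) (s := fun x :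
    {x : (I → ℤ) × (I → V) // (∀ i, x.2 i ∈ V.gr (x.1 i)) ∧ ∑ i, x.1 i = k} => V.pure x.1.2)
    fun x => Submodule.subset_span ⟨x.1.1, x.1.2, x.2.1, x.2.2, rfl⟩).2 ?_
  rw [degPart]
  congr 1
  ext t
  constructor
  · rintro ⟨⟨⟨q, v⟩, h1, h2⟩, rfl⟩
    exact ⟨q, v, h1, h2, rfl⟩
  · rintro ⟨q, v, h1, h2, rfl⟩
    exact ⟨⟨⟨q, v⟩, h1, h2⟩, rfl⟩

/-- The map `join` is equivariant. -/
theorem perm_join {I I' J J' : Type} [Fintype I] [LinearOrder I] [Fintype I'] [LinearOrder I']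
    [Fintype J] [LinearOrder J] [Fintype J'] [LinearOrder J'] (e : I ≃ I') (t : J ≃ J')
    (p : I → J) (p' : I' → J') (h : ∀ i, p' (e i) = t (p i))
    (s : ∀ j', {i // p i = t.symm j'} ≃ {i' // p' i' = j'}) (hs : ∀ j' i, (s j' i).1 = e i.1)
    (k : J → ℤ) (x : ∀ j, V.degPart {i // p i = j} (k j)) :
    V.perm e (V.join p (PiTensorProduct.tprod K fun j => (x j).1)) =
      ((Koszul.sign t k : ℤ) : K) • V.join p'
        (PiTensorProduct.tprod K fun j' => V.perm (s j') (x (t.symm j')).1) := by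
  set f : MultilinearMap K (fun j => V.degPart {i // p i = j} (k j)) (V.Tens I') :=
    (V.perm e ∘ₗ V.join p).compMultilinearMap
      ((PiTensorProduct.tprod K).compLinearMap fun j => Submodule.subtype _) with hf
  set g : MultilinearMap K (fun j => V.degPart {i // p i = j} (k j)) (V.Tens I') :=
    (((Koszul.sign t k : ℤ) : K) • V.join p' ∘ₗ
      PiTensorProduct.map (fun j' => V.perm (s j')) ∘ₗ
        (PiTensorProduct.reindex K (fun j => V.Tens {i // p i = j}) t).toLinearMap
      ).compMultilinearMap
      ((PiTensorProduct.tprod K).compLinearMap fun j => Submodule.subtype _) with hg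
  have hfg : f = g := by
    refine MultilinearMap.ext_of_span_eq_top (γ := fun j => {x : ({i // p i = j} → ℤ) ×
      ({i // p i = j} → V) // (∀ i, x.2 i ∈ V.gr (x.1 i)) ∧ ∑ i, x.1 i = k j})
      (fun j => V.span_degPart {i // p i = j} (k j)) fun y => ?_
    set q : I → ℤ := fun i => (y (p i)).1.1 ⟨i, rfl⟩ with hq
    set v : I → V := fun i => (y (p i)).1.2 ⟨i, rfl⟩ with hv
    have hqy : ∀ j (i : {i // p i = j}), (y j).1.1 i = q i.1 := by
      rintro j ⟨i, rfl⟩; rfl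
    have hvy : ∀ j (i : {i // p i = j}), (y j).1.2 i = v i.1 := by
      rintro j ⟨i, rfl⟩; rfl
    have hvq : ∀ i, v i ∈ V.gr (q i) := fun i => (y (p i)).2.1 ⟨i, rfl⟩
    have hk : k = fun j => ∑ i : {i // p i = j}, q i := by
      funext j
      rw [← (y j).2.2]
      exact Finset.sum_congr rfl fun i _ => hqy j i
    have hy : ∀ j, V.pure (y j).1.2 = V.pure fun i : {i // p i = j} => v i :=
      fun j => congrArg V.pure (funext (hvy j))
    have hl : f (fun j => ⟨V.pure (y j).1.2, Submodule.subset_span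
        ⟨(y j).1.1, (y j).1.2, (y j).2.1, (y j).2.2, rfl⟩⟩) =
        V.perm e (V.join p (PiTensorProduct.tprod K fun j => V.pure fun i : {i // p i = j} =>
          v i)) := by
      rw [hf]
      simp only [LinearMap.compMultilinearMap_apply, MultilinearMap.compLinearMap_apply,
        LinearMap.comp_apply, Submodule.subtype_apply, hy]
    have hr : g (fun j => ⟨V.pure (y j).1.2, Submodule.subset_span
        ⟨(y j).1.1, (y j).1.2, (y j).2.1, (y j).2.2, rfl⟩⟩) =
        ((Koszul.sign t k : ℤ) : K) • V.join p' (PiTensorProduct.tprod K fun j' =>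
          V.perm (s j') (V.pure fun i : {i // p i = t.symm j'} => v i)) := by
      rw [hg]
      simp only [LinearMap.compMultilinearMap_apply, MultilinearMap.compLinearMap_apply,
        LinearMap.smul_apply, LinearMap.comp_apply, Submodule.subtype_apply, hy,
        LinearEquiv.coe_coe, PiTensorProduct.reindex_tprod, PiTensorProduct.map_tprod]
    refine hl.trans (Eq.trans ?_ hr.symm)
    rw [join_pure V p hvq, map_smul, perm_pure V e hvq, smul_smul]
    have hsymm : ∀ j' (i' : {i' // p' i' = j'}), ((s j').symm i').1 = e.symm i'.1 := by
      intro j' i'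
      rw [Equiv.eq_symm_apply, ← hs, Equiv.apply_symm_apply]
    have h3 : ∀ j', V.perm (s j') (V.pure fun i : {i // p i = t.symm j'} => v i) =
        ((Koszul.sign (s j') (fun i => q i) : ℤ) : K) •
          V.pure fun i' : {i' // p' i' = j'} => v (e.symm i') := by
      intro j'
      rw [perm_pure V (s j') (q := fun i => q i.1) fun i => hvq _]
      simp only [hsymm]
    simp only [h3]
    rw [MultilinearMap.map_smul_univ, map_smul, join_pure V p' fun i => hvq (e.symm i),
      smul_smul, smul_smul]
    congr 1
    have h4 := Koszul.sign_blocks e t p p' h q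
    have h5 : (∏ j, Koszul.sign (fun i : {i // p i = j} => e i) (fun i => q i)) =
        ∏ j', Koszul.sign (s j') (fun i => q i) := by
      rw [← Equiv.prod_comp t.symm]
      refine Finset.prod_congr rfl fun j' _ => ?_
      refine Finset.prod_congr rfl fun a _ => Finset.prod_congr rfl fun b _ => ?_
      have : ∀ a b, s j' a < s j' b ↔ e a < e b := by
        intro a b
        rw [← hs j' a, ← hs j' b]
        rfl
      simp only [this]
    rw [h5, ← hk] at h4
    have h6 := congrArg (fun z : ℤˣ => ((z : ℤ) : K)) h4
    push_cast at h6 ⊢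
    rw [h6]
  have := congrArg (fun f => f x) hfg
  simp only [hf, hg] at this
  simpa [PiTensorProduct.reindex_tprod, PiTensorProduct.map_tprod] using this

end

end DGModule

/-! ### The free algebra with divided powers on a differential graded module -/

theorem isInternal_of_proj {K : Type u} [CommRing K] {M : Type v} [AddCommGroup M] [Module K M]
    (gr : ℤ → Submodule K M) (π : ℤ → M →ₗ[K] M)
    (h1 : ∀ k, ∀ x ∈ gr k, ∀ l, π l x = if k = l then x else 0) (h2 : ∀ k x, π k x ∈ gr k)
    (h3 : ∀ x, ∃ s : Finset ℤ, ∑ k ∈ s, π k x = x) : DirectSum.IsInternal gr := by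
  have h4 : ∀ (l : ℤ) (x : DirectSum ℤ fun k => gr k),
      π l (DirectSum.coeLinearMap gr x) = (x l : M) := by
    intro l x
    induction x using DirectSum.induction_on with
    | zero => simp
    | of k x =>
      rw [DirectSum.coeLinearMap_of, h1 k x x.2, DirectSum.coe_of_apply]
      split_ifs <;> rfl
    | add x y hx hy => rw [map_add, map_add, hx, hy]; rfl
  refine ⟨fun x y hxy => DFinsupp.ext fun l => Subtype.ext ?_, fun x => ?_⟩
  · exact (h4 l x).symm.trans ((congrArg (π l) hxy).trans (h4 l y))
  · obtain ⟨s, hs⟩ := h3 x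
    refine ⟨∑ k ∈ s, DirectSum.of (fun k => gr k) k ⟨π k x, h2 k x⟩, ?_⟩
    rw [map_sum]
    refine Eq.trans (Finset.sum_congr rfl fun k _ => ?_) hs
    exact DirectSum.coeLinearMap_of gr k ⟨π k x, h2 k x⟩

namespace DGModule

section

variable {K : Type u} [CommRing K] (V : DGModule.{u, v} K)

/-- The module `⨁_n (PreLie(n) ⊗ V^{⊗ n})^{Σ_n}`, where `PreLie(n)` is the free module on the
rooted trees with set of vertices `{0, …, n - 1}`. The function `f` stands for the element
`∑_n ∑_T T ⊗ f n T`; the second condition says that it is invariant under the diagonal actions of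
the symmetric groups. -/
def gammaSubmodule : Submodule K (∀ n : ℕ, RTree (Fin n) → V.Tens (Fin n)) where
  carrier := {f | (∃ B : ℕ, ∀ n, B ≤ n → ∀ T, f n T = 0) ∧
    ∀ (n : ℕ) (σ : Equiv.Perm (Fin n)) (T : RTree (Fin n)), V.perm σ (f n T) = f n (T.map σ)}
  add_mem' := by
    rintro f g ⟨⟨B, hB⟩, hf⟩ ⟨⟨C, hC⟩, hg⟩
    refine ⟨⟨max B C, fun n hn T => ?_⟩, fun n σ T => ?_⟩
    · simp [hB n (le_of_max_le_left hn), hC n (le_of_max_le_right hn)]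
    · simp [hf, hg]
  zero_mem' := ⟨⟨0, fun _ _ _ => rfl⟩, fun n σ T => by simp⟩
  smul_mem' := by
    rintro c f ⟨⟨B, hB⟩, hf⟩
    exact ⟨⟨B, fun n hn T => by simp [hB n hn]⟩, fun n σ T => by simp [hf]⟩

/-- Linear operators on the tensor powers which commute with the actions of the symmetric groups
induce operators on the modules of invariants. -/
def gammaLift {W : DGModule.{u, w} K} (A : ∀ n, V.Tens (Fin n) →ₗ[K] W.Tens (Fin n))
    (hA : ∀ n (σ : Equiv.Perm (Fin n)) t, W.perm σ (A n t) = A n (V.perm σ t)) :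
    V.gammaSubmodule →ₗ[K] W.gammaSubmodule where
  toFun f := ⟨fun n T => A n (f.1 n T), by
    obtain ⟨B, hB⟩ := f.2.1
    exact ⟨B, fun n hn T => (congrArg (A n) (hB n hn T)).trans (map_zero _)⟩,
    fun n σ T => (hA n σ _).trans (congrArg (A n) (f.2.2 n σ T))⟩
  map_add' f g := by
    refine Subtype.ext (funext fun n => funext fun T => ?_)
    exact map_add (A n) _ _
  map_smul' c f := by
    refine Subtype.ext (funext fun n => funext fun T => ?_)
    exact map_smul (A n) _ _

/-- The differential graded module `Γ(PreLie, V) = ⨁_n (PreLie(n) ⊗ V^{⊗ n})^{Σ_n}`. -/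
noncomputable def Gamma : DGModule.{u, max u v} K where
  carrier := V.gammaSubmodule
  gr k :=
    { carrier := {f | ∀ n T, f.1 n T ∈ V.degPart (Fin n) k}
      add_mem' := fun hf hg n T => add_mem (hf n T) (hg n T)
      zero_mem' := fun n T => zero_mem _
      smul_mem' := fun c f hf n T => Submodule.smul_mem _ c (hf n T) }
  isInternal := by
    refine isInternal_of_proj _ (fun k => V.gammaLift (fun n => V.degProj (Fin n) k)
      fun n σ t => V.perm_degProj σ k t) ?_ ?_ ?_
    · intro k f hf l
      refine Subtype.ext (funext fun n => funext fun T => ?_)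
      refine (V.degProj_of_mem (hf n T) l).trans ?_
      split_ifs <;> rfl
    · exact fun k f n T => V.degProj_mem k _
    · intro f
      obtain ⟨B, hB⟩ := f.2.1
      choose s hs using fun n T => V.sum_degProj (f.1 n T)
      refine ⟨(Finset.range B).biUnion fun n => Finset.univ.biUnion fun T => s n T,
        Subtype.ext (funext fun n => funext fun T => ?_)⟩
      rw [AddSubmonoidClass.coe_finsetSum, Finset.sum_apply, Finset.sum_apply]
      by_cases hn : n < B
      · refine hs n T _ fun k hk => ?_
        exact Finset.mem_biUnion.2 ⟨n, Finset.mem_range.2 hn,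
          Finset.mem_biUnion.2 ⟨T, Finset.mem_univ T, hk⟩⟩
      · have h0 := hB n (not_lt.1 hn) T
        rw [h0]
        refine Finset.sum_eq_zero fun k _ => ?_
        change V.degProj (Fin n) k (f.1 n T) = 0
        rw [h0, map_zero]
  d := V.gammaLift (fun n => V.tensD (Fin n)) fun n σ t => V.perm_tensD σ t
  d_mem := fun hf n T => V.tensD_mem (hf n T)
  d_d f := Subtype.ext (funext fun n => funext fun T => V.tensD_tensD _)

/-- The component of an element of `Γ(PreLie, V)` at a tree whose set of vertices is an arbitrary
finite linearly ordered set. -/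
noncomputable def ev {I : Type} [Fintype I] [LinearOrder I] (T : RTree I) :
    V.Gamma →ₗ[K] V.Tens I where
  toFun f := V.perm (Fintype.orderIsoFinOfCardEq I rfl).toEquiv
    (f.1 (Fintype.card I) (T.map (Fintype.orderIsoFinOfCardEq I rfl).toEquiv.symm))
  map_add' _ _ := map_add (V.perm _) _ _
  map_smul' _ _ := map_smul (V.perm _) _ _

theorem ev_eq {I : Type} [Fintype I] [LinearOrder I] (T : RTree I) (f : V.Gamma) {n : ℕ}
    (e : Fin n ≃ I) : V.ev T f = V.perm e (f.1 n (T.map e.symm)) := by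
  have h : n = Fintype.card I := by rw [← Fintype.card_congr e, Fintype.card_fin]
  subst h
  set o : Fin (Fintype.card I) ≃ I := (Fintype.orderIsoFinOfCardEq I rfl).toEquiv with ho
  have h2 := f.2.2 _ (e.trans o.symm) (T.map e.symm)
  have h3 : (T.map e.symm).map (e.trans o.symm) = T.map o.symm := by
    rw [RTree.map_map]
    congr 1
    ext i
    simp
  rw [h3] at h2
  change V.perm o (f.1 _ (T.map o.symm)) = _
  rw [← h2, ← V.perm_trans]
  congr 2
  ext i
  simp

theorem perm_ev {I I' : Type} [Fintype I] [LinearOrder I] [Fintype I'] [LinearOrder I']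
    (T : RTree I) (e : I ≃ I') (f : V.Gamma) : V.perm e (V.ev T f) = V.ev (T.map e) f := by
  set o : Fin (Fintype.card I) ≃ I := (Fintype.orderIsoFinOfCardEq I rfl).toEquiv with ho
  have h : (T.map e).map (o.trans e).symm = T.map o.symm := by
    rw [RTree.map_map]
    congr 1
    ext i
    simp
  rw [V.ev_eq T f o, V.ev_eq (T.map e) f (o.trans e), V.perm_trans, h]

theorem perm_mem {I I' : Type} [Fintype I] [LinearOrder I] [Fintype I'] [LinearOrder I']
    (e : I ≃ I') {k : ℤ} {t : V.Tens I} (ht : t ∈ V.degPart I k) :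
    V.perm e t ∈ V.degPart I' k := by
  have h := V.degProj_of_mem ht k
  rw [if_pos rfl] at h
  rw [← h, perm_degProj]
  exact V.degProj_mem k _

theorem ev_mem {I : Type} [Fintype I] [LinearOrder I] (T : RTree I) {k : ℤ} {f : V.Gamma}
    (hf : f ∈ V.Gamma.gr k) : V.ev T f ∈ V.degPart I k :=
  V.perm_mem _ (hf _ _)

/-- The part of the multiplication of the monad `Γ(PreLie, -)` which belongs to a cut `R` of the
tree `S`. -/
noncomputable def muCut {I : Type} [Fintype I] [LinearOrder I] (S : RTree I) (R : S.Cut) :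
    V.Gamma.Tens R.Blocks →ₗ[K] V.Tens I :=
  V.join (S.block R) ∘ₗ PiTensorProduct.map fun r => V.ev (S.restrict R r)

theorem muCut_pure {I : Type} [Fintype I] [LinearOrder I] (S : RTree I) (R : S.Cut)
    (g : R.Blocks → V.Gamma) : V.muCut S R (V.Gamma.pure g) =
      V.join (S.block R) (PiTensorProduct.tprod K fun r => V.ev (S.restrict R r) (g r)) := by
  rw [muCut, LinearMap.comp_apply, PiTensorProduct.map_tprod]

theorem perm_muCut {I I' : Type} [Fintype I] [LinearOrder I] [Fintype I'] [LinearOrder I']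
    (S : RTree I) (R : S.Cut) (e : I ≃ I') (u : V.Gamma.Tens R.Blocks) :
    V.perm e (V.muCut S R u) =
      V.muCut (S.map e) (RTree.Cut.map S R e) (V.Gamma.perm (S.blocksEquiv R e) u) := by
  have h : V.perm e ∘ₗ V.muCut S R =
      V.muCut (S.map e) (RTree.Cut.map S R e) ∘ₗ V.Gamma.perm (S.blocksEquiv R e) := by
    refine tens_ext fun k g hg => ?_
    rw [LinearMap.comp_apply, LinearMap.comp_apply, perm_pure _ _ hg, map_smul, muCut_pure,
      muCut_pure]
    have h1 := V.perm_join e (S.blocksEquiv R e) (S.block R)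
      ((S.map e).block (RTree.Cut.map S R e)) (S.block_map R e) (S.fiberEquiv R e)
      (fun _ _ => rfl) k fun r => ⟨V.ev (S.restrict R r) (g r), V.ev_mem _ (hg r)⟩
    refine h1.trans ?_
    congr 3
    funext r
    change V.perm (S.fiberEquiv R e r) (V.ev _ _) = _
    rw [V.perm_ev, S.restrict_map R e r]
  exact LinearMap.congr_fun h u

theorem muCut_bound {n : ℕ} (t : V.Gamma.Tens (Fin n)) : ∃ N : ℕ, ∀ (I : Type) [Fintype I]
    [LinearOrder I] (S : RTree I) (R : S.Cut) (e : Fin n ≃ R.Blocks), N ≤ Fintype.card I →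
      V.muCut S R (V.Gamma.perm e t) = 0 := by
  refine V.Gamma.tens_induction (P := fun t => ∃ N : ℕ, ∀ (I : Type) [Fintype I]
    [LinearOrder I] (S : RTree I) (R : S.Cut) (e : Fin n ≃ R.Blocks), N ≤ Fintype.card I →
      V.muCut S R (V.Gamma.perm e t) = 0) ?_ ?_ ?_ ?_ t
  · exact ⟨0, fun I _ _ S R e _ => by simp⟩
  · rintro x y ⟨N, hN⟩ ⟨M, hM⟩
    refine ⟨max N M, fun I _ _ S R e h => ?_⟩
    rw [map_add, map_add, hN I S R e (le_of_max_le_left h), hM I S R e (le_of_max_le_right h),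
      add_zero]
  · rintro c x ⟨N, hN⟩
    exact ⟨N, fun I _ _ S R e h => by rw [map_smul, map_smul, hN I S R e h, smul_zero]⟩
  · intro q g hg
    choose B hB using fun i => (g i).2.1
    refine ⟨∑ i, B i + 1, fun I _ _ S R e h => ?_⟩
    rw [perm_pure _ e hg, map_smul, muCut_pure]
    have h1 : ∃ r : R.Blocks, B (e.symm r) ≤ Fintype.card {v // S.block R v = r} := by
      by_contra! hcon
      have h2 : Fintype.card I = ∑ r, Fintype.card {v // S.block R v = r} := by
        rw [← Fintype.card_sigma]
        exact Fintype.card_congr (Equiv.sigmaFiberEquiv (S.block R)).symm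
      have h3 : ∑ r, Fintype.card {v // S.block R v = r} ≤ ∑ r, B (e.symm r) :=
        Finset.sum_le_sum fun r _ => (hcon r).le
      rw [Equiv.sum_comp e.symm B] at h3
      omega
    obtain ⟨r, hr⟩ := h1
    have h4 : V.ev (S.restrict R r) (g (e.symm r)) = 0 := by
      change V.perm _ ((g (e.symm r)).1 _ _) = 0
      rw [hB _ _ hr, map_zero]
    rw [MultilinearMap.map_coord_zero _ r h4, map_zero, smul_zero]

/-- The component at the tree `S` of the multiplication of the monad `Γ(PreLie, -)`. A tree `S`
occurs in the operadic composite `T(Q_1, …, Q_n)` of rooted trees exactly when the `Q_i` are the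
blocks of a cut of `S` and `T` is the tree of the blocks, and its coefficient is then one. -/
noncomputable def muAt {I : Type} [Fintype I] [LinearOrder I] (S : RTree I) :
    V.Gamma.Gamma →ₗ[K] V.Tens I :=
  ∑ R : S.Cut, V.muCut S R ∘ₗ V.Gamma.ev (S.contract R)

theorem perm_muAt {I I' : Type} [Fintype I] [LinearOrder I] [Fintype I'] [LinearOrder I']
    (S : RTree I) (e : I ≃ I') (x : V.Gamma.Gamma) :
    V.perm e (V.muAt S x) = V.muAt (S.map e) x := by
  rw [muAt, muAt, LinearMap.sum_apply, LinearMap.sum_apply, map_sum]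
  refine Fintype.sum_equiv (S.cutEquiv e) _ _ fun R => ?_
  rw [LinearMap.comp_apply, LinearMap.comp_apply, perm_muCut, perm_ev, S.contract_map R e]
  rfl

theorem muAt_bound (x : V.Gamma.Gamma) : ∃ N : ℕ, ∀ (I : Type) [Fintype I]
    [LinearOrder I] (S : RTree I), N ≤ Fintype.card I → V.muAt S x = 0 := by
  obtain ⟨B, hB⟩ := x.2.1
  choose N hN using fun n T => V.muCut_bound (x.1 n T)
  refine ⟨(Finset.range B).sup fun n => Finset.univ.sup fun T => N n T, fun I _ _ S h => ?_⟩
  rw [muAt, LinearMap.sum_apply]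
  refine Finset.sum_eq_zero fun R _ => ?_
  rw [LinearMap.comp_apply]
  change V.muCut S R (V.Gamma.perm _ (x.1 _ _)) = 0
  by_cases hn : Fintype.card R.Blocks < B
  · refine hN _ _ I S R _ (le_trans ?_ h)
    refine le_trans ?_ (Finset.le_sup (f := fun n => Finset.univ.sup fun T => N n T)
      (Finset.mem_range.2 hn))
    exact Finset.le_sup (f := fun T => N (Fintype.card R.Blocks) T) (Finset.mem_univ _)
  · rw [hB _ (not_lt.1 hn), map_zero, map_zero]

/-- The multiplication of the monad `Γ(PreLie, -)`. -/
noncomputable def mu : V.Gamma.Gamma →ₗ[K] V.Gamma where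
  toFun x := ⟨fun _ S => V.muAt S x, by
    obtain ⟨N, hN⟩ := V.muAt_bound x
    exact ⟨N, fun n hn S => hN (Fin n) S (by simpa using hn)⟩,
    fun n σ T => V.perm_muAt T σ x⟩
  map_add' x y := Subtype.ext (funext fun n => funext fun S => map_add (V.muAt S) x y)
  map_smul' c x := Subtype.ext (funext fun n => funext fun S => map_smul (V.muAt S) c x)

/-- The unit of the monad `Γ(PreLie, -)`: it sends `v` to `T ⊗ v`, where `T` is the tree with one
vertex. -/
noncomputable def eta (x : V) : V.Gamma :=
  ⟨fun n _ => if n = 1 then V.pure fun _ => x else 0, by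
    refine ⟨⟨2, fun n hn T => if_neg (by omega)⟩, fun n σ T => ?_⟩
    by_cases h : n = 1
    · subst h
      simp only [if_true]
      exact V.perm_of_monotone σ (Subsingleton.monotone σ) _
    · simp [h]⟩

end

/-- Morphisms of differential graded modules. -/
structure Hom {K : Type u} [CommRing K] (V : DGModule.{u, v} K) (W : DGModule.{u, w} K) where
  /-- The underlying linear map. -/
  toLinearMap : V →ₗ[K] W
  map_mem : ∀ {k : ℤ} {x : V}, x ∈ V.gr k → toLinearMap x ∈ W.gr k
  map_d : ∀ x : V, toLinearMap (V.d x) = W.d (toLinearMap x)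

/-- The functoriality of `Γ(PreLie, -)`. -/
noncomputable def gammaMap {K : Type u} [CommRing K] {V : DGModule.{u, v} K} {W : DGModule.{u, w} K}
    (f : V.Hom W) : V.Gamma →ₗ[K] W.Gamma :=
  V.gammaLift (fun n => PiTensorProduct.map fun _ : Fin n => f.toLinearMap) fun n σ t => by
    have h : W.perm σ ∘ₗ PiTensorProduct.map (fun _ : Fin n => f.toLinearMap) =
        PiTensorProduct.map (fun _ : Fin n => f.toLinearMap) ∘ₗ V.perm σ := by
      refine tens_ext fun q v hv => ?_
      rw [LinearMap.comp_apply, LinearMap.comp_apply, perm_pure V σ hv, map_smul,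
        PiTensorProduct.map_tprod, PiTensorProduct.map_tprod,
        perm_pure W σ fun i => f.map_mem (hv i)]
    exact LinearMap.congr_fun h t

end DGModule

/-! ### The elements which define the weighted braces -/

namespace DGModule

section

variable {K : Type u} [CommRing K] (V : DGModule.{u, v} K)

/-- The submodule of the elements of even degree. -/
def even : Submodule K V := ⨆ k : ℤ, V.gr (2 * k)

/-- The condition under which the weighted brace `x{y_1, …, y_p}_{r_1, …, r_p}` is defined: when
`2 ≠ 0` in `K`, only elements of even degree may have a weight greater than one. -/
def Admissible {p : ℕ} (y : Fin p → V) (r : Fin p → ℕ) : Prop :=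
  (2 : K) = 0 ∨ ∀ i, r i ≤ 1 ∨ y i ∈ V.even

/-- The words in the letters `0, …, p` in which `0` occurs once and `i + 1` occurs `r i` times. -/
def words {p : ℕ} (r : Fin p → ℕ) (m : ℕ) : Finset (Fin m → Fin (p + 1)) :=
  {w | ∀ c, Fintype.card {i // w i = c} = (Fin.cons 1 r : Fin (p + 1) → ℕ) c}

open Classical in
/-- The element of `Γ(PreLie, V)` which defines `x{y_1, …, y_p}_{r_1, …, r_p}`. It is the image of
the sum of the elements `σ · (F ⊗ (e ⊗ e_1 ⊗ ⋯ ⊗ e_1 ⊗ ⋯ ⊗ e_p ⊗ ⋯ ⊗ e_p))`, where `F` is the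
corolla with root `0`, where `e_i` occurs `r_i` times and where `σ` runs through the
`(1, r_1, …, r_p)`-shuffles, under the substitution `e ↦ x`, `e_i ↦ y_i`. A shuffle is represented
by a word `w`, whose letter `w i` says which one of `e, e_1, …, e_p` stands at the place `i`, and
`signOp w` is the Koszul sign of the shuffle. -/
noncomputable def braceElt {p : ℕ} (x : V) (y : Fin p → V) (r : Fin p → ℕ) (m : ℕ)
    (T : RTree (Fin m)) : V.Tens (Fin m) :=
  ∑ w ∈ words r m, if T.IsCorolla ∧ w T.root = 0 then
    V.signOp w (V.pure fun i => (Fin.cons x y : Fin (p + 1) → V) (w i)) else 0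

theorem decomp_of_mem_even {y : V} (hy : y ∈ V.even) {q : ℤ} (hq : V.decomp y q ≠ 0) :
    Even q := by
  by_contra hodd
  refine hq ?_
  clear hq
  induction hy using Submodule.iSup_induction' with
  | mem k z hz =>
    rw [V.decomp_of_mem hz, DirectSum.lof_eq_of, DirectSum.of_eq_of_ne]
    rintro rfl
    exact hodd (even_two_mul k)
  | zero => rw [map_zero]; rfl
  | add z z' _ _ h h' => rw [map_add, DirectSum.add_apply, h, h', add_zero]

theorem card_of_mem_words {p m : ℕ} {r : Fin p → ℕ} {w : Fin m → Fin (p + 1)}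
    (hw : w ∈ words r m) : m = 1 + ∑ i, r i := by
  have h : ∀ c, Fintype.card {i // w i = c} = (Fin.cons 1 r : Fin (p + 1) → ℕ) c := by
    simpa [words] using hw
  have h2 : Fintype.card (Fin m) = ∑ c, Fintype.card {i // w i = c} := by
    rw [← Fintype.card_sigma]
    exact Fintype.card_congr (Equiv.sigmaFiberEquiv w).symm
  rw [Fintype.card_fin] at h2
  rw [h2, Fin.sum_univ_succ]
  simp [h]

theorem comp_mem_words {p m : ℕ} {r : Fin p → ℕ} {w : Fin m → Fin (p + 1)}
    (hw : w ∈ words r m) (σ : Equiv.Perm (Fin m)) : (fun i => w (σ i)) ∈ words r m := by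
  have h : ∀ c, Fintype.card {i // w i = c} = (Fin.cons 1 r : Fin (p + 1) → ℕ) c := by
    simpa [words] using hw
  simp only [words, Finset.mem_filter, Finset.mem_univ, true_and]
  intro c
  rw [← h c]
  exact Fintype.card_congr (σ.subtypeEquiv fun i => Iff.rfl)

theorem perm_signOp {p m : ℕ} {r : Fin p → ℕ} (x : V) {y : Fin p → V} (hadm : V.Admissible y r)
    {w : Fin m → Fin (p + 1)} (hw : w ∈ words r m) (σ : Equiv.Perm (Fin m)) :
    V.perm σ (V.signOp w (V.pure fun i => (Fin.cons x y : Fin (p + 1) → V) (w i))) =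
      V.signOp (fun i => w (σ.symm i))
        (V.pure fun i => (Fin.cons x y : Fin (p + 1) → V) (w (σ.symm i))) := by
  set u : Fin p.succ → V := Fin.cons x y with hu
  have h1 : V.perm σ ∘ₗ V.signOp w =
      (PiTensorProduct.reindex K (fun _ : Fin m => V.carrier) σ).toLinearMap ∘ₗ
        V.diagOp fun q => ((Koszul.sign σ q : ℤ) : K) * ((Koszul.sign w q : ℤ) : K) := by
    refine tens_ext fun q v hv => ?_
    rw [LinearMap.comp_apply, LinearMap.comp_apply, signOp_pure V w hv, V.diagOp_pure _ hv,
      map_smul, map_smul, perm_pure V σ hv, smul_smul, mul_comm]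
    congr 1
    exact (PiTensorProduct.reindex_tprod (R := K) σ v).symm
  have h2 : V.signOp (fun i => w (σ.symm i)) ∘ₗ
      (PiTensorProduct.reindex K (fun _ : Fin m => V.carrier) σ).toLinearMap =
      (PiTensorProduct.reindex K (fun _ : Fin m => V.carrier) σ).toLinearMap ∘ₗ
        V.diagOp fun q => ((Koszul.sign (fun i => w (σ.symm i)) fun i => q (σ.symm i) : ℤ) : K) := by
    refine tens_ext fun q v hv => ?_
    rw [LinearMap.comp_apply, LinearMap.comp_apply, V.diagOp_pure _ hv, map_smul,
      LinearEquiv.coe_coe, PiTensorProduct.reindex_tprod]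
    exact signOp_pure V (fun i => w (σ.symm i)) (q := fun i => q (σ.symm i)) fun i => hv _
  have h3 : V.pure (fun i => u (w (σ.symm i))) =
      (PiTensorProduct.reindex K (fun _ : Fin m => V.carrier) σ).toLinearMap
        (V.pure fun i => u (w i)) :=
    (PiTensorProduct.reindex_tprod (R := K) (s := fun _ : Fin m => V.carrier) σ fun i => u (w i)).symm
  rw [h3, ← LinearMap.comp_apply, ← LinearMap.comp_apply, h1, h2, LinearMap.comp_apply,
    LinearMap.comp_apply]
  congr 1
  refine V.diagOp_congr _ _ _ fun q hq => ?_
  rcases hadm with h0 | hev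
  · have hunit : ∀ z : ℤˣ, ((z : ℤ) : K) = 1 := by
      intro z
      rcases Int.units_eq_one_or z with rfl | rfl
      · simp
      · have : (1 : K) + 1 = 0 := by rw [one_add_one_eq_two, h0]
        simpa using (eq_neg_of_add_eq_zero_left this).symm
    rw [hunit, hunit, hunit, one_mul]
  · have h4 := Koszul.sign_comp σ (fun i => w (σ.symm i)) q (by
      intro a b hab hw2
      simp only [Equiv.symm_apply_apply] at hw2
      have hcard : ∀ c, Fintype.card {i // w i = c} = (Fin.cons 1 r : Fin (p + 1) → ℕ) c := by
        simpa [words] using hw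
      have h5 : 1 < Fintype.card {i // w i = w a} :=
        Fintype.one_lt_card_iff.2 ⟨⟨a, rfl⟩, ⟨b, hw2.symm⟩, fun h => hab (congrArg Subtype.val h)⟩
      rw [hcard] at h5
      obtain ⟨c, hc⟩ | hc := (Fin.exists_succ_eq (x := w a)).2.mt |> fun _ => em (∃ c : Fin p, c.succ = w a)
      · have h6 : y c ∈ V.even := by
          rcases hev c with h | h
          · rw [← hc, Fin.cons_succ] at h5
            omega
          · exact h
        have h7 : Even (q a) := by
          refine V.decomp_of_mem_even h6 ?_
          have := hq a
          rwa [← hc, hu, Fin.cons_succ] at this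
        rw [Koszul.swapSign]
        exact Int.negOnePow_even _ (h7.mul_right _)
      · rw [Fin.exists_succ_eq, not_not] at hc
        rw [hc, Fin.cons_zero] at h5
        exact absurd h5 (lt_irrefl _))
    simp only [Equiv.symm_apply_apply] at h4
    have h5 : Koszul.sign σ q * Koszul.sign w q =
        Koszul.sign (fun i => w (σ.symm i)) fun i => q (σ.symm i) := by
      have : Koszul.sign w q = Koszul.sign (fun i => w i) q := rfl
      rw [this, h4, ← mul_assoc, Int.units_mul_self, one_mul]
    rw [← h5]
    push_cast
    rfl

theorem braceElt_mem {p : ℕ} (x : V) {y : Fin p → V} {r : Fin p → ℕ} (hadm : V.Admissible y r) :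
    V.braceElt x y r ∈ V.gammaSubmodule := by
  classical
  refine ⟨⟨2 + ∑ i, r i, fun n hn T => Finset.sum_eq_zero fun w hw => ?_⟩, fun n σ T => ?_⟩
  · have := card_of_mem_words hw
    omega
  · rw [braceElt, braceElt, map_sum]
    refine Finset.sum_bij' (fun w _ i => w (σ.symm i)) (fun w _ i => w (σ i))
      (fun w hw => comp_mem_words hw σ.symm) (fun w hw => comp_mem_words hw σ)
      (fun w _ => by simp) (fun w _ => by simp) fun w hw => ?_
    have h1 : w (σ.symm (T.map σ).root) = w T.root := by simp [RTree.map]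
    simp only [T.isCorolla_map σ, h1]
    split_ifs
    · exact V.perm_signOp x hadm hw σ
    · exact map_zero _

end

end DGModule

/-! ### Pre-Lie algebras with divided powers -/

/-- A differential graded pre-Lie algebra with divided powers, that is an algebra over the monad
`Γ(PreLie, -)` on differential graded `K`-modules. -/
structure GammaPreLie (K : Type u) [CommRing K] extends DGModule.{u, v} K where
  /-- The structure morphism. -/
  l : toDGModule.Gamma.Hom toDGModule
  l_eta : ∀ x : carrier, l.toLinearMap (toDGModule.eta x) = x
  l_mu : ∀ x : toDGModule.Gamma.Gamma, l.toLinearMap (toDGModule.mu x) =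
    l.toLinearMap (DGModule.gammaMap l x)

namespace GammaPreLie

variable {K : Type u} [CommRing K] (L : GammaPreLie.{u, v} K)

open Classical in
/-- The weighted brace `x{y_1, …, y_p}_{r_1, …, r_p}` (zero, by convention, when it is not
defined). -/
noncomputable def brace {p : ℕ} (x : L.carrier) (y : Fin p → L.carrier) (r : Fin p → ℕ) :
    L.carrier :=
  if h : L.Admissible y r then L.l.toLinearMap ⟨_, L.braceElt_mem x h⟩ else 0

end GammaPreLie

/-- A complete differential graded pre-Lie algebra with divided powers: it is endowed with a
filtration `L = F 1 ⊇ F 2 ⊇ ⋯` by differential graded submodules, compatible with the weighted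
braces, such that the canonical morphism from `L` to the limit of the `L / F n` in the category of
differential graded modules is an isomorphism, that is, it is bijective in every degree. -/
structure CompleteGammaPreLie (K : Type u) [CommRing K] extends GammaPreLie.{u, v} K where
  /-- The filtration (the index zero only occurs for convenience: `F 0 = L`). -/
  F : ℕ → Submodule K carrier
  F_anti : Antitone F
  F_one : F 1 = ⊤
  /-- The submodules are graded. -/
  F_graded : ∀ (n : ℕ) (x : carrier), x ∈ F n → ∀ k, (toDGModule.decomp x k : carrier) ∈ F n
  F_d : ∀ (n : ℕ) (x : carrier), x ∈ F n → d x ∈ F n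
  F_brace : ∀ {p : ℕ} (k : ℕ) (x : carrier) (m : Fin p → ℕ) (y : Fin p → carrier)
    (r : Fin p → ℕ), 1 ≤ k → (∀ i, 1 ≤ m i) → toDGModule.Admissible y r → x ∈ F k →
      (∀ i, y i ∈ F (m i)) → toGammaPreLie.brace x y r ∈ F (k + ∑ i, m i * r i)
  /-- The injectivity of the canonical morphism, in degree `k`. -/
  separated : ∀ (k : ℤ) (x : carrier), x ∈ gr k → (∀ n, 1 ≤ n → x ∈ F n) → x = 0
  /-- The surjectivity of the canonical morphism, in degree `k`: an element of the limit is given by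
  a sequence of representatives `s n` of elements of `L / F n`. -/
  complete : ∀ (k : ℤ) (s : ℕ → carrier), (∀ n, s n ∈ gr k) →
    (∀ n, 1 ≤ n → s (n + 1) - s n ∈ F n) → ∃ x ∈ gr k, ∀ n, 1 ≤ n → x - s n ∈ F n

namespace CompleteGammaPreLie

variable {K : Type u} [CommRing K] (L : CompleteGammaPreLie.{u, v} K)

/-- The module `L_+ = K 1 ⊕ L`. -/
abbrev Plus : Type (max u v) := K × L.carrier

/-- The inclusion of `L` in `L_+`. -/
abbrev incl (x : L.carrier) : L.Plus := (0, x)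

/-- The weighted braces of the unit element `1` of `L_+`:  `1{y_1, …, y_p}_{r_1, …, r_p}` is `1`
when all weights are zero, `y_i` when `r_i = 1` is the only non-zero weight, and `0` when the sum of
the weights is greater than one. -/
def oneBrace {p : ℕ} (y : Fin p → L.carrier) (r : Fin p → ℕ) : L.Plus :=
  if ∑ i, r i = 0 then (1, 0) else if ∑ i, r i = 1 then (0, ∑ i, r i • y i) else (0, 0)

/-- The extension of the weighted braces to the elements `c 1 + x` of `L_+`. -/
noncomputable def plusBrace {p : ℕ} (a : L.Plus) (y : Fin p → L.carrier) (r : Fin p → ℕ) :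
    L.Plus :=
  a.1 • L.oneBrace y r + L.incl (L.brace a.2 y r)

/-- The series `∑ s n` converges to `a` in `L_+`, where the submodules `F N` of `L` form a basis of
neighbourhoods of zero. -/
def HasSum (s : ℕ → L.Plus) (a : L.Plus) : Prop :=
  ∀ N, ∃ n₀, ∀ n, n₀ ≤ n → ∃ x ∈ L.F N, a = ∑ i ∈ Finset.range n, s i + L.incl x

open Classical in
/-- The sum of a convergent series in `L_+`. -/
noncomputable def tsum (s : ℕ → L.Plus) : L.Plus :=
  if h : ∃ a, L.HasSum s a then h.choose else 0

/-- The circular product `a ⊚ (1 + μ) = ∑ n, a{μ}_n`, as a function of `a` and `μ`. -/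
noncomputable def circ (a : L.Plus) (μ : L.carrier) : L.Plus :=
  L.tsum fun n => L.plusBrace a ![μ] ![n]

/-- The set `1 + L^0`. -/
def gauge : Set L.Plus := {a | a.1 = 1 ∧ a.2 ∈ L.gr 0}

/-- The Maurer-Cartan set. -/
def mc : Set L.carrier := {α | α ∈ L.gr 1 ∧ L.d α + L.brace α ![α] ![1] = 0}

end CompleteGammaPreLie

/-! For μ in L^0 let c_μ be the linear map x ↦ ∑ x{μ}_n on L (`circHom`). Its terms with n ≥ 1 raise
the filtration, so the series converges and c_μ is the identity on the associated graded module.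
Hence c_μ is injective (`circHom_injective`) and, by a Neumann series, surjective in every degree
(`exists_circHom_eq`). As 1{μ}_n vanishes for n ≥ 2, one has (c1 + x) ⊚ (1 + μ) = c(1 + μ) + c_μ(x),
and (1 + μ) ⊚ (1 + ν) = 1 + μ ⋆ ν with μ ⋆ ν = ν + c_ν(μ) (`star`).

The group structure rests on c_ν ∘ c_μ = c_{μ ⋆ ν} (`circHom_circHom`). In each arity this equates
two sums of decorated trees of depth at most two. In (x{μ}_i){ν}_j a corolla x with leaves μ
receives further leaves ν. In c_{μ ⋆ ν}(x) the root x receives corollas with root μ and leaves ν, or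
single vertices ν. Either way a leaf attached to the root carries μ or ν and every other label is
forced, so both sides have the same component at every tree (`mu_single_single`). Weighted braces
are sums over shuffles, in which each decoration occurs once, so no factorials appear. Associativity
and left inverses follow.

For the action put D_x(y) = ∑ x{y, μ}_{1,n} (`der`). Three identities are needed: d c_μ(x) = c_μ(dx)
+ (-1)^|x| D_x(dμ), c_μ(x{y}) = D_x(c_μ(y)), c_μ(x){y} = D_x(y) + D_x(μ{y}). Let T_μ(α) = α + μ{α} -
dμ (`twist`). By injectivity, β = (1 + μ)·α is characterised by c_μ(β) = T_μ(α). The third identity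
gives D_x(T_μ(α)) = c_μ(x){α} - D_x(dμ), whence c_μ(dβ + β{β}) = dT_μ(α) + T_μ(α){α}. This vanishes
by the equation for α together with μ{α}{α} = μ{α{α}}, so β is again a Maurer-Cartan element. The
same identities give the compatibility of T with ⋆ (`circHom_star_eq_twist`), that is, the action
law.

The brace identities come from the free algebra. The algebra axiom for `l` turns a nested brace in L
into the image of a monad product in Γ(PreLie, L) (`brace_l`), whose component at a tree S is a sum
over the cuts of S. Two kinds of cuts matter: if the outer brace has generators as arguments, the
root block is a corolla and the other blocks are single vertices (`IsLeafCut`); if its first entry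
is a generator, the root is a block by itself (`childCut`). At most two entries have non-zero
degree, which keeps the Koszul signs elementary. -/

/-! ### Koszul signs with at most two non-zero degrees -/

namespace Koszul

/-- If the degrees vanish off `{a, b}`, only the pair `a, b` can contribute to the sign. -/
theorem sign_pair {I J : Type} [Fintype I] [LinearOrder I] [LinearOrder J] (p : I → J) (q : I → ℤ)
    {a b : I} (hab : a ≠ b) (hq : ∀ i, i ≠ a → i ≠ b → q i = 0) :
    sign p q = if (a < b ∧ p b < p a) ∨ (b < a ∧ p a < p b) then swapSign (q a) (q b) else 1 := by
  have h0 : ∀ c : ℤ, swapSign 0 c = 1 := fun c => by simp [swapSign]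
  have h0' : ∀ c : ℤ, swapSign c 0 = 1 := fun c => by simp [swapSign]
  -- The case `b < a` is recovered from this one by the symmetry of `swapSign`.
  have key : ∀ a b : I, a < b → (∀ i, i ≠ a → i ≠ b → q i = 0) →
      sign p q = if p b < p a then swapSign (q a) (q b) else 1 := by
    intro a b h hq
    rw [sign, Finset.prod_eq_single a, Finset.prod_eq_single b]
    · simp [h]
    · intro i _ hi
      by_cases hia : i = a
      · simp [hia]
      · simp [hq i hia hi, h0']
    · simp
    · intro i _ hi
      refine Finset.prod_eq_one fun j _ => ?_
      by_cases hib : i = b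
      · subst hib
        by_cases hj : i < j
        · have : q j = 0 := hq j (h.trans hj).ne' hj.ne'
          simp [this, h0']
        · simp [hj]
      · simp [hq i hi hib, h0]
    · simp
  rcases lt_or_gt_of_ne hab with h | h
  · rw [key a b h hq]
    simp [h, h.not_gt]
  · rw [key b a h fun i h1 h2 => hq i h2 h1]
    simp [h, h.not_gt, swapSign_comm]

/-- If the degrees vanish off one place, the sign is trivial. -/
theorem sign_single {I J : Type} [Fintype I] [LinearOrder I] [LinearOrder J] (p : I → J)
    (q : I → ℤ) (a : I) (hq : ∀ i, i ≠ a → q i = 0) : sign p q = 1 := by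
  refine Finset.prod_eq_one fun i _ => Finset.prod_eq_one fun j _ => ?_
  by_cases h : i < j ∧ p j < p i
  · by_cases hi : i = a
    · simp [swapSign, hq j (fun hj => h.1.ne (hi.trans hj.symm))]
    · simp [swapSign, hq i hi]
  · rw [if_neg h]

/-- Transport of a sign along an isomorphism of ordered sets. -/
theorem sign_orderIso {I I' J : Type} [Fintype I] [LinearOrder I] [Fintype I'] [LinearOrder I']
    [LinearOrder J] (e : I ≃o I') (w : I → J) (q : I → ℤ) :
    sign (fun i' => w (e.symm i')) (fun i' => q (e.symm i')) = sign w q := by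
  simp only [sign]
  rw [← e.toEquiv.prod_comp]
  refine Finset.prod_congr rfl fun i _ => ?_
  rw [← e.toEquiv.prod_comp]
  refine Finset.prod_congr rfl fun j _ => ?_
  simp

end Koszul

/-! ### Components at trees of the elements defining weighted braces -/

namespace DGModule

variable {K : Type u} [CommRing K] (V : DGModule.{u, v} K)

theorem ev_fin {n : ℕ} (T : RTree (Fin n)) (f : V.Gamma) : V.ev T f = f.1 n T := by
  rw [V.ev_eq T f (Equiv.refl _), V.perm_refl]
  rfl

theorem gamma_ext {f g : V.Gamma} (h : ∀ (n : ℕ) (T : RTree (Fin n)), V.ev T f = V.ev T g) :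
    f = g := by
  refine Subtype.ext (funext fun n => funext fun T => ?_)
  rw [← V.ev_fin T f, ← V.ev_fin T g, h]

theorem ev_mu {n : ℕ} (T : RTree (Fin n)) (x : V.Gamma.Gamma) : V.ev T (V.mu x) = V.muAt T x :=
  V.ev_fin T (V.mu x)

theorem ev_d {n : ℕ} (T : RTree (Fin n)) (f : V.Gamma) :
    V.ev T (V.Gamma.d f) = V.tensD (Fin n) (V.ev T f) := by
  rw [ev_fin, ev_fin]
  rfl

theorem perm_orderIso {I I' : Type} [Fintype I] [LinearOrder I] [Fintype I'] [LinearOrder I']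
    (e : I ≃o I') (v : I → V) :
    V.perm e.toEquiv (V.pure v) = V.pure fun i' => v (e.symm i') :=
  V.perm_of_monotone e.toEquiv e.monotone v

theorem perm_signOp_orderIso {I I' J : Type} [Fintype I] [LinearOrder I] [Fintype I']
    [LinearOrder I'] [LinearOrder J] (e : I ≃o I') (w : I → J) (t : V.Tens I) :
    V.perm e.toEquiv (V.signOp w t) = V.signOp (fun i' => w (e.symm i')) (V.perm e.toEquiv t) := by
  have h : V.perm e.toEquiv ∘ₗ V.signOp w =
      V.signOp (fun i' => w (e.symm i')) ∘ₗ V.perm e.toEquiv := by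
    refine tens_ext fun q v hv => ?_
    rw [LinearMap.comp_apply, LinearMap.comp_apply, signOp_pure V w hv, map_smul, perm_orderIso,
      signOp_pure V _ (q := fun i' => q (e.symm i')) fun i => hv _, Koszul.sign_orderIso]
  exact LinearMap.congr_fun h t

theorem ev_eta {I : Type} [Fintype I] [LinearOrder I] (T : RTree I) (x : V) :
    V.ev T (V.eta x) = if Fintype.card I = 1 then V.pure fun _ => x else 0 := by
  change V.perm (Fintype.orderIsoFinOfCardEq I rfl).toEquiv
    (if Fintype.card I = 1 then V.pure fun _ => x else 0) = _
  split_ifs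
  · rw [perm_orderIso]
  · rw [map_zero]

theorem eta_mem {x : V} {a : ℤ} (hx : x ∈ V.gr a) : V.eta x ∈ V.Gamma.gr a := by
  intro n T
  change (if n = 1 then V.pure fun _ => x else 0) ∈ _
  split_ifs with h
  · subst h
    exact Submodule.subset_span ⟨fun _ => a, fun _ => x, fun _ => hx, by simp, rfl⟩
  · exact zero_mem _

/-- The element of `Γ(PreLie, V)` which defines a weighted brace. -/
noncomputable def braceGamma {p : ℕ} (x : V) (y : Fin p → V) (r : Fin p → ℕ)
    (h : V.Admissible y r) : V.Gamma :=
  ⟨_, V.braceElt_mem x h⟩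

-- The definition of `braceElt` concerns the vertex sets `Fin m`. It is transported along the
-- increasing bijection with `I`, which creates no sign, so that the formula can be applied to
-- blocks of a tree and to trees of blocks.
open Classical in
theorem ev_braceGamma {p : ℕ} (x : V) (y : Fin p → V) (r : Fin p → ℕ)
    (h : V.Admissible y r) {I : Type} [Fintype I] [LinearOrder I] (T : RTree I) :
    V.ev T (V.braceGamma x y r h) = ∑ w : I → Fin (p + 1),
      if T.IsCorolla ∧ w T.root = 0 ∧
          ∀ c, Fintype.card {i // w i = c} = (Fin.cons 1 r : Fin (p + 1) → ℕ) c then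
        V.signOp w (V.pure fun i => (Fin.cons x y : Fin (p + 1) → V) (w i)) else 0 := by
  set o := Fintype.orderIsoFinOfCardEq I rfl with ho
  change V.perm o.toEquiv (V.braceElt x y r _ (T.map o.toEquiv.symm)) = _
  rw [braceElt, map_sum, words, Finset.sum_filter]
  refine Fintype.sum_equiv (o.toEquiv.arrowCongr (Equiv.refl _)) _ _ fun w => ?_
  have h1 : ∀ c, Fintype.card {i // (o.toEquiv.arrowCongr (Equiv.refl _)) w i = c} =
      Fintype.card {i // w i = c} := fun c =>
    Fintype.card_congr (o.symm.toEquiv.subtypeEquiv fun i => by simp [Equiv.arrowCongr])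
  have h2 : (o.toEquiv.arrowCongr (Equiv.refl _)) w T.root = w (T.map o.toEquiv.symm).root := by
    simp [Equiv.arrowCongr, RTree.map]
  simp only [T.isCorolla_map, h1, h2]
  by_cases h3 : ∀ c, Fintype.card {i // w i = c} = (Fin.cons 1 r : Fin (p + 1) → ℕ) c
  · rw [if_pos (by convert! h3)]
    simp only [h3, implies_true, and_true]
    split_ifs
    · rw [perm_signOp_orderIso, perm_orderIso]
      rfl
    · rw [map_zero]
  · rw [if_neg (by convert! h3), if_neg fun h4 => h3 h4.2.2]

end DGModule

theorem sum_card_fiber {I C : Type} [Fintype I] [Fintype C] [DecidableEq C] (w : I → C) :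
    ∑ c, Fintype.card {i // w i = c} = Fintype.card I := by
  rw [← Fintype.card_sigma]
  exact Fintype.card_congr (Equiv.sigmaFiberEquiv w)

theorem card_fiber_eq_one_iff {I C : Type} [Fintype I] [DecidableEq C] (w : I → C) (c : C) :
    Fintype.card {i // w i = c} = 1 ↔ ∃ i, ∀ j, w j = c ↔ j = i := by
  rw [Fintype.card_eq_one_iff]
  constructor
  · rintro ⟨⟨i, hi⟩, h⟩
    refine ⟨i, fun j => ⟨fun hj => congrArg Subtype.val (h ⟨j, hj⟩), ?_⟩⟩
    rintro rfl
    exact hi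
  · rintro ⟨i, h⟩
    exact ⟨⟨i, (h i).2 rfl⟩, fun j => Subtype.ext ((h j).1 j.2)⟩

namespace DGModule

variable {K : Type u} [CommRing K] (V : DGModule.{u, v} K)

theorem mem_even_of_mem {x : V} {k : ℤ} (hx : x ∈ V.gr (2 * k)) : x ∈ V.even :=
  Submodule.mem_iSup_of_mem k hx

theorem admissible_of_mem {p : ℕ} {y : Fin p → V} (hy : ∀ i, y i ∈ V.gr 0) (r : Fin p → ℕ) :
    V.Admissible y r :=
  Or.inr fun i => Or.inr (V.mem_even_of_mem (k := 0) (hy i))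

theorem admissible_one {y : V} : V.Admissible ![y] ![1] :=
  Or.inr fun i => Or.inl (by fin_cases i; simp)

theorem admissible_single {y : V} (hy : y ∈ V.gr 0) (n : ℕ) : V.Admissible ![y] ![n] :=
  V.admissible_of_mem (fun i => by fin_cases i; exact hy) _

theorem admissible_pair (y : V) {z : V} (hz : z ∈ V.gr 0) (n : ℕ) :
    V.Admissible ![y, z] ![1, n] :=
  Or.inr fun i => by
    fin_cases i
    · exact Or.inl le_rfl
    · exact Or.inr (V.mem_even_of_mem (k := 0) hz)

open Classical in
/-- When the arguments of a weighted brace have degree zero, there are no signs. -/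
theorem ev_braceGamma_of_mem {p : ℕ} {x : V} {a : ℤ} (hx : x ∈ V.gr a) {y : Fin p → V}
    (hy : ∀ i, y i ∈ V.gr 0) (r : Fin p → ℕ)
    (h : V.Admissible y r) {I : Type} [Fintype I] [LinearOrder I] (T : RTree I) :
    V.ev T (V.braceGamma x y r h) = ∑ w : I → Fin (p + 1),
      if T.IsCorolla ∧ w T.root = 0 ∧
          ∀ c, Fintype.card {i // w i = c} = (Fin.cons 1 r : Fin (p + 1) → ℕ) c then
        V.pure fun i => (Fin.cons x y : Fin (p + 1) → V) (w i) else 0 := by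
  rw [ev_braceGamma]
  refine Finset.sum_congr rfl fun w _ => if_ctx_congr Iff.rfl (fun hw => ?_) fun _ => rfl
  obtain ⟨i, hi⟩ := (card_fiber_eq_one_iff w 0).1 (hw.2.2 0)
  have h1 : ∀ c : Fin (p + 1), (Fin.cons x y : Fin (p + 1) → V) c ∈
      V.gr ((Fin.cons a fun _ => 0 : Fin (p + 1) → ℤ) c) := fun c => by
    cases c using Fin.cases with
    | zero => exact hx
    | succ c => exact hy c
  rw [signOp_pure V w (q := fun i => (Fin.cons a fun _ => 0 : Fin (p + 1) → ℤ) (w i))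
    fun i => h1 (w i), Koszul.sign_single w _ i fun j hj => ?_]
  · simp
  · obtain ⟨c, hc⟩ := Fin.exists_succ_eq.2 (mt (hi j).1 hj)
    simp only [← hc, Fin.cons_succ]

/-- The decoration of a tree by `x` at the root and `y` at the other vertices. -/
def rootVec {I : Type} [DecidableEq I] (r : I) (x y : V) : I → V := fun i => if i = r then x else y

/-- The decoration of a tree by `x` at the root, `y` at the vertex `j` and `z` at the other
vertices. -/
def pairVec {I : Type} [DecidableEq I] (r j : I) (x y z : V) : I → V :=
  fun i => if i = r then x else if i = j then y else z

/-- The sign of the shuffle which moves elements of degrees `a` and `b` to the places `r`, `j`. -/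
def pairSign {I : Type} [LinearOrder I] (r j : I) (a b : ℤ) : ℤˣ :=
  if j < r then Koszul.swapSign a b else 1

-- The letter `0` is forced to stand at the root, so a single word contributes and every corolla
-- with `n` leaves has coefficient one. This is where divided powers replace a division by `n!`.
open Classical in
theorem ev_braceGamma_single {x y : V} {a : ℤ} (hx : x ∈ V.gr a) (hy : y ∈ V.gr 0) (n : ℕ)
    (h : V.Admissible ![y] ![n]) {I : Type} [Fintype I] [LinearOrder I] (T : RTree I) :
    V.ev T (V.braceGamma x ![y] ![n] h) =
      if T.IsCorolla ∧ Fintype.card I = n + 1 then V.pure (V.rootVec T.root x y) else 0 := by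
  rw [ev_braceGamma_of_mem V hx (fun i => by fin_cases i; exact hy)]
  rw [Finset.sum_eq_single fun i => if i = T.root then 0 else 1]
  · have h1 : Fintype.card {i // (if i = T.root then (0 : Fin 2) else 1) = 0} = 1 := by
      rw [card_fiber_eq_one_iff fun i => if i = T.root then (0 : Fin 2) else 1]
      exact ⟨T.root, fun j => by simp⟩
    have h2 := sum_card_fiber fun i => if i = T.root then (0 : Fin 2) else 1
    rw [Fin.sum_univ_two, h1] at h2
    refine if_ctx_congr (and_congr_right fun _ => ?_) (fun _ => ?_) fun _ => rfl
    · rw [Fin.forall_fin_two]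
      simp only [Fin.isValue, h1, Fin.cons_zero]
      change _ = (0 : Fin 2) ∧ True ∧ _ = n ↔ _
      simp
      omega
    · congr 1
      funext i
      by_cases hi : i = T.root <;> simp [hi, rootVec]
  · intro w _ hw
    rw [if_neg]
    rintro ⟨-, h0, h1⟩
    refine hw (funext fun i => ?_)
    obtain ⟨j, hj⟩ := (card_fiber_eq_one_iff w 0).1 (h1 0)
    have h2 : T.root = j := (hj _).1 h0
    subst h2
    by_cases hi : i = T.root
    · rw [hi, h0, if_pos rfl]
    · rw [if_neg hi]
      exact Fin.eq_one_of_ne_zero _ (mt (hj i).1 hi)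
  · simp

-- A word is determined by the vertex `j` at which `y` stands. As `z` has degree zero, the only
-- possible sign exchanges `x` and `y`, when `j` precedes the root.
open Classical in
theorem ev_braceGamma_pair {x y z : V} {a b : ℤ} (hx : x ∈ V.gr a) (hy : y ∈ V.gr b)
    (hz : z ∈ V.gr 0) (n : ℕ) (h : V.Admissible ![y, z] ![1, n]) {I : Type} [Fintype I]
    [LinearOrder I] (T : RTree I) :
    V.ev T (V.braceGamma x ![y, z] ![1, n] h) = ∑ j,
      if T.IsCorolla ∧ j ≠ T.root ∧ Fintype.card I = n + 2 then
        ((pairSign T.root j a b : ℤ) : K) • V.pure (V.pairVec T.root j x y z) else 0 := by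
  rw [ev_braceGamma, ← Finset.sum_filter, ← Finset.sum_filter]
  symm
  set W : I → I → Fin 3 := fun j i => if i = T.root then 0 else if i = j then 1 else 2 with hW
  have hvec : ∀ j, (fun i => (Fin.cons x ![y, z] : Fin 3 → V) (W j i)) =
      V.pairVec T.root j x y z := fun j => funext fun i => by
    by_cases hi : i = T.root
    · simp [hW, pairVec, hi]
    · by_cases hj : i = j
      · simp only [hW, pairVec, hj, if_true]
        simp [hj ▸ hi]
      · simp only [hW, pairVec, hi, hj, if_false]
        rfl
  refine Finset.sum_bij (fun j _ => W j) ?_ ?_ ?_ ?_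
  · intro j hj
    simp only [Finset.mem_filter, Finset.mem_univ, true_and] at hj ⊢
    obtain ⟨hc, hj, hn⟩ := hj
    refine ⟨hc, by simp [hW], ?_⟩
    have h0 : Fintype.card {i // W j i = 0} = 1 := by
      rw [card_fiber_eq_one_iff]
      refine ⟨T.root, fun i => ?_⟩
      by_cases hi : i = T.root
      · simp [hW, hi]
      · by_cases hj : i = j <;> simp [hW, hi, hj]
    have h1 : Fintype.card {i // W j i = 1} = 1 := by
      rw [card_fiber_eq_one_iff]
      refine ⟨j, fun i => ?_⟩
      by_cases hi : i = T.root
      · simp [hW, hi, hj.symm]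
      · by_cases hj : i = j <;> simp [hW, hi, hj]
        exact hj ▸ hi
    have h2 := sum_card_fiber (W j)
    rw [Fin.sum_univ_three, h0, h1] at h2
    intro c
    fin_cases c
    · exact h0
    · exact h1
    · change Fintype.card {i // W j i = 2} = n
      omega
  · intro j hj j' hj' h2
    simp only [Finset.mem_filter, Finset.mem_univ, true_and] at hj hj'
    have := congrFun h2 j
    by_contra hne
    simp [hW, hj.2.1, hne] at this
  · intro w hw
    simp only [Finset.mem_filter, Finset.mem_univ, true_and] at hw
    obtain ⟨hc, h0, hw⟩ := hw
    obtain ⟨i, hi⟩ := (card_fiber_eq_one_iff w 0).1 (hw 0)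
    obtain ⟨j, hj⟩ := (card_fiber_eq_one_iff w 1).1 (hw 1)
    have h2 : T.root = i := (hi _).1 h0
    subst h2
    have hjr : j ≠ T.root := by
      rintro rfl
      rw [(hj _).2 rfl] at h0
      exact absurd h0 (by decide)
    have h3 := sum_card_fiber w
    rw [Fin.sum_univ_three, hw, hw, hw] at h3
    refine ⟨j, ?_, funext fun k => ?_⟩
    · simp only [Finset.mem_filter, Finset.mem_univ, true_and]
      refine ⟨hc, hjr, ?_⟩
      change 1 + 1 + n = _ at h3
      omega
    · by_cases hk : k = T.root
      · simp [hW, hk, h0]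
      · by_cases hk' : k = j
        · subst hk'
          simp [hW, hk, (hj k).2 rfl]
        · have h5 := mt (hi k).1 hk
          have h6 := mt (hj k).1 hk'
          simp only [hW, hk, hk', if_false]
          exact ((by decide : ∀ c : Fin 3, c ≠ 0 → c ≠ 1 → c = 2) _ h5 h6).symm
  · intro j hj
    simp only [Finset.mem_filter, Finset.mem_univ, true_and] at hj
    rw [hvec, signOp_pure V (W j)
      (q := fun i => if i = T.root then a else if i = j then b else 0) ?_]
    · congr 3
      rw [Koszul.sign_pair _ _ hj.2.1.symm (by intro i h1 h2; simp [h1, h2])]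
      simp [hW, pairSign, hj.2.1]
    · intro i
      simp only [pairVec]
      split_ifs <;> assumption

-- The element `z` is a dummy: with two vertices the third value of `pairVec` is never taken. The
-- formula thereby has the shape of the one for `x{y, z}_{1, 0}`.
open Classical in
theorem ev_braceGamma_one {x y : V} {a b : ℤ} (hx : x ∈ V.gr a) (hy : y ∈ V.gr b)
    (h : V.Admissible ![y] ![1]) (z : V) {I : Type} [Fintype I]
    [LinearOrder I] (T : RTree I) :
    V.ev T (V.braceGamma x ![y] ![1] h) = ∑ j,
      if T.IsCorolla ∧ j ≠ T.root ∧ Fintype.card I = 2 then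
        ((pairSign T.root j a b : ℤ) : K) • V.pure (V.pairVec T.root j x y z) else 0 := by
  rw [ev_braceGamma, ← Finset.sum_filter, ← Finset.sum_filter]
  symm
  set W : I → I → Fin 2 := fun j i => if i = T.root then 0 else 1 with hW
  have two : ∀ j, j ≠ T.root → Fintype.card I = 2 → ∀ i, i ≠ T.root → i = j := by
    intro j hj hc i hi
    by_contra hij
    have : ({T.root, j, i} : Finset I).card ≤ 2 := hc ▸ Finset.card_le_univ _
    rw [Finset.card_eq_three.2 ⟨_, _, _, hj.symm, hi.symm, Ne.symm hij, rfl⟩] at this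
    omega
  refine Finset.sum_bij (fun j _ => W j) ?_ ?_ ?_ ?_
  · intro j hj
    simp only [Finset.mem_filter, Finset.mem_univ, true_and] at hj ⊢
    obtain ⟨hc, hj, hn⟩ := hj
    refine ⟨hc, by simp [hW], ?_⟩
    rw [Fin.forall_fin_two]
    refine ⟨(card_fiber_eq_one_iff _ _).2 ⟨T.root, fun i => ?_⟩,
      (card_fiber_eq_one_iff _ _).2 ⟨j, fun i => ?_⟩⟩
    · by_cases hi : i = T.root <;> simp [hW, hi]
    · by_cases hi : i = T.root
      · simp [hW, hi, hj.symm]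
      · simp [hW, two j hj hn i hi, hj]
  · intro j hj j' hj' _
    simp only [Finset.mem_filter, Finset.mem_univ, true_and] at hj hj'
    exact two _ hj'.2.1 hj.2.2 _ hj.2.1
  · intro w hw
    simp only [Finset.mem_filter, Finset.mem_univ, true_and] at hw
    obtain ⟨hc, h0, hw⟩ := hw
    obtain ⟨i, hi⟩ := (card_fiber_eq_one_iff w 0).1 (hw 0)
    obtain ⟨j, hj⟩ := (card_fiber_eq_one_iff w 1).1 (hw 1)
    have h2 : T.root = i := (hi _).1 h0
    subst h2
    have hjr : j ≠ T.root := by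
      rintro rfl
      rw [(hj _).2 rfl] at h0
      exact absurd h0 (by decide)
    have h3 := sum_card_fiber w
    rw [Fin.sum_univ_two, hw, hw] at h3
    refine ⟨j, ?_, funext fun k => ?_⟩
    · simp only [Finset.mem_filter, Finset.mem_univ, true_and]
      exact ⟨hc, hjr, h3.symm⟩
    · by_cases hk : k = T.root
      · simp [hW, hk, h0]
      · have h5 := mt (hi k).1 hk
        simp only [hW, hk, if_false]
        exact (Fin.eq_one_of_ne_zero _ h5).symm
  · intro j hj
    simp only [Finset.mem_filter, Finset.mem_univ, true_and] at hj
    have hvec : (fun i => (Fin.cons x ![y] : Fin 2 → V) (W j i)) =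
        V.pairVec T.root j x y z := funext fun i => by
      by_cases hi : i = T.root
      · simp [hW, pairVec, hi]
      · simp [hW, pairVec, two j hj.2.1 hj.2.2 i hi, hj.2.1]
    rw [hvec, signOp_pure V (W j)
      (q := fun i => if i = T.root then a else if i = j then b else 0) ?_]
    · congr 3
      rw [Koszul.sign_pair _ _ hj.2.1.symm (by intro i h1 h2; simp [h1, h2])]
      simp [hW, pairSign, hj.2.1]
    · intro i
      by_cases hi : i = T.root
      · simp [hi, pairVec, hx]
      · simp [two j hj.2.1 hj.2.2 i hi, pairVec, hj.2.1, hy]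

end DGModule

/-! ### Combinatorics of the two kinds of cuts -/

namespace RTree

variable {I : Type} [DecidableEq I] (S : RTree I)

/-- The root block of a cut. -/
abbrev rootBlock (R : S.Cut) : R.Blocks := ⟨S.root, R.2⟩

/-- The cuts of a tree such that the root block is a corolla, to which the other blocks, which are
single vertices, are attached. -/
def IsLeafCut (R : S.Cut) : Prop :=
  (∀ v, v ∉ R.1 → S.parent v = S.root) ∧ ∀ v, v ∈ R.1 → S.parent v = S.root ∨ S.parent v ∉ R.1

variable {S}

theorem IsLeafCut.block_eq {R : S.Cut} (h : S.IsLeafCut R) {v : I} (hv : v ∉ R.1) :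
    S.block R v = S.rootBlock R := by
  rw [S.block_of_notMem R hv, h.1 v hv, S.block_of_mem R R.2]

theorem IsLeafCut.contract {R : S.Cut} (h : S.IsLeafCut R) : (S.contract R).IsCorolla := by
  intro b
  change S.block R (S.parent b.1) = S.rootBlock R
  rcases h.2 b.1 b.2 with h1 | h1
  · rw [h1, S.block_of_mem R R.2]
  · exact h.block_eq h1

theorem restrict_isCorolla_iff (R : S.Cut) (b : R.Blocks) : (S.restrict R b).IsCorolla ↔
    ∀ v, v ∉ R.1 → S.block R v = b → S.parent v = b.1 := by
  constructor
  · intro h v hv hb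
    have := congrArg Subtype.val (h ⟨v, hb⟩)
    rwa [S.restrict_parent, if_neg hv] at this
  · rintro h ⟨v, hv⟩
    refine Subtype.ext ?_
    rw [S.restrict_parent]
    change _ = b.1
    by_cases h1 : v ∈ R.1
    · rw [if_pos h1]
      rw [S.block_of_mem R h1] at hv
      exact congrArg Subtype.val hv
    · rw [if_neg h1, h v h1 hv]

theorem card_fiber_block_eq_one [Fintype I] (R : S.Cut) (b : R.Blocks) :
    Fintype.card {v // S.block R v = b} = 1 ↔ ∀ v, S.block R v = b → v = b.1 := by
  rw [card_fiber_eq_one_iff]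
  constructor
  · rintro ⟨i, hi⟩ v hv
    rw [(hi v).1 hv, ← (hi b.1).1 (S.block_of_mem R b.2)]
  · intro h
    refine ⟨b.1, fun j => ⟨h j, ?_⟩⟩
    rintro rfl
    exact S.block_of_mem R b.2

/-- The right hand side lists what makes a summand of the monad product non-zero when the outer
brace is applied to generators: its tree is a corolla, the root block carries a corolla, and the
unit `eta` is supported on trees with one vertex. -/
theorem isLeafCut_iff [Fintype I] (R : S.Cut) : S.IsLeafCut R ↔ (S.contract R).IsCorolla ∧
    (S.restrict R (S.rootBlock R)).IsCorolla ∧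
      ∀ b, b ≠ S.rootBlock R → Fintype.card {v // S.block R v = b} = 1 := by
  simp only [restrict_isCorolla_iff, card_fiber_block_eq_one]
  constructor
  · intro h
    refine ⟨h.contract, fun v hv _ => h.1 v hv, fun b hb v hv => ?_⟩
    by_cases h1 : v ∈ R.1
    · rw [← hv, S.block_of_mem R h1]
    · exact absurd (hv.symm.trans (h.block_eq h1)) hb
  · rintro ⟨h1, h2, h3⟩
    have key : ∀ v, v ∉ R.1 → S.block R v = S.rootBlock R := by
      intro v hv
      by_contra hb
      exact hv (h3 _ hb v rfl ▸ (S.block R v).2)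
    refine ⟨fun v hv => h2 v hv (key v hv), fun v hv => ?_⟩
    by_contra! hc
    have h4 : S.block R (S.parent v) = S.rootBlock R := h1 ⟨v, hv⟩
    rw [S.block_of_mem R hc.2] at h4
    exact hc.1 (congrArg Subtype.val h4)

theorem IsLeafCut.card [Fintype I] {R : S.Cut} (h : S.IsLeafCut R) :
    Fintype.card {v // S.block R v = S.rootBlock R} + Fintype.card R.Blocks =
      Fintype.card I + 1 := by
  have h1 := sum_card_fiber (S.block R)
  rw [← Finset.add_sum_erase _ _ (Finset.mem_univ (S.rootBlock R)),
    Finset.sum_congr rfl fun b hb => ((isLeafCut_iff R).1 h).2.2 b (Finset.ne_of_mem_erase hb)] at h1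
  simp only [Finset.sum_const, smul_eq_mul, mul_one, Finset.mem_univ, Finset.card_erase_of_mem,
    Finset.card_univ] at h1
  have : 0 < Fintype.card R.Blocks := Fintype.card_pos_iff.2 ⟨S.rootBlock R⟩
  omega

variable (S)

/-- The cut whose blocks are the root and the subtrees attached to the root. -/
def childCut [Fintype I] : S.Cut :=
  ⟨Finset.univ.filter fun v => S.parent v = S.root, by simp [S.parent_root]⟩

variable {S} [Fintype I]

theorem mem_childCut {v : I} : v ∈ S.childCut.1 ↔ S.parent v = S.root := by simp [childCut]

/-- If the root is a block by itself, every other block hangs on the root vertex, so the roots of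
blocks are the vertices whose parent is the root. The root itself is among them by the convention on
`parent`. -/
theorem eq_childCut {R : S.Cut} (h : (S.contract R).IsCorolla)
    (h1 : Fintype.card {v // S.block R v = S.rootBlock R} = 1) : R = S.childCut := by
  rw [card_fiber_block_eq_one] at h1
  refine Subtype.ext (Finset.ext fun v => ?_)
  rw [mem_childCut]
  constructor
  · intro hv
    exact h1 _ (h ⟨v, hv⟩)
  · intro hv
    by_contra hR
    have h2 := h1 v (by rw [S.block_of_notMem R hR, hv, S.block_of_mem R R.2])
    exact hR (h2 ▸ R.2)

theorem contract_childCut : (S.contract S.childCut).IsCorolla := fun b => by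
  change S.block S.childCut (S.parent b.1) = S.rootBlock S.childCut
  rw [mem_childCut.1 b.2, S.block_of_mem _ S.childCut.2]

theorem block_childCut_eq_root {v : I} (hv : S.block S.childCut v = S.rootBlock S.childCut) :
    v = S.root := by
  induction v using S.induct with
  | h v ih =>
    by_cases h : v ∈ S.childCut.1
    · rw [S.block_of_mem _ h] at hv
      exact congrArg Subtype.val hv
    · by_contra hr
      rw [S.block_of_notMem _ h] at hv
      exact h (mem_childCut.2 (ih hr hv))

theorem card_rootBlock_childCut :
    Fintype.card {v // S.block S.childCut v = S.rootBlock S.childCut} = 1 :=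
  (card_fiber_block_eq_one _ _).2 fun _ => block_childCut_eq_root

/-- Since the parent of the root is the root, the right hand side says that the depth is at most
two. -/
theorem childCut_corollas_iff : (∀ b, (S.restrict S.childCut b).IsCorolla) ↔
    ∀ v, S.parent (S.parent v) = S.root := by
  simp only [restrict_isCorolla_iff]
  constructor
  · intro h v
    by_cases hv : v ∈ S.childCut.1
    · rw [mem_childCut.1 hv, S.parent_root]
    · rw [h _ v hv rfl]
      exact mem_childCut.1 (S.block _ v).2
  · rintro h _ v hv rfl
    rw [S.block_of_notMem _ hv, S.block_of_mem _ (mem_childCut.2 (h v))]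

theorem block_childCut (h : ∀ v, S.parent (S.parent v) = S.root) (v : I) :
    (S.block S.childCut v).1 = if S.parent v = S.root then v else S.parent v := by
  split_ifs with hv
  · rw [S.block_of_mem _ (mem_childCut.2 hv)]
  · rw [S.block_of_notMem _ (mt mem_childCut.1 hv), S.block_of_mem _ (mem_childCut.2 (h v))]

/-- Only the child `j` of the root has children, and these have no children. -/
theorem childCut_single_iff (j : S.childCut.Blocks) :
    ((S.restrict S.childCut j).IsCorolla ∧ ∀ b, b ≠ S.rootBlock S.childCut → b ≠ j →
      Fintype.card {v // S.block S.childCut v = b} = 1) ↔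
    ∀ v, S.parent v = S.root ∨ S.parent v = j.1 := by
  simp only [restrict_isCorolla_iff, card_fiber_block_eq_one]
  have hjr : S.parent j.1 = S.root := mem_childCut.1 j.2
  constructor
  · rintro ⟨h1, h2⟩ v
    by_cases hv : v ∈ S.childCut.1
    · exact Or.inl (mem_childCut.1 hv)
    · right
      by_cases hb : S.block S.childCut v = j
      · exact h1 v hv hb
      · by_cases hr : S.block S.childCut v = S.rootBlock S.childCut
        · rw [block_childCut_eq_root hr] at hv
          exact absurd S.childCut.2 hv
        · have h3 := h2 _ hr hb v rfl
          exact absurd (h3 ▸ (S.block S.childCut v).2) hv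
  · intro h
    have hd : ∀ v, S.parent (S.parent v) = S.root := fun v => by
      rcases h v with h1 | h1
      · rw [h1, S.parent_root]
      · rw [h1, hjr]
    refine ⟨fun v hv _ => (h v).resolve_left (mt mem_childCut.2 hv), fun b hb hbj v hv => ?_⟩
    rw [← hv, block_childCut hd]
    split_ifs with h1
    · rfl
    · refine absurd ?_ hbj
      rw [← hv]
      refine Subtype.ext ?_
      rw [block_childCut hd, if_neg h1]
      exact (h v).resolve_left h1

theorem block_childCut_single {j : I} (hj : S.parent j = S.root)
    (h : ∀ v, S.parent v = S.root ∨ S.parent v = j) (v : I) :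
    (S.block S.childCut v).1 = if S.parent v = S.root then v else j := by
  rw [block_childCut fun v => ?_]
  · split_ifs with h1
    · rfl
    · exact (h v).resolve_left h1
  · rcases h v with h1 | h1
    · rw [h1, S.parent_root]
    · rw [h1, hj]

theorem card_childCut_single (j : S.childCut.Blocks)
    (h : ∀ v, S.parent v = S.root ∨ S.parent v = j.1) :
    Fintype.card {v // S.block S.childCut v = j} + Fintype.card S.childCut.Blocks =
      Fintype.card I + 1 := by
  have h1 := sum_card_fiber (S.block S.childCut)
  rw [← Finset.add_sum_erase _ _ (Finset.mem_univ j),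
    Finset.sum_congr rfl fun b hb => (show _ = 1 from ?_)] at h1
  · simp only [Finset.sum_const, smul_eq_mul, mul_one, Finset.mem_univ, Finset.card_erase_of_mem,
      Finset.card_univ] at h1
    have : 0 < Fintype.card S.childCut.Blocks := Fintype.card_pos_iff.2 ⟨j⟩
    omega
  · by_cases hr : b = S.rootBlock S.childCut
    · rw [hr]
      exact card_rootBlock_childCut
    · exact ((childCut_single_iff j).2 h).2 b hr (Finset.ne_of_mem_erase hb)

end RTree

/-! ### The monad product of a brace, as a sum over cuts -/

namespace DGModule

variable {K : Type u} [CommRing K] (V : DGModule.{u, v} K)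

/-- Insertion of a tensor into a block of a pure tensor. -/
noncomputable def ins {I J : Type} [Fintype I] [LinearOrder I] [Fintype J] [LinearOrder J]
    (p : I → J) (b : J) (v : I → V) : V.Tens {i // p i = b} →ₗ[K] V.Tens I :=
  V.join p ∘ₗ (PiTensorProduct.tprod K (s := fun j => V.Tens {i // p i = j})).toLinearMap
    (fun j => V.pure fun i : {i // p i = j} => v i) b

/-- This isolates the one block that carries something other than a generator. Since `ins` is
linear, the sum expressing the component at that block can be pulled out before evaluating on pure
tensors. -/
theorem join_eq_ins {I J : Type} [Fintype I] [LinearOrder I] [Fintype J] [LinearOrder J]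
    (p : I → J) (b : J) (v : I → V) (t : ∀ j, V.Tens {i // p i = j})
    (ht : ∀ j, j ≠ b → t j = V.pure fun i : {i // p i = j} => v i) :
    V.join p (PiTensorProduct.tprod K t) = V.ins p b v (t b) := by
  rw [ins, LinearMap.comp_apply, MultilinearMap.toLinearMap_apply]
  congr 2
  funext j
  by_cases hj : j = b
  · subst hj; simp
  · rw [Function.update_of_ne hj, ht j hj]

theorem ins_pure {I J : Type} [Fintype I] [LinearOrder I] [Fintype J] [LinearOrder J]
    (p : I → J) (b : J) {v u : I → V} {q : I → ℤ} (hu : ∀ i, u i ∈ V.gr (q i))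
    (huv : ∀ i, p i ≠ b → u i = v i) :
    V.ins p b v (V.pure fun i => u i) = ((Koszul.sign p q : ℤ) : K) • V.pure u := by
  rw [← V.join_pure p hu]
  refine (V.join_eq_ins p b v (fun j => V.pure fun i : {i // p i = j} => u i) fun j hj => ?_).symm
  refine congrArg V.pure (funext fun i => huv _ ?_)
  rw [i.2]
  exact hj

/-- An element of `Γ(PreLie, V)` all of whose components at trees other than corollas vanish. -/
def CorollaSupported (M : V.Gamma) : Prop :=
  ∀ {I : Type} [Fintype I] [LinearOrder I] (T : RTree I), ¬ T.IsCorolla → V.ev T M = 0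

theorem corollaSupported_braceGamma {p : ℕ} (x : V) (y : Fin p → V) (r : Fin p → ℕ)
    (h : V.Admissible y r) : V.CorollaSupported (V.braceGamma x y r h) := by
  classical
  intro I _ _ T hT
  rw [ev_braceGamma]
  exact Finset.sum_eq_zero fun w _ => if_neg fun h => hT h.1

variable {V}

-- For a cut that is not a leaf cut some tensor factor is zero: either `M` is evaluated at a tree
-- that is not a corolla, or `eta` at a tree with more than one vertex.
open Classical in
theorem muCut_eta {I : Type} [Fintype I] [LinearOrder I] (S : RTree I) (R : S.Cut)
    (hR : (S.contract R).IsCorolla) {M : V.Gamma} (hM : V.CorollaSupported M)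
    (g : R.Blocks → V.Gamma) (y : I → V) (hg : g (S.rootBlock R) = M)
    (hy : ∀ b, b ≠ S.rootBlock R → g b = V.eta (y b.1)) :
    V.muCut S R (V.Gamma.pure g) = if S.IsLeafCut R then
      V.ins (S.block R) (S.rootBlock R) y (V.ev (S.restrict R (S.rootBlock R)) M) else 0 := by
  rw [muCut_pure]
  split_ifs with h
  · have h1 := (RTree.isLeafCut_iff R).1 h
    rw [V.join_eq_ins _ (S.rootBlock R) y, hg]
    intro b hb
    rw [hy b hb, ev_eta, if_pos (h1.2.2 b hb)]
    refine congrArg V.pure (funext fun i => ?_)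
    rw [(RTree.card_fiber_block_eq_one R b).1 (h1.2.2 b hb) i.1 i.2]
  · rw [RTree.isLeafCut_iff, not_and, not_and] at h
    by_cases h1 : (S.restrict R (S.rootBlock R)).IsCorolla
    · have h2 := h hR h1
      push Not at h2
      obtain ⟨b, hb, hb'⟩ := h2
      rw [MultilinearMap.map_coord_zero _ b, map_zero]
      rw [hy b hb, ev_eta, if_neg hb']
    · rw [MultilinearMap.map_coord_zero _ (S.rootBlock R), map_zero]
      rw [hg, hM _ h1]

/-- A generator at the root of the outer brace forces the root block to be a single vertex, which
leaves only the child cut. -/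
theorem muCut_eq_zero_of_ne_childCut {I : Type} [Fintype I] [LinearOrder I] (S : RTree I)
    {R : S.Cut} (hR : (S.contract R).IsCorolla) (hne : R ≠ S.childCut) (g : R.Blocks → V.Gamma)
    {x : V} (hg : g (S.rootBlock R) = V.eta x) : V.muCut S R (V.Gamma.pure g) = 0 := by
  rw [muCut_pure, MultilinearMap.map_coord_zero _ (S.rootBlock R), map_zero]
  rw [hg, ev_eta, if_neg fun h => hne (RTree.eq_childCut hR h)]

-- Here `M` sits at the child `j` and generators sit at the other blocks, so the product survives
-- only if no child of the root other than `j` has children and the block of `j` is a corolla.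
open Classical in
theorem muCut_childCut {I : Type} [Fintype I] [LinearOrder I] (S : RTree I) {M : V.Gamma}
    (hM : V.CorollaSupported M) (j : S.childCut.Blocks) (hj : j ≠ S.rootBlock S.childCut)
    (x z : V) :
    V.muCut S S.childCut (V.Gamma.pure
        (V.Gamma.pairVec (S.rootBlock S.childCut) j (V.eta x) M (V.eta z))) =
      if ∀ v, S.parent v = S.root ∨ S.parent v = j.1 then
        V.ins (S.block S.childCut) j (V.rootVec S.root x z) (V.ev (S.restrict S.childCut j) M)
      else 0 := by
  rw [muCut_pure]
  have hgj : V.Gamma.pairVec (S.rootBlock S.childCut) j (V.eta x) M (V.eta z) j = M := by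
    simp [pairVec, hj]
  split_ifs with h <;> rw [← RTree.childCut_single_iff j] at h
  · rw [V.join_eq_ins _ j (V.rootVec S.root x z), hgj]
    intro b hb
    by_cases hr : b = S.rootBlock S.childCut
    · subst hr
      simp only [pairVec, if_true]
      rw [ev_eta, if_pos RTree.card_rootBlock_childCut]
      refine congrArg V.pure (funext fun i => ?_)
      rw [RTree.block_childCut_eq_root i.2]
      simp [rootVec]
    · have h1 := h.2 b hr hb
      simp only [pairVec, hr, hb, if_false]
      rw [ev_eta, if_pos h1]
      refine congrArg V.pure (funext fun i => ?_)
      rw [(RTree.card_fiber_block_eq_one _ b).1 h1 i.1 i.2, rootVec, if_neg]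
      exact fun h => hr (Subtype.ext h)
  · rw [not_and] at h
    by_cases h1 : (S.restrict S.childCut j).IsCorolla
    · have h2 := h h1
      push Not at h2
      obtain ⟨b, hb, hbj, hb'⟩ := h2
      rw [MultilinearMap.map_coord_zero _ b, map_zero]
      simp only [pairVec, hb, hbj, if_false]
      rw [ev_eta, if_neg hb']
    · rw [MultilinearMap.map_coord_zero _ j, map_zero]
      rw [hgj, hM _ h1]

theorem muAt_apply {I : Type} [Fintype I] [LinearOrder I] (S : RTree I) (x : V.Gamma.Gamma) :
    V.muAt S x = ∑ R : S.Cut, V.muCut S R (V.Gamma.ev (S.contract R) x) := by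
  rw [muAt, LinearMap.sum_apply]
  rfl

open Classical in
theorem muAt_single {M : V.Gamma} {m : ℤ} (hM : V.CorollaSupported M) (hm : M ∈ V.Gamma.gr m)
    {z : V} (hz : z ∈ V.gr 0) (n : ℕ) (h : V.Gamma.Admissible ![V.eta z] ![n])
    {I : Type} [Fintype I] [LinearOrder I] (S : RTree I) :
    V.muAt S (V.Gamma.braceGamma M ![V.eta z] ![n] h) = ∑ R : S.Cut,
      if S.IsLeafCut R ∧ Fintype.card R.Blocks = n + 1 then
        V.ins (S.block R) (S.rootBlock R) (fun _ => z) (V.ev (S.restrict R (S.rootBlock R)) M)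
      else 0 := by
  rw [muAt_apply]
  refine Finset.sum_congr rfl fun R _ => ?_
  rw [V.Gamma.ev_braceGamma_single hm (V.eta_mem hz) n h]
  by_cases hc : (S.contract R).IsCorolla
  · by_cases hn : Fintype.card R.Blocks = n + 1
    · rw [if_pos ⟨hc, hn⟩, muCut_eta S R hc hM _ (fun _ => z)]
      · simp [hn]
      · exact if_pos rfl
      · exact fun b hb => if_neg hb
    · rw [if_neg fun h => hn h.2, if_neg fun h => hn h.2, map_zero]
  · rw [if_neg fun h => hc h.1, map_zero, if_neg fun h => hc h.1.contract]

open Classical in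
theorem muAt_one {M : V.Gamma} {m b : ℤ} (hM : V.CorollaSupported M) (hm : M ∈ V.Gamma.gr m)
    {y : V} (hy : y ∈ V.gr b) (h : V.Gamma.Admissible ![V.eta y] ![1])
    {I : Type} [Fintype I] [LinearOrder I] (S : RTree I) :
    V.muAt S (V.Gamma.braceGamma M ![V.eta y] ![1] h) = ∑ R : S.Cut, ∑ j : R.Blocks,
      if S.IsLeafCut R ∧ j ≠ S.rootBlock R ∧ Fintype.card R.Blocks = 2 then
        ((pairSign S.root j.1 m b : ℤ) : K) •
        V.ins (S.block R) (S.rootBlock R) (fun _ => y) (V.ev (S.restrict R (S.rootBlock R)) M)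
      else 0 := by
  rw [muAt_apply]
  refine Finset.sum_congr rfl fun R _ => ?_
  rw [V.Gamma.ev_braceGamma_one hm (V.eta_mem hy) h (V.eta y), map_sum]
  refine Finset.sum_congr rfl fun j _ => ?_
  by_cases hc : (S.contract R).IsCorolla
  · by_cases hn : j ≠ S.rootBlock R ∧ Fintype.card R.Blocks = 2
    · rw [if_pos ⟨hc, hn⟩, map_smul, muCut_eta S R hc hM _ (fun _ => y)]
      · by_cases hl : S.IsLeafCut R
        · rw [if_pos hl, if_pos ⟨hl, hn⟩]
          rfl
        · rw [if_neg hl, if_neg fun h => hl h.1, smul_zero]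
      · exact if_pos rfl
      · intro b hb
        rw [pairVec]
        refine (if_neg hb).trans ?_
        split_ifs <;> rfl
    · rw [if_neg fun h => hn h.2, if_neg fun h => hn h.2, map_zero]
  · rw [if_neg fun h => hc h.1, map_zero, if_neg fun h => hc h.1.contract]

-- All cuts but the child cut drop out, and the remaining sum runs over the child `j` of the root at
-- which `M` is inserted. The sign moves `M` past `x` as a whole, hence depends on the degree `m` of
-- `M` and on the position of the root of its block.
open Classical in
theorem muAt_pair {M : V.Gamma} {a m : ℤ} (hM : V.CorollaSupported M) (hm : M ∈ V.Gamma.gr m)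
    {x z : V} (hx : x ∈ V.gr a) (hz : z ∈ V.gr 0) (n : ℕ)
    (h : V.Gamma.Admissible ![M, V.eta z] ![1, n])
    {I : Type} [Fintype I] [LinearOrder I] (S : RTree I) :
    V.muAt S (V.Gamma.braceGamma (V.eta x) ![M, V.eta z] ![1, n] h) = ∑ j : S.childCut.Blocks,
      if j ≠ S.rootBlock S.childCut ∧ (∀ v, S.parent v = S.root ∨ S.parent v = j.1) ∧
          Fintype.card S.childCut.Blocks = n + 2 then
        ((pairSign S.root j.1 a m : ℤ) : K) • V.ins (S.block S.childCut) j
          (V.rootVec S.root x z) (V.ev (S.restrict S.childCut j) M)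
      else 0 := by
  rw [muAt_apply, Finset.sum_eq_single S.childCut]
  · rw [V.Gamma.ev_braceGamma_pair (V.eta_mem hx) hm (V.eta_mem hz), map_sum]
    refine Finset.sum_congr rfl fun j _ => ?_
    have hc := RTree.contract_childCut (S := S)
    by_cases hn : j ≠ S.rootBlock S.childCut ∧ Fintype.card S.childCut.Blocks = n + 2
    · rw [if_pos ⟨hc, hn⟩, map_smul]
      have := muCut_childCut S hM j hn.1 x z
      refine (congrArg (_ • ·) this).trans ?_
      by_cases hl : ∀ v, S.parent v = S.root ∨ S.parent v = j.1
      · rw [if_pos hl, if_pos ⟨hn.1, hl, hn.2⟩]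
        rfl
      · rw [if_neg hl, if_neg fun h => hl h.2.1, smul_zero]
    · rw [if_neg fun h => hn h.2, if_neg fun h => hn ⟨h.1, h.2.2⟩, map_zero]
  · intro R _ hne
    rw [V.Gamma.ev_braceGamma_pair (V.eta_mem hx) hm (V.eta_mem hz), map_sum]
    refine Finset.sum_eq_zero fun j _ => ?_
    split_ifs with hc
    · rw [map_smul, muCut_eq_zero_of_ne_childCut S hc.1 hne _ (if_pos rfl), smul_zero]
    · rw [map_zero]
  · simp

end DGModule

/-! ### Sums over cuts rewritten as sums over vertices -/

namespace RTree

theorem eq_root_of_parent_eq {I : Type} {S : RTree I} {v : I} (h : S.parent v = v) : v = S.root := by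
  obtain ⟨k, hk⟩ := S.reach v
  rwa [Function.iterate_fixed h] at hk

variable {I : Type} [DecidableEq I] {S : RTree I}

theorem coe_block_eq_iff (R : S.Cut) {v : I} (hv : v ∈ R.1) (b : R.Blocks) :
    S.block R v = b ↔ v = b.1 := by
  rw [S.block_of_mem R hv, Subtype.ext_iff]

variable [Fintype I] {E : Type*} [AddCommMonoid E]

open Classical in
/-- Leaf cuts with two blocks are given by a leaf such that all other vertices are attached to the
root. -/
theorem sum_isLeafCut_two (F : I → E) :
    (∑ R : S.Cut, ∑ j : R.Blocks,
      if S.IsLeafCut R ∧ j ≠ S.rootBlock R ∧ Fintype.card R.Blocks = 2 then F j.1 else 0) =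
    ∑ j, if j ≠ S.root ∧ ∀ v, v ≠ j → S.parent v = S.root then F j else 0 := by
  rw [Finset.sum_sigma', ← Finset.sum_filter, ← Finset.sum_filter]
  -- With two blocks the cut is the set formed by the root and `j`.
  have key : ∀ (R : S.Cut) (j : R.Blocks), j ≠ S.rootBlock R → Fintype.card R.Blocks = 2 →
      ∀ v, v ∈ R.1 ↔ v = S.root ∨ v = j.1 := by
    intro R j hj hc v
    have h1 : (Finset.univ : Finset R.Blocks) = {S.rootBlock R, j} := by
      symm
      rw [← Finset.card_eq_iff_eq_univ, Finset.card_pair hj.symm, hc]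
    constructor
    · intro hv
      have h2 := h1 ▸ Finset.mem_univ (⟨v, hv⟩ : R.Blocks)
      rw [Finset.mem_insert, Finset.mem_singleton] at h2
      exact h2.imp (congrArg Subtype.val) (congrArg Subtype.val)
    · rintro (rfl | rfl)
      exacts [R.2, j.2]
  refine Finset.sum_bij (fun x _ => x.2.1) ?_ ?_ ?_ fun _ _ => rfl
  · rintro ⟨R, j⟩ h
    simp only [Finset.mem_filter, Finset.mem_sigma, Finset.mem_univ, true_and] at h ⊢
    obtain ⟨h1, h2, h3⟩ := h
    have hR := key R j h2 h3
    refine ⟨fun h => h2 (Subtype.ext h), fun v hv => ?_⟩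
    by_cases hr : v = S.root
    · rw [hr, S.parent_root]
    · exact h1.1 v (by rw [hR]; tauto)
  · rintro ⟨R, j⟩ h ⟨R', j'⟩ h' hjj
    simp only [Finset.mem_filter, Finset.mem_sigma, Finset.mem_univ, true_and] at h h' hjj
    have hR : R = R' := Subtype.ext (Finset.ext fun v => by
      rw [key R j h.2.1 h.2.2, key R' j' h'.2.1 h'.2.2, hjj])
    subst hR
    rw [Subtype.ext hjj]
  · intro j hj
    simp only [Finset.mem_filter, Finset.mem_univ, true_and] at hj
    set R : S.Cut := ⟨{S.root, j}, by simp⟩ with hR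
    refine ⟨⟨R, ⟨j, by simp [hR]⟩⟩, ?_, rfl⟩
    simp only [Finset.mem_filter, Finset.mem_sigma, Finset.mem_univ, true_and]
    refine ⟨⟨fun v hv => ?_, fun v hv => ?_⟩, fun h => hj.1 (congrArg Subtype.val h), ?_⟩
    · simp only [hR, Finset.mem_insert, Finset.mem_singleton, not_or] at hv
      exact hj.2 v hv.2
    · simp only [hR, Finset.mem_insert, Finset.mem_singleton, not_or] at hv ⊢
      by_cases h0 : S.parent v = S.root
      · exact Or.inl h0
      · right
        refine ⟨h0, fun h1 => ?_⟩
        -- Every vertex other than `j` is attached to the root, so `v` would be `j` and its own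
        -- parent, but the root is the only fixed point of `parent`.
        have h2 : v = j := by
          by_contra h2
          exact h0 (hj.2 v h2)
        exact hj.1 (eq_root_of_parent_eq (h2 ▸ h1 : S.parent j = j))
    · rw [Fintype.card_coe]
      exact Finset.card_pair (Ne.symm hj.1)

open Classical in
/-- Leaf cuts whose root block has two vertices. -/
theorem sum_isLeafCut_rootBlock_two (F : I → E) (n : ℕ) :
    (∑ R : S.Cut, ∑ j : {v // S.block R v = S.rootBlock R},
      if S.IsLeafCut R ∧ Fintype.card R.Blocks = n + 1 ∧ j.1 ≠ S.root ∧
        Fintype.card {v // S.block R v = S.rootBlock R} = 2 then F j.1 else 0) =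
    ∑ j, if j ≠ S.root ∧ S.parent j = S.root ∧ (∀ v, S.parent v = S.root ∨ S.parent v = j) ∧
      Fintype.card I = n + 2 then F j else 0 := by
  rw [Finset.sum_sigma', ← Finset.sum_filter, ← Finset.sum_filter]
  -- The root block consists of the root and `j`, so `j` is the only vertex that is not the root of
  -- a block.
  have key : ∀ (R : S.Cut) (j : {v // S.block R v = S.rootBlock R}), S.IsLeafCut R →
      j.1 ≠ S.root → Fintype.card {v // S.block R v = S.rootBlock R} = 2 →
      ∀ v, v ∉ R.1 ↔ v = j.1 := by
    intro R j hl hj hc v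
    set r : {v // S.block R v = S.rootBlock R} := ⟨S.root, S.block_of_mem R R.2⟩ with hr
    have h1 : (Finset.univ : Finset {v // S.block R v = S.rootBlock R}) = {r, j} := by
      symm
      rw [← Finset.card_eq_iff_eq_univ, Finset.card_pair, hc]
      intro h
      exact hj (congrArg Subtype.val h).symm
    constructor
    · intro hv
      have h2 := h1 ▸ Finset.mem_univ
        (⟨v, hl.block_eq hv⟩ : {v // S.block R v = S.rootBlock R})
      rw [Finset.mem_insert, Finset.mem_singleton] at h2
      rcases h2 with h2 | h2
      · have h3 : v = S.root := congrArg Subtype.val h2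
        exact absurd R.2 (h3 ▸ hv)
      · exact congrArg Subtype.val h2
    · rintro rfl hR
      exact hj ((coe_block_eq_iff R hR _).1 j.2)
  refine Finset.sum_bij (fun x _ => x.2.1) ?_ ?_ ?_ fun _ _ => rfl
  · rintro ⟨R, j⟩ h
    simp only [Finset.mem_filter, Finset.mem_sigma, Finset.mem_univ, true_and] at h ⊢
    obtain ⟨h1, h2, h3, h4⟩ := h
    have hR := key R j h1 h3 h4
    have h5 := h1.card
    refine ⟨h3, h1.1 _ ((hR _).2 rfl), fun v => ?_, by omega⟩
    by_cases hv : v ∈ R.1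
    · exact (h1.2 v hv).imp_right (hR _).1
    · exact Or.inl (h1.1 v hv)
  · rintro ⟨R, j⟩ h ⟨R', j'⟩ h' hjj
    simp only [Finset.mem_filter, Finset.mem_sigma, Finset.mem_univ, true_and] at h h' hjj
    have hR : R = R' := Subtype.ext (Finset.ext fun v => by
      rw [← not_iff_not, key R j h.1 h.2.2.1 h.2.2.2, key R' j' h'.1 h'.2.2.1 h'.2.2.2, hjj])
    subst hR
    rw [Subtype.ext hjj]
  · intro j hj
    simp only [Finset.mem_filter, Finset.mem_univ, true_and] at hj
    -- Only the edge from `j` to the root is kept, all other edges are cut.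
    set R : S.Cut := ⟨Finset.univ.erase j, by simp [hj.1.symm]⟩ with hR
    have hmem : ∀ v, v ∈ R.1 ↔ v ≠ j := fun v => by simp [hR]
    have hl : S.IsLeafCut R := by
      refine ⟨fun v hv => ?_, fun v hv => ?_⟩
      · rw [hmem, not_not] at hv
        rw [hv, hj.2.1]
      · rw [hmem, not_not]
        exact hj.2.2.1 v
    have hc : Fintype.card R.Blocks = n + 1 := by
      rw [Fintype.card_coe]
      simp [hR, hj.2.2.2]
    have h5 := hl.card
    refine ⟨⟨R, ⟨j, hl.block_eq (by simp [hmem])⟩⟩, ?_, rfl⟩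
    simp only [Finset.mem_filter, Finset.mem_sigma, Finset.mem_univ, true_and]
    exact ⟨hl, hc, hj.1, by omega⟩

open Classical in
theorem sum_childCut_blocks (F : I → E) (P : I → Prop) :
    (∑ j : S.childCut.Blocks, if P j.1 then F j.1 else 0) =
      ∑ j, if S.parent j = S.root ∧ P j then F j else 0 := by
  rw [Finset.sum_coe_sort S.childCut.1 fun j => if P j then F j else 0, childCut,
    Finset.sum_filter]
  refine Finset.sum_congr rfl fun j _ => ?_
  rw [ite_and]

open Classical in
/-- Cuts such that the root and all but one of the other blocks are single vertices, and the
remaining block has two vertices. -/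
theorem sum_childCut_two (F : I → I → E) (n : ℕ) :
    (∑ j : S.childCut.Blocks, ∑ k : {v // S.block S.childCut v = j},
      if (j ≠ S.rootBlock S.childCut ∧ (∀ v, S.parent v = S.root ∨ S.parent v = j.1) ∧
        Fintype.card S.childCut.Blocks = n + 2) ∧ k.1 ≠ j.1 ∧
        Fintype.card {v // S.block S.childCut v = j} = 2 then F j.1 k.1 else 0) =
    ∑ k, if k ≠ S.root ∧ (∀ v, v ≠ k → S.parent v = S.root) ∧ S.parent k ≠ S.root ∧
      Fintype.card I = n + 3 then F (S.parent k) k else 0 := by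
  rw [Finset.sum_sigma', ← Finset.sum_filter, ← Finset.sum_filter]
  have hpar : ∀ (j : S.childCut.Blocks) (k : {v // S.block S.childCut v = j}), k.1 ≠ j.1 →
      (∀ v, S.parent v = S.root ∨ S.parent v = j.1) → S.parent k.1 ≠ S.root := by
    intro j k hk h hkr
    have h2 := block_childCut_single (mem_childCut.1 j.2) h k.1
    rw [if_pos hkr, k.2] at h2
    exact hk h2.symm
  have key : ∀ (j : S.childCut.Blocks) (k : {v // S.block S.childCut v = j}), k.1 ≠ j.1 →
      (∀ v, S.parent v = S.root ∨ S.parent v = j.1) →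
      Fintype.card {v // S.block S.childCut v = j} = 2 →
      ∀ v, v ≠ k.1 → S.parent v = S.root := by
    intro j k hk h hc v hv
    set r : {v // S.block S.childCut v = j} := ⟨j.1, S.block_of_mem _ j.2⟩ with hr
    have h1 : (Finset.univ : Finset {v // S.block S.childCut v = j}) = {r, k} := by
      symm
      rw [← Finset.card_eq_iff_eq_univ, Finset.card_pair, hc]
      intro h
      exact hk (congrArg Subtype.val h).symm
    by_contra hvr
    have h2 : S.block S.childCut v = j := Subtype.ext (by
      rw [block_childCut_single (mem_childCut.1 j.2) h, if_neg hvr])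
    have h3 := h1 ▸ Finset.mem_univ (⟨v, h2⟩ : {v // S.block S.childCut v = j})
    rw [Finset.mem_insert, Finset.mem_singleton] at h3
    rcases h3 with h3 | h3
    · have h4 : v = j.1 := congrArg Subtype.val h3
      exact hvr (h4 ▸ mem_childCut.1 j.2)
    · exact hv (congrArg Subtype.val h3)
  refine Finset.sum_bij (fun x _ => x.2.1) ?_ ?_ ?_ ?_
  · rintro ⟨j, k⟩ h
    simp only [Finset.mem_filter, Finset.mem_sigma, Finset.mem_univ, true_and] at h ⊢
    obtain ⟨⟨h1, h2, h3⟩, h4, h5⟩ := h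
    have h6 := card_childCut_single j h2
    have h7 := hpar j k h4 h2
    refine ⟨fun h => h7 (by rw [h, S.parent_root]), key j k h4 h2 h5, h7, by omega⟩
  · rintro ⟨j, k⟩ h ⟨j', k'⟩ h' hkk
    simp only [Finset.mem_filter, Finset.mem_sigma, Finset.mem_univ, true_and] at h h' hkk
    have hj : j = j' := by rw [← k.2, ← k'.2, hkk]
    subst hj
    rw [Subtype.ext hkk]
  · intro k hk
    simp only [Finset.mem_filter, Finset.mem_univ, true_and] at hk
    obtain ⟨h1, h2, h3, h4⟩ := hk
    have hkk : S.parent k ≠ k := fun h => h1 (eq_root_of_parent_eq h)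
    -- The vertex `k` is the only one at distance two from the root, so the block with two vertices
    -- consists of `k` and its parent.
    set j : S.childCut.Blocks := ⟨S.parent k, mem_childCut.2 (h2 _ hkk)⟩ with hj
    have h5 : ∀ v, S.parent v = S.root ∨ S.parent v = j.1 := by
      intro v
      by_cases hv : v = k
      · exact Or.inr (hv ▸ rfl)
      · exact Or.inl (h2 v hv)
    have h6 : S.block S.childCut k = j := Subtype.ext (by
      rw [block_childCut_single (mem_childCut.1 j.2) h5, if_neg h3])
    have h7 : Fintype.card {v // S.block S.childCut v = j} = 2 := by
      rw [← Finset.card_univ, Finset.card_eq_two]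
      refine ⟨⟨j.1, S.block_of_mem _ j.2⟩, ⟨k, h6⟩, fun h => hkk (congrArg Subtype.val h), ?_⟩
      refine Finset.eq_univ_of_forall (fun ⟨v, hv⟩ => ?_) |>.symm
      rw [Finset.mem_insert, Finset.mem_singleton]
      by_cases hvk : v = k
      · exact Or.inr (Subtype.ext hvk)
      · left
        refine Subtype.ext ?_
        rw [coe_block_eq_iff _ (mem_childCut.2 (h2 v hvk))] at hv
        exact hv
    have h8 := card_childCut_single j h5
    refine ⟨⟨j, ⟨k, h6⟩⟩, ?_, rfl⟩
    simp only [Finset.mem_filter, Finset.mem_sigma, Finset.mem_univ, true_and]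
    exact ⟨⟨fun h => h3 (congrArg Subtype.val h), h5, by omega⟩, hkk.symm, h7⟩
  · rintro ⟨j, k⟩ h
    simp only [Finset.mem_filter, Finset.mem_sigma, Finset.mem_univ, true_and] at h
    have h1 := hpar j k h.2.1 h.1.2.1
    rw [(h.1.2.1 k.1).resolve_left h1]

end RTree

/-! ### The identity (x{y}){z}_n = ∑ x{y{z}_i, z}_{1, k} in the free algebra -/

namespace DGModule

variable {K : Type u} [CommRing K] (V : DGModule.{u, v} K)

theorem pure_mem_degPart {I : Type} [Fintype I] {q : I → ℤ} {v : I → V}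
    (hv : ∀ i, v i ∈ V.gr (q i)) {k : ℤ} (hk : ∑ i, q i = k) : V.pure v ∈ V.degPart I k :=
  Submodule.subset_span ⟨q, v, hv, hk, rfl⟩

theorem mem_gamma_gr {f : V.Gamma} {k : ℤ}
    (h : ∀ (n : ℕ) (T : RTree (Fin n)), V.ev T f ∈ V.degPart (Fin n) k) : f ∈ V.Gamma.gr k :=
  fun n T => V.ev_fin T f ▸ h n T

theorem braceGamma_mem {p : ℕ} {x : V} {a : ℤ} (hx : x ∈ V.gr a) {y : Fin p → V}
    (hy : ∀ i, y i ∈ V.gr 0) (r : Fin p → ℕ) (h : V.Admissible y r) :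
    V.braceGamma x y r h ∈ V.Gamma.gr a := by
  classical
  refine V.mem_gamma_gr fun n T => ?_
  rw [V.ev_braceGamma_of_mem hx hy]
  refine sum_mem fun w _ => ?_
  split_ifs with hw
  · obtain ⟨i, hi⟩ := (card_fiber_eq_one_iff w 0).1 (hw.2.2 0)
    refine V.pure_mem_degPart (q := fun i => (Fin.cons a fun _ => 0 : Fin (p + 1) → ℤ) (w i))
      (fun i => ?_) ?_
    · cases w i using Fin.cases with
      | zero => exact hx
      | succ c => exact hy c
    · rw [Finset.sum_eq_single i]
      · rw [(hi i).2 rfl, Fin.cons_zero]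
      · intro j _ hj
        obtain ⟨c, hc⟩ := Fin.exists_succ_eq.2 (mt (hi j).1 hj)
        rw [← hc, Fin.cons_succ]
      · simp
  · exact zero_mem _

theorem rootVec_mem {I : Type} [DecidableEq I] (r : I) {x z : V} {a : ℤ} (hx : x ∈ V.gr a)
    (hz : z ∈ V.gr 0) (i : I) : V.rootVec r x z i ∈ V.gr (if i = r then a else 0) := by
  simp only [rootVec]
  split_ifs <;> assumption

theorem pairVec_mem {I : Type} [DecidableEq I] (r j : I) {x y z : V} {a b : ℤ} (hx : x ∈ V.gr a)
    (hy : y ∈ V.gr b) (hz : z ∈ V.gr 0) (i : I) :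
    V.pairVec r j x y z i ∈ V.gr (if i = r then a else if i = j then b else 0) := by
  simp only [pairVec]
  split_ifs <;> assumption

theorem braceGamma_pair_mem {x y z : V} {a b : ℤ} (hx : x ∈ V.gr a) (hy : y ∈ V.gr b)
    (hz : z ∈ V.gr 0) (n : ℕ) (h : V.Admissible ![y, z] ![1, n]) :
    V.braceGamma x ![y, z] ![1, n] h ∈ V.Gamma.gr (a + b) := by
  classical
  refine V.mem_gamma_gr fun n T => ?_
  rw [V.ev_braceGamma_pair hx hy hz]
  refine sum_mem fun j _ => ?_
  split_ifs with hj
  · refine Submodule.smul_mem _ _ (V.pure_mem_degPart (V.pairVec_mem _ _ hx hy hz) ?_)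
    have : ∀ i, (if i = T.root then a else if i = j then b else 0) =
        (if i = T.root then a else 0) + if i = j then b else 0 := fun i => by
      by_cases hi : i = T.root
      · simp [hi, hj.2.1.symm]
      · simp [hi]
    simp [this, Finset.sum_add_distrib]
  · exact zero_mem _

/-- An argument of weight zero plays no role. This lets facts about x{y, z}_{1, n} be specialised to
x{y}_1. -/
theorem braceGamma_one_eq {x y z : V} {a b : ℤ} (hx : x ∈ V.gr a) (hy : y ∈ V.gr b)
    (hz : z ∈ V.gr 0) (h : V.Admissible ![y] ![1]) (h' : V.Admissible ![y, z] ![1, 0]) :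
    V.braceGamma x ![y] ![1] h = V.braceGamma x ![y, z] ![1, 0] h' := by
  classical
  refine V.gamma_ext fun n T => ?_
  rw [V.ev_braceGamma_one hx hy h z, V.ev_braceGamma_pair hx hy hz]

theorem braceGamma_one_mem {x y : V} {a b : ℤ} (hx : x ∈ V.gr a) (hy : y ∈ V.gr b)
    (h : V.Admissible ![y] ![1]) : V.braceGamma x ![y] ![1] h ∈ V.Gamma.gr (a + b) := by
  have hz : (0 : V) ∈ V.gr 0 := zero_mem _
  rw [V.braceGamma_one_eq hx hy hz h (V.admissible_pair y hz 0)]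
  exact V.braceGamma_pair_mem hx hy hz 0 _

variable {V}

theorem rootVec_coe {I : Type} [DecidableEq I] {P : I → Prop} [DecidableEq {i // P i}] (r : {i // P i}) (x y : V) :
    V.rootVec r x y = fun i => V.rootVec r.1 x y i.1 := by
  funext i
  simp only [rootVec, Subtype.ext_iff]

theorem pairVec_coe {I : Type} [DecidableEq I] {P : I → Prop} [DecidableEq {i // P i}] (r j : {i // P i}) (x y z : V) :
    V.pairVec r j x y z = fun i => V.pairVec r.1 j.1 x y z i.1 := by
  funext i
  simp only [pairVec, Subtype.ext_iff]

theorem sign_pairVec {I J : Type} [Fintype I] [LinearOrder I] [LinearOrder J] (p : I → J) {r j : I}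
    (hrj : j ≠ r) (a b : ℤ) :
    Koszul.sign p (fun i => if i = r then a else if i = j then b else 0) =
      if (r < j ∧ p j < p r) ∨ (j < r ∧ p r < p j) then Koszul.swapSign a b else 1 := by
  rw [Koszul.sign_pair p _ hrj.symm fun i h1 h2 => by simp [h1, h2]]
  simp [hrj]

open Classical in
/-- The brace identity `(x{y}){z}_n = ∑ x{y{z}_i, z}_{1, k}`, `i + k = n`. -/
theorem muAt_one_single {x y z : V} {a b : ℤ} (hx : x ∈ V.gr a) (hy : y ∈ V.gr b)
    (hz : z ∈ V.gr 0) (n : ℕ) {I : Type} [Fintype I] [LinearOrder I] (S : RTree I) :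
    V.muAt S (V.Gamma.braceGamma (V.braceGamma x ![y] ![1] V.admissible_one) ![V.eta z] ![n]
      (V.Gamma.admissible_single (V.eta_mem hz) n)) =
    ∑ k ∈ Finset.HasAntidiagonal.antidiagonal n, V.muAt S (V.Gamma.braceGamma (V.eta x)
      ![V.braceGamma y ![z] ![k.1] (V.admissible_single hz k.1), V.eta z] ![1, k.2]
      (V.Gamma.admissible_pair _ (V.eta_mem hz) k.2)) := by
  set F : I → V.Tens (I) := fun j =>
    ((pairSign S.root j a b : ℤ) : K) • V.pure (V.pairVec S.root j x y z) with hF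
  have hl := muAt_single (V.corollaSupported_braceGamma x ![y] ![1] V.admissible_one)
    (V.braceGamma_one_mem hx hy _) hz n (V.Gamma.admissible_single (V.eta_mem hz) n) S
  have hr := fun k : ℕ × ℕ => muAt_pair
    (V.corollaSupported_braceGamma y ![z] ![k.1] (V.admissible_single hz k.1))
    (V.braceGamma_mem hy (fun i => by fin_cases i; exact hz) ![k.1] _) hx hz k.2
    (V.Gamma.admissible_pair _ (V.eta_mem hz) k.2) S
  rw [hl]
  simp only [hr]
  -- Both sides decorate the same trees: `x` at the root, `y` at a child `j` of the root, and `z` at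
  -- all other vertices, each attached to the root or to `j`.
  trans ∑ j, if j ≠ S.root ∧ S.parent j = S.root ∧ (∀ v, S.parent v = S.root ∨ S.parent v = j) ∧
      Fintype.card (I) = n + 2 then F j else 0
  · rw [← RTree.sum_isLeafCut_rootBlock_two]
    refine Finset.sum_congr rfl fun R _ => ?_
    by_cases hR : S.IsLeafCut R ∧ Fintype.card R.Blocks = n + 1
    · rw [if_pos hR, V.ev_braceGamma_one hx hy _ z, map_sum]
      refine Finset.sum_congr rfl fun j _ => ?_
      have hc := ((RTree.isLeafCut_iff R).1 hR.1).2.1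
      by_cases hj : j.1 ≠ S.root ∧ Fintype.card {v // S.block R v = S.rootBlock R} = 2
      · rw [if_pos ⟨hc, fun h => hj.1 (congrArg Subtype.val h), hj.2⟩,
          if_pos ⟨hR.1, hR.2, hj⟩, map_smul, pairVec_coe]
        refine congrArg (_ • ·) ?_
        refine (V.ins_pure _ _ (V.pairVec_mem S.root j.1 hx hy hz) fun i hi => ?_).trans ?_
        · rw [pairVec, if_neg, if_neg]
          · rintro rfl
            exact hi j.2
          · rintro rfl
            exact hi (S.block_of_mem R R.2)
        -- The vertices carrying `x` and `y` lie in the same block, so reassembling the tensor adds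
        -- no sign to the one already present in x{y}.
        · rw [sign_pairVec _ hj.1, if_neg]
          · simp
          · rw [j.2, S.block_of_mem R R.2]
            simp
      · rw [if_neg, if_neg fun h => hj h.2.2, map_zero]
        exact fun h => hj ⟨fun h' => h.2.1 (Subtype.ext h'), h.2.2⟩
    · rw [if_neg hR]
      exact (Finset.sum_eq_zero fun j _ => if_neg fun h => hR ⟨h.1, h.2.1⟩).symm
  -- The brace y{z}_i sees a block with `i + 1` vertices, and the outer brace with weights `1, k`
  -- sees `k + 2` blocks. Apart from these two size conditions the summand does not depend on `(i,
  -- k)`.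
  · have hterm : ∀ (k : ℕ × ℕ) (j : S.childCut.Blocks),
        (if j ≠ S.rootBlock S.childCut ∧ (∀ v, S.parent v = S.root ∨ S.parent v = j.1) ∧
          Fintype.card S.childCut.Blocks = k.2 + 2 then
        ((pairSign S.root j.1 a b : ℤ) : K) • V.ins (S.block S.childCut) j
          (V.rootVec S.root x z) (V.ev (S.restrict S.childCut j)
            (V.braceGamma y ![z] ![k.1] (V.admissible_single hz k.1)))
        else 0) = if (j ≠ S.rootBlock S.childCut ∧ (∀ v, S.parent v = S.root ∨ S.parent v = j.1)) ∧
          Fintype.card S.childCut.Blocks = k.2 + 2 ∧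
          Fintype.card {v // S.block S.childCut v = j} = k.1 + 1 then F j.1 else 0 := by
      intro k j
      by_cases hj : j ≠ S.rootBlock S.childCut ∧ ∀ v, S.parent v = S.root ∨ S.parent v = j.1
      · have hc := ((RTree.childCut_single_iff j).2 hj.2).1
        have hj0 : j.1 ≠ S.root := fun h => hj.1 (Subtype.ext h)
        by_cases hk : Fintype.card S.childCut.Blocks = k.2 + 2
        · by_cases hk' : Fintype.card {v // S.block S.childCut v = j} = k.1 + 1
          · rw [if_pos ⟨hj.1, hj.2, hk⟩, if_pos ⟨hj, hk, hk'⟩, V.ev_braceGamma_single hy hz,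
              if_pos ⟨hc, hk'⟩, rootVec_coe]
            refine congrArg (_ • ·) ?_
            have h0 : (fun i : {v // S.block S.childCut v = j} =>
                V.rootVec (S.restrict S.childCut j).root.1 y z i.1) =
                fun i => V.pairVec S.root j.1 x y z i.1 := by
              funext i
              have : i.1 ≠ S.root := by
                intro h
                have h2 := i.2
                rw [h, S.block_of_mem _ S.childCut.2] at h2
                exact hj.1 h2.symm
              simp only [rootVec, pairVec, this, if_false]
              rfl
            rw [h0]
            refine (V.ins_pure _ _ (V.pairVec_mem S.root j.1 hx hy hz) fun i hi => ?_).trans ?_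
            · rw [pairVec, rootVec, if_neg (c := i = j.1)]
              rintro rfl
              exact hi (S.block_of_mem _ j.2)
            -- The root and `j` represent their own blocks, and blocks are ordered by their roots:
            -- there is no inversion.
            · rw [sign_pairVec _ hj0, if_neg]
              · simp
              · rw [S.block_of_mem _ j.2, S.block_of_mem _ S.childCut.2]
                rintro (⟨h1, h2⟩ | ⟨h1, h2⟩)
                exacts [lt_asymm h1 h2, lt_asymm h1 h2]
          · rw [if_pos ⟨hj.1, hj.2, hk⟩, if_neg fun h => hk' h.2.2, V.ev_braceGamma_single hy hz,
              if_neg fun h => hk' h.2, map_zero, smul_zero]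
        · rw [if_neg fun h => hk h.2.2, if_neg fun h => hk h.2.1]
      · rw [if_neg fun h => hj ⟨h.1, h.2.1⟩, if_neg fun h => hj h.1]
    simp only [hterm]
    rw [Finset.sum_comm]
    have hsum := RTree.sum_childCut_blocks (S := S) F fun j => j ≠ S.root ∧
      (∀ v, S.parent v = S.root ∨ S.parent v = j) ∧ Fintype.card (I) = n + 2
    refine Eq.trans (Eq.trans ?_ hsum.symm) ?_
    · exact Finset.sum_congr rfl fun j _ => by congr 1; exact propext (by tauto)
    · refine Finset.sum_congr rfl fun j _ => ?_
      by_cases hj : j ≠ S.rootBlock S.childCut ∧ ∀ v, S.parent v = S.root ∨ S.parent v = j.1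
      · have hcard := RTree.card_childCut_single j hj.2
        have hB : 1 < Fintype.card S.childCut.Blocks :=
          Fintype.one_lt_card_iff.2 ⟨_, _, hj.1⟩
        have hfib : 0 < Fintype.card {v // S.block S.childCut v = j} :=
          Fintype.card_pos_iff.2 ⟨⟨j.1, S.block_of_mem _ j.2⟩⟩
        have hj0 : j.1 ≠ S.root := fun h => hj.1 (Subtype.ext h)
        by_cases hN : Fintype.card (I) = n + 2
        -- The sizes of the block of `j` and of the set of blocks determine the pair `(i, k)`. The
        -- total number of vertices guarantees `i + k = n`.
        · rw [if_pos ⟨hj0, hj.2, hN⟩, Finset.sum_eq_single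
            (Fintype.card {v // S.block S.childCut v = j} - 1,
              Fintype.card S.childCut.Blocks - 2), if_pos ⟨hj, by omega, by omega⟩]
          · rintro ⟨i, k⟩ _ hik
            refine if_neg fun h => hik (Prod.ext ?_ ?_)
            · have := h.2.2
              change i = _ - 1
              change _ = i + 1 at this
              omega
            · have := h.2.1
              change k = _ - 2
              change _ = k + 2 at this
              omega
          · intro h
            rw [Finset.HasAntidiagonal.mem_antidiagonal] at h
            omega
        · rw [if_neg fun h => hN h.2.2]
          refine (Finset.sum_eq_zero fun k hk => if_neg fun h => hN ?_).symm
          rw [Finset.HasAntidiagonal.mem_antidiagonal] at hk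
          omega
      · rw [if_neg fun h => hj ⟨fun h' => h.1 (congrArg Subtype.val h'), h.2.1⟩]
        exact (Finset.sum_eq_zero fun k _ => if_neg fun h => hj h.1).symm

end DGModule

/-! ### The identities for (x{z}_n){y} and for x{y}{y} in the free algebra -/

namespace DGModule

variable {K : Type u} [CommRing K] {V : DGModule.{u, v} K}

-- The vertex `j` carrying `y` may be attached to the root or to any vertex carrying `z`, while all
-- others are attached to the root. The two possibilities give the two terms of
-- `mu_single_one_succ`.
open Classical in
theorem muAt_single_one {x y z : V} {a b : ℤ} (hx : x ∈ V.gr a) (hy : y ∈ V.gr b)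
    (hz : z ∈ V.gr 0) (n : ℕ) {I : Type} [Fintype I] [LinearOrder I] (S : RTree I) :
    V.muAt S (V.Gamma.braceGamma (V.braceGamma x ![z] ![n] (V.admissible_single hz n)) ![V.eta y]
      ![1] V.Gamma.admissible_one) =
    ∑ j, if j ≠ S.root ∧ (∀ v, v ≠ j → S.parent v = S.root) ∧ Fintype.card I = n + 2 then
      ((pairSign S.root j a b : ℤ) : K) • V.pure (V.pairVec S.root j x y z) else 0 := by
  set F : I → V.Tens I := fun j => if Fintype.card I = n + 2 then
    ((pairSign S.root j a b : ℤ) : K) • V.pure (V.pairVec S.root j x y z) else 0 with hF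
  rw [muAt_one (V.corollaSupported_braceGamma _ _ _ _)
    (V.braceGamma_mem hx (fun i => by fin_cases i; exact hz) ![n] _) hy]
  refine Eq.trans (Eq.trans ?_ (RTree.sum_isLeafCut_two (S := S) F)) ?_
  · refine Finset.sum_congr rfl fun R _ => Finset.sum_congr rfl fun j _ => ?_
    refine if_ctx_congr Iff.rfl (fun h => ?_) fun _ => rfl
    have hc := ((RTree.isLeafCut_iff R).1 h.1).2.1
    have hcard := h.1.card
    have hj0 : j.1 ≠ S.root := fun h' => h.2.1 (Subtype.ext h')
    rw [V.ev_braceGamma_single hx hz]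
    by_cases hn : Fintype.card I = n + 2
    · simp only [hF, if_pos hn]
      rw [if_pos ⟨hc, by omega⟩, rootVec_coe]
      refine congrArg (_ • ·) ?_
      have h0 : (fun i : {v // S.block R v = S.rootBlock R} =>
          V.rootVec (S.restrict R (S.rootBlock R)).root.1 x z i.1) =
          fun i => V.pairVec S.root j.1 x y z i.1 := by
        funext i
        have : i.1 ≠ j.1 := fun h' => by
          have h2 := i.2
          rw [h', S.block_of_mem R j.2] at h2
          exact h.2.1 h2
        simp only [rootVec, pairVec, this, if_false]
        rfl
      rw [h0]
      refine (V.ins_pure _ _ (V.pairVec_mem S.root j.1 hx hy hz) fun i hi => ?_).trans ?_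
      · rw [pairVec, if_neg, if_pos]
        · by_contra hij
          have hiR : i ∉ R.1 := by
            intro hiR
            have h1 : ({S.rootBlock R, j, ⟨i, hiR⟩} : Finset R.Blocks).card ≤ 2 :=
              h.2.2 ▸ Finset.card_le_univ _
            rw [Finset.card_eq_three.2 ⟨_, _, _, h.2.1.symm, fun h' => hi ?_,
              fun h' => hij (congrArg Subtype.val h').symm, rfl⟩] at h1
            · omega
            · rw [S.block_of_mem R hiR, h']
          exact hi (h.1.block_eq hiR)
        · rintro rfl
          exact hi (S.block_of_mem R R.2)
      · rw [sign_pairVec _ hj0, if_neg]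
        · simp
        · rw [S.block_of_mem _ j.2, S.block_of_mem _ R.2]
          rintro (⟨h1, h2⟩ | ⟨h1, h2⟩)
          exacts [lt_asymm h1 h2, lt_asymm h1 h2]
    · simp only [hF, if_neg hn]
      rw [if_neg (by omega), map_zero, smul_zero]
  · refine Finset.sum_congr rfl fun j _ => ?_
    simp only [hF, ← ite_and, and_assoc]

-- When z{y} is grafted on `x`, the parent of the vertex `k` carrying `y` has label `z`, like all
-- the remaining vertices. The tensor is therefore the same as for (x{z}_{n+1}){y}, and only the
-- shape of the tree differs.
open Classical in
theorem muAt_pair_one {x y z : V} {a b : ℤ} (hx : x ∈ V.gr a) (hy : y ∈ V.gr b)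
    (hz : z ∈ V.gr 0) (n : ℕ) {I : Type} [Fintype I] [LinearOrder I] (S : RTree I) :
    V.muAt S (V.Gamma.braceGamma (V.eta x)
      ![V.braceGamma z ![y] ![1] V.admissible_one, V.eta z] ![1, n]
      (V.Gamma.admissible_pair _ (V.eta_mem hz) n)) =
    ∑ k, if k ≠ S.root ∧ (∀ v, v ≠ k → S.parent v = S.root) ∧ S.parent k ≠ S.root ∧
        Fintype.card I = n + 3 then
      ((pairSign S.root k a b : ℤ) : K) • V.pure (V.pairVec S.root k x y z) else 0 := by
  set F : I → I → V.Tens I := fun _ k =>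
    ((pairSign S.root k a b : ℤ) : K) • V.pure (V.pairVec S.root k x y z) with hF
  rw [muAt_pair (V.corollaSupported_braceGamma _ _ _ _)
    (zero_add b ▸ V.braceGamma_one_mem hz hy V.admissible_one) hx hz]
  refine Eq.trans ?_ (RTree.sum_childCut_two (S := S) F n)
  refine Finset.sum_congr rfl fun j _ => ?_
  by_cases hj : j ≠ S.rootBlock S.childCut ∧ (∀ v, S.parent v = S.root ∨ S.parent v = j.1) ∧
      Fintype.card S.childCut.Blocks = n + 2
  swap
  · rw [if_neg hj]
    exact (Finset.sum_eq_zero fun k _ => if_neg fun h => hj h.1).symm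
  rw [if_pos hj, V.ev_braceGamma_one hz hy _ z, map_sum, Finset.smul_sum]
  refine Finset.sum_congr rfl fun k _ => ?_
  have hc := ((RTree.childCut_single_iff j).2 hj.2.1).1
  have hj0 : j.1 ≠ S.root := fun h => hj.1 (Subtype.ext h)
  by_cases hk : k.1 ≠ j.1 ∧ Fintype.card {v // S.block S.childCut v = j} = 2
  swap
  · rw [if_neg, if_neg fun h => hk h.2, map_zero, smul_zero]
    exact fun h => hk ⟨fun h' => h.2.1 (Subtype.ext h'), h.2.2⟩
  have hk0 : k.1 ≠ S.root := fun h => by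
    have h2 := k.2
    rw [h, S.block_of_mem _ S.childCut.2] at h2
    exact hj.1 h2.symm
  rw [if_pos ⟨hc, fun h => hk.1 (congrArg Subtype.val h), hk.2⟩, if_pos ⟨hj, hk⟩, map_smul,
    smul_smul, pairVec_coe]
  have h0 : (fun i : {v // S.block S.childCut v = j} =>
      V.pairVec (S.restrict S.childCut j).root.1 k.1 z y z i.1) =
      fun i => V.pairVec S.root k.1 x y z i.1 := by
    funext i
    have hi : i.1 ≠ S.root := fun h => by
      have h2 := i.2
      rw [h, S.block_of_mem _ S.childCut.2] at h2
      exact hj.1 h2.symm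
    by_cases hik : i.1 = k.1
    · have h3 : k.1 ≠ (S.restrict S.childCut j).root.1 := hk.1
      simp only [pairVec, hik, hk0, h3, if_false]
    · simp only [pairVec, hi, hik, if_false, ite_self]
  rw [h0]
  refine (congrArg (_ • ·) (V.ins_pure _ _ (V.pairVec_mem S.root k.1 hx hy hz)
    fun i hi => ?_)).trans ?_
  · have hik : i ≠ k.1 := by
      rintro rfl
      exact hi k.2
    simp only [pairVec, rootVec, hik, if_false]
  -- The outer brace contributes the sign for moving the block of `j` past the root, and `join`
  -- contributes the same exchange sign when `j` and `k` are on opposite sides of the root. The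
  -- product depends only on the position of `k`. The exchange of `z` and `y` is free since `z` has
  -- degree zero.
  · rw [smul_smul, sign_pairVec _ hk0, k.2, S.block_of_mem _ S.childCut.2]
    refine congrArg (· • _) ?_
    have h1 : (j < ⟨S.root, S.childCut.2⟩) ↔ j.1 < S.root := Iff.rfl
    have h2 : ((⟨S.root, S.childCut.2⟩ : S.childCut.Blocks) < j) ↔ S.root < j.1 := Iff.rfl
    have h4 : Koszul.swapSign 0 b = 1 := by simp [Koszul.swapSign]
    have h5 : ∀ s : ℤˣ, ((s : ℤ) : K) * ((s : ℤ) : K) = 1 := fun s => by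
      rcases Int.units_eq_one_or s with rfl | rfl <;> simp
    simp only [h1, h2, pairSign, h4, ite_self]
    rcases lt_or_gt_of_ne hj0 with hlt | hlt <;> rcases lt_or_gt_of_ne hk0 with hlt' | hlt' <;>
      simp [hlt, hlt.not_gt, hlt', hlt'.not_gt, h5]

/-- The brace identity `(x{z}_n){y} = x{y, z}_{1, n} + x{z{y}, z}_{1, n - 1}`, for `n > 0`. -/
theorem mu_single_one_succ {x y z : V} {a b : ℤ} (hx : x ∈ V.gr a) (hy : y ∈ V.gr b)
    (hz : z ∈ V.gr 0) (n : ℕ) :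
    V.mu (V.Gamma.braceGamma (V.braceGamma x ![z] ![n + 1] (V.admissible_single hz (n + 1)))
      ![V.eta y] ![1] V.Gamma.admissible_one) =
    V.braceGamma x ![y, z] ![1, n + 1] (V.admissible_pair y hz (n + 1)) +
      V.mu (V.Gamma.braceGamma (V.eta x)
      ![V.braceGamma z ![y] ![1] V.admissible_one, V.eta z] ![1, n]
      (V.Gamma.admissible_pair _ (V.eta_mem hz) n)) := by
  classical
  refine V.gamma_ext fun N S => ?_
  rw [map_add, ev_mu, ev_mu, muAt_single_one hx hy hz, V.ev_braceGamma_pair hx hy hz,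
    muAt_pair_one hx hy hz, ← Finset.sum_add_distrib]
  refine Finset.sum_congr rfl fun j _ => ?_
  -- Given that all vertices other than `j` are attached to the root, the parent of `j` is the root
  -- exactly when the tree is a corolla. This separates the two terms on the right.
  have key : S.IsCorolla ↔ (∀ v, v ≠ j → S.parent v = S.root) ∧ S.parent j = S.root := by
    constructor
    · exact fun h => ⟨fun v _ => h v, h j⟩
    · rintro ⟨h1, h2⟩ v
      by_cases hv : v = j
      · rw [hv, h2]
      · exact h1 v hv
  simp only [key]
  by_cases h1 : j ≠ S.root <;> by_cases h2 : ∀ v, v ≠ j → S.parent v = S.root <;>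
    by_cases h3 : S.parent j = S.root <;> by_cases h4 : Fintype.card (Fin N) = n + 3 <;>
    simp_all

-- Two vertices carry the odd element `y`: `k` in the root block, and `j` attached afterwards. The
-- sign records the order of `k` and `j`, which is what produces cancellation on corollas.
open Classical in
theorem muAt_one_one {x y : V} (hx : x ∈ V.gr 0) (hy : y ∈ V.gr 1)
    {I : Type} [Fintype I] [LinearOrder I] (S : RTree I) :
    V.muAt S (V.Gamma.braceGamma (V.braceGamma x ![y] ![1] V.admissible_one) ![V.eta y]
      ![1] V.Gamma.admissible_one) =
    ∑ j, if j ≠ S.root ∧ (∀ v, v ≠ j → S.parent v = S.root) ∧ Fintype.card I = 3 then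
      ∑ k, if k ≠ S.root ∧ k ≠ j then
        ((pairSign k j 1 1 : ℤ) : K) • V.pure (V.rootVec S.root x y) else 0 else 0 := by
  set F : I → V.Tens I := fun j => if Fintype.card I = 3 then
    ∑ k, if k ≠ S.root ∧ k ≠ j then
        ((pairSign k j 1 1 : ℤ) : K) • V.pure (V.rootVec S.root x y) else 0 else 0 with hF
  rw [muAt_one (V.corollaSupported_braceGamma _ _ _ _)
    (V.braceGamma_one_mem hx hy V.admissible_one) hy]
  refine Eq.trans (Eq.trans ?_ (RTree.sum_isLeafCut_two (S := S) F)) ?_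
  swap
  · refine Finset.sum_congr rfl fun j _ => ?_
    simp only [hF, ← ite_and, and_assoc]
  refine Finset.sum_congr rfl fun R _ => Finset.sum_congr rfl fun j _ => ?_
  refine if_ctx_congr Iff.rfl (fun h => ?_) fun _ => rfl
  have hc := ((RTree.isLeafCut_iff R).1 h.1).2.1
  have hcard := h.1.card
  have hj0 : j.1 ≠ S.root := fun h' => h.2.1 (Subtype.ext h')
  rw [V.ev_braceGamma_one hx hy _ y]
  by_cases hn : Fintype.card I = 3
  swap
  · simp only [hF, if_neg hn]
    rw [map_sum, Finset.smul_sum]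
    refine Finset.sum_eq_zero fun k _ => ?_
    rw [if_neg (by omega), map_zero, smul_zero]
  simp only [hF, if_pos hn]
  rw [map_sum, Finset.smul_sum]
  have hR : ∀ k : I, k ≠ S.root → (S.block R k = S.rootBlock R ↔ k ≠ j.1) := by
    intro k hk
    constructor
    · rintro h1 rfl
      rw [S.block_of_mem R j.2] at h1
      exact h.2.1 h1
    · intro hkj
      refine h.1.block_eq fun hkR => ?_
      have h1 : ({S.rootBlock R, j, ⟨k, hkR⟩} : Finset R.Blocks).card ≤ 2 :=
        h.2.2 ▸ Finset.card_le_univ _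
      rw [Finset.card_eq_three.2 ⟨_, _, _, h.2.1.symm, fun h' => hk (congrArg Subtype.val h').symm,
        fun h' => hkj (congrArg Subtype.val h').symm, rfl⟩] at h1
      omega
  rw [← Finset.sum_filter]
  symm
  rw [← Finset.sum_filter_of_ne (p := fun k => (S.restrict R (S.rootBlock R)).IsCorolla ∧
    k ≠ (S.restrict R (S.rootBlock R)).root ∧
    Fintype.card {v // S.block R v = S.rootBlock R} = 2)]
  swap
  · intro k _ hk
    by_contra h1
    rw [if_neg h1, map_zero, smul_zero] at hk
    exact hk rfl
  symm
  refine Finset.sum_bij (fun k _ => k.1) ?_ ?_ ?_ ?_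
  · intro k hk
    simp only [Finset.mem_filter, Finset.mem_univ, true_and] at hk ⊢
    have hk0 : k.1 ≠ S.root := fun h' => hk.2.1 (Subtype.ext h')
    exact ⟨hk0, (hR _ hk0).1 k.2⟩
  · intro k _ k' _ hkk
    exact Subtype.ext hkk
  · intro k hk
    simp only [Finset.mem_filter, Finset.mem_univ, true_and] at hk
    refine ⟨⟨k, (hR k hk.1).2 hk.2⟩, ?_, rfl⟩
    simp only [Finset.mem_filter, Finset.mem_univ, true_and]
    exact ⟨hc, fun h' => hk.1 (congrArg Subtype.val h'), by omega⟩
  · intro k hk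
    simp only [Finset.mem_filter, Finset.mem_univ, true_and] at hk
    have hk0 : k.1 ≠ S.root := fun h' => hk.2.1 (Subtype.ext h')
    have hkj : k.1 ≠ j.1 := (hR _ hk0).1 k.2
    rw [if_pos hk, map_smul, smul_smul, pairVec_coe]
    have h0 : (fun i : {v // S.block R v = S.rootBlock R} =>
        V.pairVec (S.restrict R (S.rootBlock R)).root.1 k.1 x y y i.1) =
        fun i => V.rootVec S.root x y i.1 := by
      funext i
      simp only [pairVec, rootVec, ite_self]
      rfl
    rw [h0]
    refine (congrArg (_ • ·) (V.ins_pure _ _ (q := fun i => if i = k.1 then 1 else if i = j.1 then 1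
      else 0) (fun i => ?_) fun i hi => ?_)).trans ?_
    · by_cases hir : i = S.root
      · simp [rootVec, hir, hk0.symm, hj0.symm, hx]
      · have : i = k.1 ∨ i = j.1 := by
          by_contra! hcon
          have h1 : ({S.root, k.1, j.1, i} : Finset I).card ≤ 3 := hn ▸ Finset.card_le_univ _
          rw [Finset.card_insert_of_notMem (by simp [hk0.symm, hj0.symm, Ne.symm hir]),
            Finset.card_eq_three.2 ⟨_, _, _, hkj, hcon.1.symm, hcon.2.symm, rfl⟩] at h1
          omega
        rcases this with rfl | rfl <;> simp [rootVec, hir, hy]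
    · rw [rootVec, if_neg]
      rintro rfl
      exact hi (S.block_of_mem R R.2)
    -- The element x{y} has degree one, so moving the second `y` past the root block gives -1 when
    -- `j` precedes the root. The sign of `join` compares `j` with `k` and the root, and together
    -- they give -1 exactly when `j` precedes `k`.
    · rw [smul_smul, sign_pairVec _ hkj.symm, k.2, S.block_of_mem _ j.2]
      refine congrArg (· • _) ?_
      have h1 : (j < S.rootBlock R) ↔ j.1 < S.root := Iff.rfl
      have h2 : (S.rootBlock R < j) ↔ S.root < j.1 := Iff.rfl
      have h4 : Koszul.swapSign 0 1 = 1 := by simp [Koszul.swapSign]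
      have h5 : Koszul.swapSign 1 1 = -1 := by simp [Koszul.swapSign]
      have h6 : Koszul.swapSign (0 + 1) 1 = -1 := by simp [Koszul.swapSign]
      simp only [h1, h2, pairSign, h4, h5, h6, ite_self]
      rcases lt_or_gt_of_ne hj0 with hlt | hlt <;> rcases lt_or_gt_of_ne hkj with hlt' | hlt' <;>
        simp [hlt, hlt.not_gt, hlt', hlt'.not_gt]

-- Only linear trees with three vertices occur. As `x` has degree zero, the sign is that of the
-- inner brace y{y}. The argument `z` has weight zero.
open Classical in
theorem muAt_pair_one_one {x y z : V} (hx : x ∈ V.gr 0) (hy : y ∈ V.gr 1) (hz : z ∈ V.gr 0)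
    {I : Type} [Fintype I] [LinearOrder I] (S : RTree I) :
    V.muAt S (V.Gamma.braceGamma (V.eta x)
      ![V.braceGamma y ![y] ![1] V.admissible_one, V.eta z] ![1, 0]
      (V.Gamma.admissible_pair _ (V.eta_mem hz) 0)) =
    ∑ k, if k ≠ S.root ∧ (∀ v, v ≠ k → S.parent v = S.root) ∧ S.parent k ≠ S.root ∧
        Fintype.card I = 3 then
      ((pairSign (S.parent k) k 1 1 : ℤ) : K) • V.pure (V.rootVec S.root x y) else 0 := by
  set F : I → I → V.Tens I := fun j k =>
    ((pairSign j k 1 1 : ℤ) : K) • V.pure (V.rootVec S.root x y) with hF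
  rw [muAt_pair (V.corollaSupported_braceGamma _ _ _ _)
    (V.braceGamma_one_mem hy hy V.admissible_one) hx hz]
  refine Eq.trans ?_ (RTree.sum_childCut_two (S := S) F 0)
  refine Finset.sum_congr rfl fun j _ => ?_
  by_cases hj : j ≠ S.rootBlock S.childCut ∧ (∀ v, S.parent v = S.root ∨ S.parent v = j.1) ∧
      Fintype.card S.childCut.Blocks = 0 + 2
  swap
  · rw [if_neg hj]
    exact (Finset.sum_eq_zero fun k _ => if_neg fun h => hj h.1).symm
  rw [if_pos hj, V.ev_braceGamma_one hy hy _ y, map_sum, Finset.smul_sum]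
  refine Finset.sum_congr rfl fun k _ => ?_
  have hc := ((RTree.childCut_single_iff j).2 hj.2.1).1
  have hj0 : j.1 ≠ S.root := fun h => hj.1 (Subtype.ext h)
  by_cases hk : k.1 ≠ j.1 ∧ Fintype.card {v // S.block S.childCut v = j} = 2
  swap
  · rw [if_neg, if_neg fun h => hk h.2, map_zero, smul_zero]
    exact fun h => hk ⟨fun h' => h.2.1 (Subtype.ext h'), h.2.2⟩
  have hroot : ∀ i : {v // S.block S.childCut v = j}, i.1 ≠ S.root := fun i h => by
    have h2 := i.2
    rw [h, S.block_of_mem _ S.childCut.2] at h2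
    exact hj.1 h2.symm
  have hcard := RTree.card_childCut_single j hj.2.1
  rw [if_pos ⟨hc, fun h => hk.1 (congrArg Subtype.val h), hk.2⟩, if_pos ⟨hj, hk⟩, map_smul,
    smul_smul, pairVec_coe]
  have h0 : (fun i : {v // S.block S.childCut v = j} =>
      V.pairVec (S.restrict S.childCut j).root.1 k.1 y y y i.1) =
      fun i => V.rootVec S.root x y i.1 := by
    funext i
    simp only [pairVec, rootVec, hroot i, if_false, ite_self]
  have hall : ∀ i, i = S.root ∨ i = j.1 ∨ i = k.1 := by
    intro i
    by_contra! hcon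
    have h1 : ({S.root, j.1, k.1, i} : Finset I).card ≤ 3 := by
      have := Finset.card_le_univ ({S.root, j.1, k.1, i} : Finset I)
      omega
    rw [Finset.card_insert_of_notMem (by simp [(hroot k).symm, hj0.symm, hcon.1.symm]),
      Finset.card_eq_three.2 ⟨_, _, _, hk.1.symm, hcon.2.1.symm, hcon.2.2.symm, rfl⟩] at h1
    omega
  rw [h0]
  refine (congrArg (_ • ·) (V.ins_pure _ _ (q := fun i => if i = j.1 then 1 else if i = k.1 then 1
    else 0) (fun i => ?_) fun i hi => ?_)).trans ?_
  · rcases hall i with rfl | rfl | rfl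
    · simp [rootVec, (hroot k).symm, hj0.symm, hx]
    · simp [rootVec, hj0, hy]
    · simp [rootVec, hroot k, hy]
  · rcases hall i with rfl | rfl | rfl
    · simp [rootVec]
    · exact absurd (S.block_of_mem _ j.2) hi
    · exact absurd k.2 hi
  · rw [smul_smul, sign_pairVec _ hk.1, k.2, S.block_of_mem _ j.2]
    refine congrArg (· • _) ?_
    have h4 : ∀ c, Koszul.swapSign 0 c = 1 := fun c => by simp [Koszul.swapSign]
    simp only [pairSign, h4, ite_self, lt_irrefl, and_false, or_false, if_false]
    simp
    rfl

/-- The identity `x{y}{y} = x{y{y}}` for elements of degrees `0` and `1`. -/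
theorem mu_one_one {x y z : V} (hx : x ∈ V.gr 0) (hy : y ∈ V.gr 1) (hz : z ∈ V.gr 0) :
    V.mu (V.Gamma.braceGamma (V.braceGamma x ![y] ![1] V.admissible_one) ![V.eta y]
      ![1] V.Gamma.admissible_one) =
    V.mu (V.Gamma.braceGamma (V.eta x)
      ![V.braceGamma y ![y] ![1] V.admissible_one, V.eta z] ![1, 0]
      (V.Gamma.admissible_pair _ (V.eta_mem hz) 0)) := by
  classical
  refine V.gamma_ext fun N S => ?_
  rw [ev_mu, ev_mu, muAt_one_one hx hy, muAt_pair_one_one hx hy hz]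
  set t := V.pure (V.rootVec S.root x y) with ht
  by_cases hN : Fintype.card (Fin N) = 3
  swap
  · exact (Finset.sum_eq_zero fun j _ => if_neg fun h => hN h.2.2).trans
      (Finset.sum_eq_zero fun j _ => if_neg fun h => hN h.2.2.2).symm
  -- On a corolla the right side is zero and the left side cancels in pairs under the exchange of
  -- `j` and `k`, by the sign of two elements of degree one. Pairing terms, rather than dividing by
  -- two, keeps this valid over any `K`.
  by_cases hS : S.IsCorolla
  · refine Eq.trans ?_ (Finset.sum_eq_zero fun k _ => if_neg fun h => h.2.2.1 (hS k)).symm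
    trans ∑ j, ∑ k, if j ≠ S.root ∧ k ≠ S.root ∧ k ≠ j then
      ((pairSign k j 1 1 : ℤ) : K) • t else 0
    · refine Finset.sum_congr rfl fun j _ => ?_
      by_cases hj : j = S.root
      · rw [if_neg fun h => h.1 hj]
        exact (Finset.sum_eq_zero fun k _ => if_neg fun h => h.1 hj).symm
      · rw [if_pos ⟨hj, fun v _ => hS v, hN⟩]
        refine Finset.sum_congr rfl fun k _ => ?_
        simp [hj]
    rw [← Finset.sum_product']
    have h5 : Koszul.swapSign 1 1 = -1 := by simp [Koszul.swapSign]
    refine Finset.sum_involution (fun p _ => (p.2, p.1)) ?_ ?_ (by simp) (by simp)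
    · rintro ⟨j, k⟩ -
      by_cases h1 : j ≠ S.root ∧ k ≠ S.root ∧ k ≠ j
      · rw [if_pos h1, if_pos ⟨h1.2.1, h1.1, h1.2.2.symm⟩, ← add_smul]
        rcases lt_or_gt_of_ne h1.2.2 with h | h <;> simp [pairSign, h, h.not_gt, h5]
      · rw [if_neg h1, if_neg fun h => h1 ⟨h.2.1, h.1, h.2.2.symm⟩, add_zero]
    · rintro ⟨j, k⟩ - h heq
      simp only [Prod.mk.injEq] at heq
      exact h (if_neg fun h' => h'.2.2 heq.1)
  · refine Finset.sum_congr rfl fun j _ => ?_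
    by_cases h1 : j ≠ S.root ∧ (∀ v, v ≠ j → S.parent v = S.root)
    · have h2 : S.parent j ≠ S.root := fun h => hS fun v => by
        by_cases hv : v = j
        · rw [hv, h]
        · exact h1.2 v hv
      have h3 : S.parent j ≠ j := fun h => h1.1 (RTree.eq_root_of_parent_eq h)
      -- With three vertices, the parent of `j` is the only vertex besides the root and `j`, so the
      -- inner sum has a single term.
      rw [if_pos ⟨h1.1, h1.2, hN⟩, if_pos ⟨h1.1, h1.2, h2, hN⟩, Finset.sum_eq_single (S.parent j),
        if_pos ⟨h2, h3⟩]
      · intro k _ hk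
        refine if_neg fun h => ?_
        have h4 : ({S.root, j, S.parent j, k} : Finset (Fin N)).card ≤ 3 :=
          hN ▸ Finset.card_le_univ _
        rw [Finset.card_insert_of_notMem (by simp [h1.1.symm, h2.symm, h.1.symm]),
          Finset.card_eq_three.2 ⟨_, _, _, h3.symm, h.2.symm, hk.symm, rfl⟩] at h4
        omega
      · simp
    · rw [if_neg fun h => h1 ⟨h.1, h.2.1⟩, if_neg fun h => h1 ⟨h.1, h.2.1⟩]

end DGModule

/-! ### Two successive circular products and trees of depth two -/

theorem sum_fiber_mul {B : Type} [Fintype B] {C : Type} [Fintype C] [DecidableEq C] (w : B → C)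
    (f : C → ℕ) : ∑ c, f c * Fintype.card {b // w b = c} = ∑ b, f (w b) := by
  rw [← Finset.sum_fiberwise Finset.univ w fun b => f (w b)]
  refine Finset.sum_congr rfl fun c _ => ?_
  rw [Finset.sum_congr rfl fun b hb => by rw [(Finset.mem_filter.1 hb).2], Finset.sum_const,
    Fintype.card_subtype, smul_eq_mul, mul_comm]

namespace DGModule

variable {K : Type u} [CommRing K] {V : DGModule.{u, v} K}

theorem braceGamma_congr {p : ℕ} (x : V) {y y' : Fin p → V} {r : Fin p → ℕ}
    (h : V.Admissible y r) (h' : V.Admissible y' r) (hy : ∀ i, r i ≠ 0 → y i = y' i) :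
    V.braceGamma x y r h = V.braceGamma x y' r h' := by
  classical
  refine V.gamma_ext fun n T => ?_
  rw [ev_braceGamma, ev_braceGamma]
  refine Finset.sum_congr rfl fun w _ => if_ctx_congr Iff.rfl (fun hw => ?_) fun _ => rfl
  congr 2
  funext i
  cases hc : w i using Fin.cases with
  | zero => rfl
  | succ c =>
    refine hy c ?_
    have h1 := hw.2.2 c.succ
    rw [Fin.cons_succ] at h1
    rw [← h1]
    exact (Fintype.card_pos_iff.2 ⟨⟨i, hc⟩⟩).ne'

/-- The expansion `x{y_1 + ⋯ + y_p}_n = ∑ x{y_1, …, y_p}_r`, where `r` runs over the weights of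
sum `n`. -/
theorem braceGamma_sum {p : ℕ} {x : V} {a : ℤ} (hx : x ∈ V.gr a) {y : Fin p → V}
    (hy : ∀ i, y i ∈ V.gr 0) (n : ℕ) :
    V.braceGamma x ![∑ i, y i] ![n] (V.admissible_single (sum_mem fun i _ => hy i) n) =
      ∑ r ∈ Finset.piAntidiag Finset.univ n, V.braceGamma x y r (V.admissible_of_mem hy r) := by
  classical
  refine V.gamma_ext fun N T => ?_
  rw [map_sum, V.ev_braceGamma_single hx (sum_mem fun i _ => hy i)]
  simp only [V.ev_braceGamma_of_mem hx hy]
  by_cases hT : T.IsCorolla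
  swap
  · rw [if_neg fun h => hT h.1]
    exact (Finset.sum_eq_zero fun r _ => Finset.sum_eq_zero fun w _ => if_neg fun h => hT h.1).symm
  rw [Finset.sum_comm]
  have hcard : ∀ w : Fin N → Fin (p + 1), ∀ r : Fin p → ℕ,
      (∀ c, Fintype.card {i // w i = c} = (Fin.cons 1 r : Fin (p + 1) → ℕ) c) →
      Fintype.card (Fin N) = 1 + ∑ i, r i := fun w r h => by
    rw [← sum_card_fiber w, Fin.sum_univ_succ, h]
    simp only [h, Fin.cons_succ, Fin.cons_zero]
  by_cases hn : Fintype.card (Fin N) = n + 1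
  swap
  · rw [if_neg fun h => hn h.2]
    refine (Finset.sum_eq_zero fun w _ => Finset.sum_eq_zero fun r hr => if_neg fun h => hn ?_).symm
    rw [hcard w r h.2.2, (Finset.mem_piAntidiag.1 hr).1, add_comm]
  rw [if_pos ⟨hT, hn⟩]
  -- Multilinear expansion of the decoration with ∑ y_i at the non-root vertices. The index `0` is
  -- reserved for `x`, so the choice functions are words, and those with `0` in a wrong place have a
  -- zero factor.
  set g : Fin N → Fin (p + 1) → V := fun i j =>
    if i = T.root then (Fin.cons x fun _ => 0 : Fin (p + 1) → V) j
    else (Fin.cons 0 y : Fin (p + 1) → V) j with hg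
  have h1 : V.rootVec T.root x (∑ i, y i) = fun i => ∑ j, g i j := by
    funext i
    rw [Fin.sum_univ_succ]
    by_cases hi : i = T.root <;> simp [hg, rootVec, hi]
  rw [h1]
  refine (MultilinearMap.map_sum (PiTensorProduct.tprod K (s := fun _ : Fin N => V.carrier))
    (α := fun _ => Fin (p + 1)) g).trans ?_
  refine Finset.sum_congr rfl fun w _ => ?_
  by_cases hw : ∀ i, w i = 0 ↔ i = T.root
  -- A word belongs to exactly one weight, given by the numbers of occurrences of its letters.
  · rw [Finset.sum_eq_single fun c => Fintype.card {i // w i = c.succ}]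
    · have h2 : Fintype.card {i // w i = 0} = 1 := (card_fiber_eq_one_iff w 0).2 ⟨_, hw⟩
      rw [if_pos]
      · congr 1
        funext i
        cases hc : w i using Fin.cases with
        | zero => simp [hg, (hw i).1 hc]
        | succ c =>
          have : i ≠ T.root := fun h => by
            rw [(hw i).2 h] at hc
            exact absurd hc.symm (Fin.succ_ne_zero c)
          simp [hg, this]
      · refine ⟨hT, (hw _).2 rfl, fun c => ?_⟩
        cases c using Fin.cases with
        | zero => exact h2
        | succ c => rfl
    · intro r _ hr
      refine if_neg fun h => hr (funext fun c => ?_)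
      rw [h.2.2, Fin.cons_succ]
    · intro h
      refine absurd ?_ h
      have h3 := sum_card_fiber w
      rw [Fin.sum_univ_succ, (card_fiber_eq_one_iff w 0).2 ⟨_, hw⟩, hn] at h3
      rw [Finset.mem_piAntidiag]
      exact ⟨by omega, by simp⟩
  · rw [Finset.sum_eq_zero]
    · push Not at hw
      obtain ⟨i, hi⟩ := hw
      refine MultilinearMap.map_coord_zero _ i ?_
      rcases hi with ⟨h2, h3⟩ | ⟨h2, h3⟩
      · simp [hg, h2, h3]
      · obtain ⟨c, hc⟩ := Fin.exists_succ_eq.2 h2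
        simp only [hg, if_pos h3]
        rw [← hc, Fin.cons_succ]
    · intro r _
      refine if_neg fun h => hw ?_
      obtain ⟨i, hi⟩ := (card_fiber_eq_one_iff w 0).1 (h.2.2 0)
      rw [(hi _).1 h.2.1]
      exact hi

/-- The decoration of a tree in which the vertices outside a cut carry `z`, and the vertices in the
cut other than the root carry `z'`. -/
def cutVec {I : Type} [DecidableEq I] (r : I) (R : Finset I) (x z z' : V) : I → V :=
  fun i => if i = r then x else if i ∈ R then z' else z

-- In (x{z}_i){z'}_j the root block of a leaf cut has `i + 1` vertices and there are `j + 1` blocks.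
-- Each leaf cut thus determines `(i, j)` and occurs once in the sum.
open Classical in
theorem muAt_single_single {x z z' : V} {a : ℤ} (hx : x ∈ V.gr a) (hz : z ∈ V.gr 0)
    (hz' : z' ∈ V.gr 0) (n : ℕ) {I : Type} [Fintype I] [LinearOrder I] (S : RTree I) :
    ∑ k ∈ Finset.HasAntidiagonal.antidiagonal n,
      V.muAt S (V.Gamma.braceGamma (V.braceGamma x ![z] ![k.1] (V.admissible_single hz k.1))
        ![V.eta z'] ![k.2] (V.Gamma.admissible_single (V.eta_mem hz') k.2)) =
    ∑ R : S.Cut, if S.IsLeafCut R ∧ Fintype.card I = n + 1 then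
      V.pure (V.cutVec S.root R.1 x z z') else 0 := by
  have h1 := fun k : ℕ × ℕ => muAt_single
    (V.corollaSupported_braceGamma x ![z] ![k.1] (V.admissible_single hz k.1))
    (V.braceGamma_mem hx (fun i => by fin_cases i; exact hz) ![k.1] _) hz' k.2
    (V.Gamma.admissible_single (V.eta_mem hz') k.2) S
  simp only [h1]
  rw [Finset.sum_comm]
  refine Finset.sum_congr rfl fun R _ => ?_
  by_cases hR : S.IsLeafCut R
  swap
  · rw [if_neg fun h => hR h.1]
    exact Finset.sum_eq_zero fun k _ => if_neg fun h => hR h.1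
  have hcard := hR.card
  have hc := ((RTree.isLeafCut_iff R).1 hR).2.1
  have hterm : ∀ k : ℕ × ℕ, (if S.IsLeafCut R ∧ Fintype.card R.Blocks = k.2 + 1 then
        V.ins (S.block R) (S.rootBlock R) (fun _ => z') (V.ev (S.restrict R (S.rootBlock R))
          (V.braceGamma x ![z] ![k.1] (V.admissible_single hz k.1)))
      else 0) = if Fintype.card R.Blocks = k.2 + 1 ∧
        Fintype.card {v // S.block R v = S.rootBlock R} = k.1 + 1 then
          V.pure (V.cutVec S.root R.1 x z z') else 0 := by
    intro k
    by_cases h2 : Fintype.card R.Blocks = k.2 + 1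
    swap
    · rw [if_neg fun h => h2 h.2, if_neg fun h => h2 h.1]
    rw [if_pos ⟨hR, h2⟩, V.ev_braceGamma_single hx hz]
    by_cases h3 : Fintype.card {v // S.block R v = S.rootBlock R} = k.1 + 1
    swap
    · rw [if_neg fun h => h3 h.2, if_neg fun h => h3 h.2, map_zero]
    rw [if_pos ⟨hc, h3⟩, if_pos ⟨h2, h3⟩, rootVec_coe]
    have h0 : (fun i : {v // S.block R v = S.rootBlock R} =>
        V.rootVec (S.restrict R (S.rootBlock R)).root.1 x z i.1) =
        fun i => V.cutVec S.root R.1 x z z' i.1 := by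
      funext i
      by_cases hi : i.1 = S.root
      · rw [rootVec, cutVec, if_pos hi]
        exact if_pos hi
      · have : i.1 ∉ R.1 := fun h => hi ((RTree.coe_block_eq_iff R h _).1 i.2)
        simp only [rootVec, cutVec, this, if_false]
        rfl
    rw [h0]
    refine (V.ins_pure _ _ (q := fun i => if i = S.root then a else 0) (fun i => ?_)
      fun i hi => ?_).trans ?_
    · simp only [cutVec]
      split_ifs <;> assumption
    · have h4 : i ∈ R.1 := by
        by_contra h
        exact hi (hR.block_eq h)
      rw [cutVec, if_neg, if_pos h4]
      rintro rfl
      exact hi (S.block_of_mem R R.2)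
    · rw [Koszul.sign_single _ _ S.root fun i hi => if_neg hi]
      simp
  simp only [hterm]
  have hB : 0 < Fintype.card R.Blocks := Fintype.card_pos_iff.2 ⟨S.rootBlock R⟩
  have hfib : 0 < Fintype.card {v // S.block R v = S.rootBlock R} :=
    Fintype.card_pos_iff.2 ⟨⟨S.root, S.block_of_mem R R.2⟩⟩
  by_cases hN : Fintype.card I = n + 1
  · rw [if_pos ⟨hR, hN⟩, Finset.sum_eq_single
      (Fintype.card {v // S.block R v = S.rootBlock R} - 1, Fintype.card R.Blocks - 1),
      if_pos ⟨by omega, by omega⟩]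
    · rintro ⟨i, k⟩ _ hik
      refine if_neg fun h => hik (Prod.ext ?_ ?_)
      · have := h.2
        change i = _ - 1
        change _ = i + 1 at this
        omega
      · have := h.1
        change k = _ - 1
        change _ = k + 1 at this
        omega
    · intro h
      rw [Finset.HasAntidiagonal.mem_antidiagonal] at h
      omega
  · rw [if_neg fun h => hN h.2]
    refine Finset.sum_eq_zero fun k hk => if_neg fun h => hN ?_
    rw [Finset.HasAntidiagonal.mem_antidiagonal] at hk
    omega

open Classical in
/-- The decoration of a tree of depth two: `x` at the root, `z` at the vertices which are neither
the root nor leaves, `z'` at the vertices at distance two from the root, and `z + z'` at the leaves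
attached to the root. -/
noncomputable def depthVec {I : Type} (S : RTree I) (x z z' : V) : I → V := fun i =>
  if i = S.root then x else if S.parent i = S.root then
    (if ∃ v, S.parent v = i then z else z + z') else z'

-- In a leaf cut, vertices at distance two from the root are blocks of their own, children of the
-- root that have children belong to the root block, and leaves attached to the root are free.
-- Summing over the free choices of `z` or `z'` turns the label into `z + z'`.
open Classical in
theorem sum_cutVec (x z z' : V) {I : Type} [Fintype I] [LinearOrder I] (S : RTree I) :
    (∑ R : S.Cut, if S.IsLeafCut R then V.pure (V.cutVec S.root R.1 x z z') else 0) =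
      if ∀ v, S.parent (S.parent v) = S.root then V.pure (depthVec S x z z') else 0 := by
  by_cases hS : ∀ v, S.parent (S.parent v) = S.root
  swap
  · rw [if_neg hS]
    refine Finset.sum_eq_zero fun R _ => if_neg fun h => hS fun v => ?_
    by_cases hv : v ∈ R.1
    · rcases h.2 v hv with h1 | h1
      · rw [h1, S.parent_root]
      · exact h.1 _ h1
    · rw [h.1 v hv, S.parent_root]
  rw [if_pos hS]
  -- The labels of `depthVec` are split as `m + m'`, with `m` for vertices in the root block and
  -- `m'` for the root and the single blocks. A subset in the expansion is the complement of a cut.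
  set m : I → V := fun i => if i ≠ S.root ∧ S.parent i = S.root then z else 0 with hm
  set m' : I → V := fun i => if i = S.root then x else
    if S.parent i = S.root ∧ ∃ v, S.parent v = i then 0 else z' with hm'
  have h1 : depthVec S x z z' = m + m' := by
    funext i
    by_cases hi : i = S.root
    · simp [depthVec, hm, hm', hi]
    · by_cases hp : S.parent i = S.root
      · by_cases hv : ∃ v, S.parent v = i <;> simp [depthVec, hm, hm', hi, hp, hv]
      · simp [depthVec, hm, hm', hi, hp]
  rw [h1]
  refine Eq.trans ?_ (MultilinearMap.map_add_univ
    (PiTensorProduct.tprod K (s := fun _ : I => V.carrier)) m m').symm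
  rw [← Finset.sum_filter]
  symm
  -- Subsets that are not complements of leaf cuts put a zero entry of `m` or `m'` somewhere.
  rw [← Finset.sum_filter_of_ne (p := fun s : Finset I => S.root ∉ s ∧
    (∀ v ∈ s, S.parent v = S.root) ∧ ∀ v, v ∉ s → S.parent v = S.root ∨ S.parent v ∈ s)]
  · symm
    refine Finset.sum_bij (fun R _ => R.1ᶜ) ?_ ?_ ?_ ?_
    · intro R hR
      have h2 := (Finset.mem_filter.1 hR).2
      simp only [Finset.mem_filter, Finset.mem_univ, true_and, Finset.mem_compl, not_not]
      exact ⟨R.2, h2⟩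
    · intro R _ R' _ h
      exact Subtype.ext (compl_injective h)
    · intro s hs
      simp only [Finset.mem_filter, Finset.mem_univ, true_and] at hs
      set R : S.Cut := ⟨sᶜ, Finset.mem_compl.2 hs.1⟩ with hR
      refine ⟨R, Finset.mem_filter.2 ⟨Finset.mem_univ _, fun v hv => hs.2.1 v ?_, fun v hv => ?_⟩,
        compl_compl s⟩
      · simpa [hR] using hv
      · have h2 := hs.2.2 v (by simpa [hR] using hv)
        simpa [hR] using h2
    · intro R hR
      replace hR := (Finset.mem_filter.1 hR).2
      congr 1
      funext i
      by_cases hi : i ∈ R.1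
      · rw [Finset.piecewise_eq_of_notMem _ _ _ (by simpa using hi)]
        by_cases hir : i = S.root
        · simp [cutVec, hm', hir]
        · simp only [cutVec, hm', hir, hi, if_true, if_false]
          rw [if_neg]
          rintro ⟨hp, v, hv⟩
          by_cases hvR : v ∈ R.1
          · rcases hR.2 v hvR with h2 | h2
            · exact hir (hv.symm.trans h2)
            · exact h2 (hv ▸ hi)
          · exact hir (hv.symm.trans (hR.1 v hvR))
      · rw [Finset.piecewise_eq_of_mem _ _ _ (by simpa using hi)]
        have hir : i ≠ S.root := fun h => hi (h ▸ R.2)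
        simp [cutVec, hm, hir, hi, hR.1 i hi]
  · intro s _ hs
    by_contra hcon
    refine hs ?_
    by_cases hr : S.root ∈ s
    · refine MultilinearMap.map_coord_zero _ S.root ?_
      rw [Finset.piecewise_eq_of_mem _ _ _ hr]
      simp [hm]
    by_cases h2 : ∀ v ∈ s, S.parent v = S.root
    · have h3 : ¬ ∀ v, v ∉ s → S.parent v = S.root ∨ S.parent v ∈ s := fun h => hcon ⟨hr, h2, h⟩
      push Not at h3
      obtain ⟨v, hv, hvr, hvs⟩ := h3
      refine MultilinearMap.map_coord_zero _ (S.parent v) ?_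
      rw [Finset.piecewise_eq_of_notMem _ _ _ hvs]
      simp [hm', hvr, hS v]
    · push Not at h2
      obtain ⟨v, hv, hvr⟩ := h2
      refine MultilinearMap.map_coord_zero _ v ?_
      rw [Finset.piecewise_eq_of_mem _ _ _ hv]
      simp [hm, hvr]

end DGModule

/-- The functions `r` on `Fin N` such that `∑ (i + 1) r i = k`. -/
def weightedTuples (N k : ℕ) : Finset (Fin N → ℕ) :=
  (Fintype.piFinset fun _ => Finset.range (k + 1)).filter fun r => ∑ i, (i.1 + 1) * r i = k

/-- The bound `k` on the entries, imposed for finiteness, is implied by the equation because all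
coefficients `i + 1` are positive. -/
theorem mem_weightedTuples {N k : ℕ} {r : Fin N → ℕ} :
    r ∈ weightedTuples N k ↔ ∑ i, (i.1 + 1) * r i = k := by
  rw [weightedTuples, Finset.mem_filter, Fintype.mem_piFinset]
  refine ⟨fun h => h.2, fun h => ⟨fun i => Finset.mem_range.2 ?_, h⟩⟩
  have h1 : (i.1 + 1) * r i ≤ k := h ▸ Finset.single_le_sum
    (f := fun i : Fin N => (i.1 + 1) * r i) (fun _ _ => Nat.zero_le _) (Finset.mem_univ i)
  have h2 := Nat.le_mul_of_pos_left (r i) (Nat.succ_pos i.1)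
  exact Nat.lt_succ_of_le (h2.trans h1)

namespace DGModule

variable {K : Type u} [CommRing K] {V : DGModule.{u, v} K}

/-- The element of `Γ(PreLie, V)` which defines `z{z'}_c`, to which `z'` is added when `c = 0`. -/
noncomputable def treeArg {z' : V} (hz' : z' ∈ V.gr 0) (z : V) (c : ℕ) : V.Gamma :=
  V.braceGamma z ![z'] ![c] (V.admissible_single hz' c) + if c = 0 then V.eta z' else 0

theorem treeArg_mem {z z' : V} (hz : z ∈ V.gr 0) (hz' : z' ∈ V.gr 0) (c : ℕ) :
    treeArg hz' z c ∈ V.Gamma.gr 0 := by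
  refine add_mem (V.braceGamma_mem hz (fun i => by fin_cases i; exact hz') ![c] _) ?_
  split_ifs
  · exact V.eta_mem hz'
  · exact zero_mem _

-- For `c = 0` the support is the tree with one vertex, and the added generator merges by additivity
-- into the root label `z + z'`. This is the label that `depthVec` gives to leaves attached to the
-- root.
open Classical in
theorem ev_treeArg {z z' : V} (hz : z ∈ V.gr 0) (hz' : z' ∈ V.gr 0) (c : ℕ)
    {I : Type} [Fintype I] [LinearOrder I] (T : RTree I) :
    V.ev T (treeArg hz' z c) = if T.IsCorolla ∧ Fintype.card I = c + 1 then
      V.pure (V.rootVec T.root (if c = 0 then z + z' else z) z') else 0 := by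
  rw [treeArg, map_add, V.ev_braceGamma_single hz hz']
  by_cases hc : c = 0
  · subst hc
    simp only [if_true]
    rw [ev_eta]
    by_cases h1 : Fintype.card I = 1
    · have h2 : T.IsCorolla := fun v =>
        (Fintype.card_le_one_iff.1 h1.le) _ _
      rw [if_pos ⟨h2, h1⟩, if_pos h1, if_pos ⟨h2, h1⟩]
      have h3 : ∀ u, V.rootVec T.root u z' = Function.update (fun _ => z') T.root u := by
        intro u
        funext i
        by_cases hi : i = T.root
        · subst hi; simp [rootVec]
        · simp [rootVec, hi]
      rw [h3, h3]
      refine Eq.trans ?_ (MultilinearMap.map_update_add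
        (PiTensorProduct.tprod K (s := fun _ : I => V.carrier)) _ _ _ _).symm
      rw [Function.update_eq_self T.root (fun _ => z')]
    · rw [if_neg fun h => h1 h.2, if_neg h1, if_neg fun h => h1 h.2, add_zero]
  · simp only [hc, if_false, map_zero, add_zero]

/-- This matches the case distinction in `depthVec` (does a child of the root have children?) with
the one in `treeArg` (is the block larger than one vertex?). -/
theorem exists_parent_iff {I : Type} [Fintype I] [DecidableEq I] {S : RTree I}
    (hS : ∀ v, S.parent (S.parent v) = S.root) (b : S.childCut.Blocks)
    (hb : b ≠ S.rootBlock S.childCut) :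
    (∃ v, S.parent v = b.1) ↔ Fintype.card {v // S.block S.childCut v = b} ≠ 1 := by
  have hbr : b.1 ≠ S.root := fun h => hb (Subtype.ext h)
  rw [Ne, RTree.card_fiber_block_eq_one]
  push Not
  constructor
  · rintro ⟨v, hv⟩
    have h1 : S.parent v ≠ S.root := hv.symm ▸ hbr
    refine ⟨v, Subtype.ext ?_, fun h => hbr (RTree.eq_root_of_parent_eq (h ▸ hv))⟩
    rw [RTree.block_childCut hS, if_neg h1, hv]
  · rintro ⟨v, hv, hvb⟩
    refine ⟨v, ?_⟩
    have h1 := congrArg Subtype.val hv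
    rw [RTree.block_childCut hS] at h1
    split_ifs at h1
    · exact absurd h1 hvb
    · exact h1

-- The letter `i + 1` places `treeArg` of index `i` in a block, and that element lives on corollas
-- with `i + 1` vertices. Hence the letter must equal the size of the block. No signs arise, since
-- only `x` may have non-zero degree.
open Classical in
theorem muCut_treeArg {x z z' : V} {a : ℤ} (hx : x ∈ V.gr a) (hz : z ∈ V.gr 0)
    (hz' : z' ∈ V.gr 0) (N : ℕ) {I : Type} [Fintype I] [LinearOrder I] (S : RTree I)
    (w : S.childCut.Blocks → Fin (N + 1)) (hw : ∀ b, w b = 0 ↔ b = S.rootBlock S.childCut) :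
    V.muCut S S.childCut (V.Gamma.pure fun b => (Fin.cons (V.eta x) (fun i : Fin N =>
        treeArg hz' z i.1) : Fin (N + 1) → V.Gamma) (w b)) =
      if (∀ v, S.parent (S.parent v) = S.root) ∧ ∀ b, b ≠ S.rootBlock S.childCut →
          Fintype.card {v // S.block S.childCut v = b} = (w b).1 then
        V.pure (depthVec S x z z') else 0 := by
  rw [muCut_pure]
  set t : ∀ b, V.Tens {v // S.block S.childCut v = b} := fun b =>
    V.ev (S.restrict S.childCut b) ((Fin.cons (V.eta x) (fun i : Fin N =>
        treeArg hz' z i.1) : Fin (N + 1) → V.Gamma) (w b)) with ht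
  have htb : ∀ b, b ≠ S.rootBlock S.childCut → t b =
      if (S.restrict S.childCut b).IsCorolla ∧
        Fintype.card {v // S.block S.childCut v = b} = (w b).1 then
      V.pure (V.rootVec (S.restrict S.childCut b).root (if (w b).1 = 1 then z + z' else z) z')
      else 0 := by
    intro b hb
    obtain ⟨c, hc⟩ := Fin.exists_succ_eq.2 (mt (hw b).1 hb)
    simp only [ht, ← hc, Fin.cons_succ]
    rw [ev_treeArg hz hz']
    simp
    congr
  split_ifs with h
  · have h1 := RTree.childCut_corollas_iff.2 h.1
    have h2 : ∀ b, t b = V.pure fun i : {v // S.block S.childCut v = b} =>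
        depthVec S x z z' i := by
      intro b
      by_cases hb : b = S.rootBlock S.childCut
      · subst hb
        simp only [ht, (hw _).2 rfl, Fin.cons_zero]
        rw [ev_eta, if_pos RTree.card_rootBlock_childCut]
        refine congrArg V.pure (funext fun i => ?_)
        rw [RTree.block_childCut_eq_root i.2]
        simp [depthVec]
      · rw [htb b hb, if_pos ⟨h1 b, h.2 b hb⟩, rootVec_coe, ← h.2 b hb]
        have hbr : b.1 ≠ S.root := fun h => hb (Subtype.ext h)
        refine congrArg V.pure (funext fun i => ?_)
        have hir : i.1 ≠ S.root := fun hi => by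
          have h2 := i.2
          rw [hi, S.block_of_mem _ S.childCut.2] at h2
          exact hb h2.symm
        by_cases hib : i.1 = b.1
        · have hp := RTree.mem_childCut.1 b.2
          have h3 := exists_parent_iff h.1 b hb
          rw [rootVec, hib]
          refine (if_pos rfl).trans ?_
          rw [depthVec, if_neg hbr, if_pos hp]
          by_cases h4 : ∃ v, S.parent v = b.1
          · rw [if_pos h4, if_neg (h3.1 h4)]
          · rw [if_neg h4, if_pos (not_not.1 (mt h3.2 h4))]
        · have hp : S.parent i.1 ≠ S.root := fun hp =>
            hib ((RTree.coe_block_eq_iff _ (RTree.mem_childCut.2 hp) _).1 i.2)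
          rw [depthVec, if_neg hir, if_neg hp]
          exact if_neg hib
    have h3 : t = fun b => V.pure fun i : {v // S.block S.childCut v = b} =>
        depthVec S x z z' i := funext h2
    rw [h3, V.join_pure (S.block S.childCut) (q := fun i => if i = S.root then a else 0),
      Koszul.sign_single _ _ S.root fun i hi => if_neg hi]
    · simp
    · intro i
      simp only [depthVec]
      split_ifs
      exacts [hx, hz, add_mem hz hz', hz']
  · by_cases hS : ∀ v, S.parent (S.parent v) = S.root
    · have h1 : ¬ ∀ b, b ≠ S.rootBlock S.childCut →
          Fintype.card {v // S.block S.childCut v = b} = (w b).1 := fun h' => h ⟨hS, h'⟩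
      push Not at h1
      obtain ⟨b, hb, hb'⟩ := h1
      rw [MultilinearMap.map_coord_zero _ b, map_zero]
      rw [htb b hb, if_neg fun h => hb' h.2]
    · rw [← RTree.childCut_corollas_iff] at hS
      push Not at hS
      obtain ⟨b, hb⟩ := hS
      have hbr : b ≠ S.rootBlock S.childCut := by
        rintro rfl
        exact hb fun v => Fintype.card_le_one_iff.1 RTree.card_rootBlock_childCut.le _ _
      rw [MultilinearMap.map_coord_zero _ b, map_zero]
      rw [htb b hbr, if_neg fun h => hb h.1]

-- The tree determines the word, each block being labelled by its size, and the word determines the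
-- weight `r`. So one term survives, and ∑ (i + 1) r_i counts the vertices other than the root.
open Classical in
theorem sum_muAt_treeArg {x z z' : V} {a : ℤ} (hx : x ∈ V.gr a) (hz : z ∈ V.gr 0)
    (hz' : z' ∈ V.gr 0) {N k : ℕ} (hk : k ≤ N) {I : Type} [Fintype I] [LinearOrder I]
    (S : RTree I) :
    ∑ r ∈ weightedTuples N k, V.muAt S (V.Gamma.braceGamma (V.eta x)
      (fun i : Fin N => treeArg hz' z i.1) r
      (V.Gamma.admissible_of_mem (fun i => treeArg_mem hz hz' i.1) r)) =
    if (∀ v, S.parent (S.parent v) = S.root) ∧ Fintype.card I = k + 1 then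
      V.pure (depthVec S x z z') else 0 := by
  have hroot : ∀ (w : S.childCut.Blocks → Fin (N + 1)) (r : Fin N → ℕ),
      w (S.rootBlock S.childCut) = 0 →
      (∀ c, Fintype.card {b // w b = c} = (Fin.cons 1 r : Fin (N + 1) → ℕ) c) →
      ∀ b, w b = 0 ↔ b = S.rootBlock S.childCut := by
    intro w r h0 h b
    obtain ⟨i, hi⟩ := (card_fiber_eq_one_iff w 0).1 (h 0)
    rw [(hi _).1 h0]
    exact hi b
  have hmu : ∀ r : Fin N → ℕ, V.muAt S (V.Gamma.braceGamma (V.eta x)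
      (fun i : Fin N => treeArg hz' z i.1) r
      (V.Gamma.admissible_of_mem (fun i => treeArg_mem hz hz' i.1) r)) =
      ∑ w : S.childCut.Blocks → Fin (N + 1), if (w (S.rootBlock S.childCut) = 0 ∧
          ∀ c, Fintype.card {b // w b = c} = (Fin.cons 1 r : Fin (N + 1) → ℕ) c) ∧
          (∀ v, S.parent (S.parent v) = S.root) ∧ ∀ b, b ≠ S.rootBlock S.childCut →
          Fintype.card {v // S.block S.childCut v = b} = (w b).1 then
        V.pure (depthVec S x z z') else 0 := by
    intro r
    rw [muAt_apply, Finset.sum_eq_single S.childCut]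
    · rw [V.Gamma.ev_braceGamma_of_mem (V.eta_mem hx) fun i => treeArg_mem hz hz' i.1, map_sum]
      refine Finset.sum_congr rfl fun w _ => ?_
      have hc := RTree.contract_childCut (S := S)
      by_cases hw : w (S.rootBlock S.childCut) = 0 ∧
          ∀ c, Fintype.card {b // w b = c} = (Fin.cons 1 r : Fin (N + 1) → ℕ) c
      · rw [if_pos ⟨hc, hw⟩, muCut_treeArg hx hz hz' N S w (hroot w r hw.1 hw.2)]
        exact if_congr (by tauto) rfl rfl
      · rw [if_neg fun h => hw h.2, if_neg fun h => hw h.1, map_zero]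
    · intro R _ hne
      rw [V.Gamma.ev_braceGamma_of_mem (V.eta_mem hx) fun i => treeArg_mem hz hz' i.1, map_sum]
      refine Finset.sum_eq_zero fun w _ => ?_
      split_ifs with hc
      · refine muCut_eq_zero_of_ne_childCut S hc.1 hne _ (x := x) ?_
        have : w (S.rootBlock R) = 0 := hc.2.1
        simp only [this, Fin.cons_zero]
      · rw [map_zero]
    · simp
  simp only [hmu]
  have hsum : ∑ b, Fintype.card {v // S.block S.childCut v = b} = Fintype.card I :=
    sum_card_fiber _
  rw [← Finset.add_sum_erase _ _ (Finset.mem_univ (S.rootBlock S.childCut)),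
    RTree.card_rootBlock_childCut] at hsum
  have hweight : ∀ w : S.childCut.Blocks → Fin (N + 1), (w (S.rootBlock S.childCut) = 0) →
      (∀ b, b ≠ S.rootBlock S.childCut →
          Fintype.card {v // S.block S.childCut v = b} = (w b).1) →
      ∑ i : Fin N, (i.1 + 1) * Fintype.card {b // w b = i.succ} + 1 = Fintype.card I := by
    intro w h0 h
    have h1 := sum_fiber_mul w fun c => c.1
    rw [Fin.sum_univ_succ, ← Finset.add_sum_erase _ _ (Finset.mem_univ (S.rootBlock S.childCut)),
      h0] at h1
    simp only [Fin.val_zero, zero_mul, zero_add, Fin.val_succ] at h1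
    rw [h1, ← hsum, add_comm]
    congr 1
    exact Finset.sum_congr rfl fun b hb => (h b (Finset.ne_of_mem_erase hb)).symm
  by_cases hS : (∀ v, S.parent (S.parent v) = S.root) ∧ Fintype.card I = k + 1
  swap
  · rw [if_neg hS]
    refine Finset.sum_eq_zero fun r hr => Finset.sum_eq_zero fun w _ => if_neg fun h => hS ?_
    refine ⟨h.2.1, ?_⟩
    rw [← hweight w h.1.1 h.2.2, ← mem_weightedTuples.1 hr]
    simp only [h.1.2, Fin.cons_succ]
  rw [if_pos hS]
  -- Here `k ≤ N` enters: a block other than the root has at most `k` vertices, so its size is an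
  -- available letter.
  have hle : ∀ b, b ≠ S.rootBlock S.childCut →
      Fintype.card {v // S.block S.childCut v = b} < N + 1 := by
    intro b hb
    have := Finset.single_le_sum (f := fun b => Fintype.card {v // S.block S.childCut v = b})
      (fun _ _ => Nat.zero_le _) (Finset.mem_erase.2 ⟨hb, Finset.mem_univ b⟩)
    change Fintype.card {v // S.block S.childCut v = b} ≤ _ at this
    omega
  set w₀ : S.childCut.Blocks → Fin (N + 1) := fun b =>
    if hb : b = S.rootBlock S.childCut then 0 else ⟨_, hle b hb⟩ with hw₀
  have hw1 : w₀ (S.rootBlock S.childCut) = 0 := by simp [hw₀]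
  have hw2 : ∀ b, b ≠ S.rootBlock S.childCut →
      Fintype.card {v // S.block S.childCut v = b} = (w₀ b).1 := fun b hb => by
    simp only [hw₀, hb, dite_false]
  have hw3 : ∀ b, w₀ b = 0 ↔ b = S.rootBlock S.childCut := by
    intro b
    refine ⟨fun h => ?_, fun h => h ▸ hw1⟩
    by_contra hb
    have h1 := hw2 b hb
    rw [h] at h1
    exact (Fintype.card_pos_iff.2 ⟨⟨b.1, S.block_of_mem _ b.2⟩⟩ :
      0 < Fintype.card {v // S.block S.childCut v = b}).ne' h1
  have huniq : ∀ w : S.childCut.Blocks → Fin (N + 1), w (S.rootBlock S.childCut) = 0 →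
      (∀ b, b ≠ S.rootBlock S.childCut →
          Fintype.card {v // S.block S.childCut v = b} = (w b).1) → w = w₀ := by
    intro w h0 h
    funext b
    by_cases hb : b = S.rootBlock S.childCut
    · rw [hb, h0, hw1]
    · exact Fin.ext (by rw [← h b hb, hw2 b hb])
  rw [Finset.sum_eq_single fun i => Fintype.card {b // w₀ b = i.succ}]
  · rw [Finset.sum_eq_single w₀]
    · refine if_pos ⟨⟨hw1, fun c => ?_⟩, hS.1, hw2⟩
      cases c using Fin.cases with
      | zero => exact (card_fiber_eq_one_iff w₀ 0).2 ⟨_, hw3⟩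
      | succ c => rfl
    · exact fun w _ hw => if_neg fun h => hw (huniq w h.1.1 h.2.2)
    · simp
  · intro r _ hr
    refine Finset.sum_eq_zero fun w _ => if_neg fun h => hr (funext fun i => ?_)
    rw [← huniq w h.1.1 h.2.2, h.1.2, Fin.cons_succ]
  · intro h
    refine absurd (mem_weightedTuples.2 ?_) h
    have := hweight w₀ hw1 hw2
    omega

/-- The composite of two circular products, in the arity `k + 1`. -/
theorem mu_single_single {x z z' : V} {a : ℤ} (hx : x ∈ V.gr a) (hz : z ∈ V.gr 0)
    (hz' : z' ∈ V.gr 0) {N k : ℕ} (hk : k ≤ N) :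
    ∑ k ∈ Finset.HasAntidiagonal.antidiagonal k,
      V.mu (V.Gamma.braceGamma (V.braceGamma x ![z] ![k.1] (V.admissible_single hz k.1))
        ![V.eta z'] ![k.2] (V.Gamma.admissible_single (V.eta_mem hz') k.2)) =
    ∑ r ∈ weightedTuples N k, V.mu (V.Gamma.braceGamma (V.eta x)
      (fun i : Fin N => treeArg hz' z i.1) r
      (V.Gamma.admissible_of_mem (fun i => treeArg_mem hz hz' i.1) r)) := by
  classical
  refine V.gamma_ext fun n S => ?_
  rw [map_sum, map_sum]
  simp only [ev_mu]
  rw [muAt_single_single hx hz hz', sum_muAt_treeArg hx hz hz' hk]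
  have h := sum_cutVec x z z' S
  by_cases hn : Fintype.card (Fin n) = k + 1
  · simp only [hn, and_true]
    convert! h
  · rw [if_neg fun h => hn h.2]
    exact Finset.sum_eq_zero fun R _ => if_neg fun h => hn h.2

end DGModule

/-! ### Functoriality, multilinearity and the differential -/

namespace DGModule

section

variable {K : Type u} [CommRing K] {V : DGModule.{u, v} K} {W : DGModule.{u, w} K}

theorem map_signOp (f : V.Hom W) {I J : Type} [Fintype I] [LinearOrder I] [LinearOrder J]
    (w : I → J) (t : V.Tens I) :
    PiTensorProduct.map (fun _ : I => f.toLinearMap) (V.signOp w t) =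
      W.signOp w (PiTensorProduct.map (fun _ : I => f.toLinearMap) t) := by
  have h : PiTensorProduct.map (fun _ : I => f.toLinearMap) ∘ₗ V.signOp w =
      W.signOp w ∘ₗ PiTensorProduct.map (fun _ : I => f.toLinearMap) := by
    refine tens_ext fun q v hv => ?_
    rw [LinearMap.comp_apply, LinearMap.comp_apply, signOp_pure V w hv, map_smul,
      PiTensorProduct.map_tprod, signOp_pure W w fun i => f.map_mem (hv i)]
  exact LinearMap.congr_fun h t

theorem gammaMap_braceGamma (f : V.Hom W) {p : ℕ} (x : V) (y : Fin p → V) (r : Fin p → ℕ)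
    (h : V.Admissible y r) (h' : W.Admissible (fun i => f.toLinearMap (y i)) r) :
    gammaMap f (V.braceGamma x y r h) =
      W.braceGamma (f.toLinearMap x) (fun i => f.toLinearMap (y i)) r h' := by
  refine Subtype.ext (funext fun n => funext fun T => ?_)
  change PiTensorProduct.map (fun _ : Fin n => f.toLinearMap) (V.braceElt x y r n T) =
    W.braceElt _ _ r n T
  rw [braceElt, braceElt, map_sum]
  refine Finset.sum_congr rfl fun w _ => ?_
  rw [apply_ite (PiTensorProduct.map fun _ : Fin n => f.toLinearMap), map_signOp,
    PiTensorProduct.map_tprod, map_zero]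
  have h1 : (fun i => f.toLinearMap ((Fin.cons x y : Fin (p + 1) → V) (w i))) = fun i =>
      (Fin.cons (f.toLinearMap x) (fun i => f.toLinearMap (y i)) : Fin (p + 1) → W) (w i) := by
    funext i
    refine Fin.cases ?_ (fun c => ?_) (w i) <;> simp
  rw [h1]

/-- A letter of multiplicity one occupies a single place, so the tensor is linear in the
corresponding entry. -/
theorem braceElt_update_linear {p : ℕ} (u : Fin (p + 1) → V) (r : Fin p → ℕ) (c : Fin (p + 1))
    (hc : (Fin.cons 1 r : Fin (p + 1) → ℕ) c = 1) (s t : K) (a b : V) {m : ℕ}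
    {w : Fin m → Fin (p + 1)} (hw : w ∈ words r m) :
    (V.pure fun i => Function.update u c (s • a + t • b) (w i)) =
      s • (V.pure fun i => Function.update u c a (w i)) +
      t • V.pure fun i => Function.update u c b (w i) := by
  have hcard := (Finset.mem_filter.1 hw).2 c
  rw [hc] at hcard
  obtain ⟨j, hj⟩ := (card_fiber_eq_one_iff w c).1 (by convert! hcard)
  have h1 : ∀ z, (fun i => Function.update u c z (w i)) =
      Function.update (fun i => u (w i)) j z := by
    intro z
    funext i
    by_cases hi : i = j
    · subst hi
      rw [(hj i).2 rfl, Function.update_self, Function.update_self]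
    · rw [Function.update_of_ne hi, Function.update_of_ne (mt (hj i).1 hi)]
  simp only [h1, pure]
  rw [MultilinearMap.map_update_add, MultilinearMap.map_update_smul,
    MultilinearMap.map_update_smul]

/-- Phrasing the entries as updates of one tuple `u` treats linearity in `x` (the letter `0`) and in
an argument of weight one by the same statement. -/
theorem braceElt_linear {p : ℕ} {x x₁ x₂ : V} {y y₁ y₂ : Fin p → V} (r : Fin p → ℕ)
    (u : Fin (p + 1) → V) (c : Fin (p + 1)) (hc : (Fin.cons 1 r : Fin (p + 1) → ℕ) c = 1)
    (s t : K) (a b : V)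
    (h : (Fin.cons x y : Fin (p + 1) → V) = Function.update u c (s • a + t • b))
    (h₁ : (Fin.cons x₁ y₁ : Fin (p + 1) → V) = Function.update u c a)
    (h₂ : (Fin.cons x₂ y₂ : Fin (p + 1) → V) = Function.update u c b)
    (hy : V.Admissible y r) (hy₁ : V.Admissible y₁ r) (hy₂ : V.Admissible y₂ r) :
    V.braceGamma x y r hy = s • V.braceGamma x₁ y₁ r hy₁ + t • V.braceGamma x₂ y₂ r hy₂ := by
  refine Subtype.ext (funext fun n => funext fun T => ?_)
  change V.braceElt x y r n T = s • V.braceElt x₁ y₁ r n T + t • V.braceElt x₂ y₂ r n T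
  rw [braceElt, braceElt, braceElt, Finset.smul_sum, Finset.smul_sum, ← Finset.sum_add_distrib]
  refine Finset.sum_congr rfl fun w hw => ?_
  split_ifs
  · rw [h, h₁, h₂, braceElt_update_linear u r c hc s t a b hw, map_add, map_smul, map_smul]
  · simp

/-- Reaching the vertex `j`, the differential passes `x` only if the root precedes `j`. With (-1)^a
as a common factor, the remaining sign is that of a shuffle of `x` and an element of degree one. -/
theorem tensD_rootVec {x z : V} {a : ℤ} (hx : x ∈ V.gr a) (hz : z ∈ V.gr 0) {I : Type} [Fintype I]
    [LinearOrder I] (r : I) :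
    V.tensD I (V.pure (V.rootVec r x z)) = V.pure (V.rootVec r (V.d x) z) +
      ((a.negOnePow : ℤ) : K) • ∑ j, if j ≠ r then
        ((pairSign r j a 1 : ℤ) : K) • V.pure (V.pairVec r j x (V.d z) z) else 0 := by
  rw [V.tensD_pure (V.rootVec_mem r hx hz), ← Finset.add_sum_erase _ _ (Finset.mem_univ r)]
  congr 1
  · rw [Finset.prod_eq_one, Units.val_one, Int.cast_one, one_smul]
    · refine congrArg V.pure (funext fun i => ?_)
      by_cases hi : i = r
      · subst hi; simp [rootVec]
      · simp [rootVec, hi]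
    · intro j _
      split_ifs with h1 h2
      · exact absurd h2 h1.ne
      · simp
      · rfl
  · rw [← Finset.add_sum_erase _ _ (Finset.mem_univ r), if_neg (by simp), zero_add,
      Finset.smul_sum]
    refine Finset.sum_congr rfl fun i hi => ?_
    have hir := Finset.ne_of_mem_erase hi
    rw [if_pos hir, smul_smul]
    congr 1
    · have : (∏ j, if j < i then (if j = r then a else 0).negOnePow else 1) =
          a.negOnePow * pairSign r i a 1 := by
        rw [Finset.prod_eq_single r]
        · rcases lt_or_gt_of_ne hir with h | h
          · simp [h, h.not_gt, pairSign, Koszul.swapSign, Int.units_mul_self]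
          · simp [h, h.not_gt, pairSign]
        · intro j _ hj
          simp [hj]
        · simp
      rw [this]
      push_cast
      rfl
    · refine congrArg V.pure (funext fun j => ?_)
      by_cases hj : j = i
      · subst hj; simp [rootVec, pairVec, hir]
      · simp [rootVec, pairVec, hj]

-- Differentiating one of the `z` turns it into a distinguished argument of weight one. The sum over
-- its position is part of the brace x{dz, z}_{1, n}, so no factor `n + 1` appears.
open Classical in
theorem d_braceGamma_succ {x z : V} {a : ℤ} (hx : x ∈ V.gr a) (hz : z ∈ V.gr 0) (n : ℕ) :
    V.Gamma.d (V.braceGamma x ![z] ![n + 1] (V.admissible_single hz (n + 1))) =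
      V.braceGamma (V.d x) ![z] ![n + 1] (V.admissible_single hz (n + 1)) +
      ((a.negOnePow : ℤ) : K) • V.braceGamma x ![V.d z, z] ![1, n] (V.admissible_pair _ hz n) := by
  refine V.gamma_ext fun m T => ?_
  rw [ev_d, V.ev_braceGamma_single hx hz, map_add, map_smul,
    V.ev_braceGamma_single (V.d_mem hx) hz, V.ev_braceGamma_pair hx (V.d_mem hz) hz, zero_add]
  by_cases h : T.IsCorolla ∧ Fintype.card (Fin m) = n + 1 + 1
  · rw [if_pos h, if_pos h, V.tensD_rootVec hx hz]
    congr 2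
    refine Finset.sum_congr rfl fun j _ => ?_
    by_cases hj : j = T.root
    · rw [if_neg (not_not.2 hj), if_neg fun h' => h'.2.1 hj]
    · rw [if_pos hj, if_pos ⟨h.1, hj, h.2⟩]
  · rw [if_neg h, if_neg h, map_zero, Finset.sum_eq_zero, smul_zero, add_zero]
    intro j _
    exact if_neg fun h' => h ⟨h'.1, h'.2.2⟩

/-- Leibniz rule on two vertices. Raising the degree of one entry changes the shuffle sign, and this
change accounts for the order in which `x` and `y` stand in the tensor. -/
theorem tensD_pairVec {x y z : V} {a b : ℤ} (hx : x ∈ V.gr a) (hy : y ∈ V.gr b)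
    (hz : z ∈ V.gr 0) {I : Type} [Fintype I] [LinearOrder I] {r j : I} (hj : j ≠ r)
    (hI : Fintype.card I = 2) :
    ((pairSign r j a b : ℤ) : K) • V.tensD I (V.pure (V.pairVec r j x y z)) =
      ((pairSign r j (a + 1) b : ℤ) : K) • V.pure (V.pairVec r j (V.d x) y z) +
      ((a.negOnePow : ℤ) : K) •
        ((pairSign r j a (b + 1) : ℤ) : K) • V.pure (V.pairVec r j x (V.d y) z) := by
  have hI' : ∀ i, i = r ∨ i = j := by
    intro i
    by_contra! h
    have h3 : ({i, r, j} : Finset I).card = 3 :=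
      Finset.card_eq_three.2 ⟨i, r, j, h.1, h.2, hj.symm, rfl⟩
    have := Finset.card_le_univ ({i, r, j} : Finset I)
    omega
  have h1 : Function.update (V.pairVec r j x y z) r (V.d (V.pairVec r j x y z r)) =
      V.pairVec r j (V.d x) y z := by
    funext i
    by_cases hi : i = r
    · subst hi; simp [pairVec]
    · simp [pairVec, hi]
  have h2 : Function.update (V.pairVec r j x y z) j (V.d (V.pairVec r j x y z j)) =
      V.pairVec r j x (V.d y) z := by
    funext i
    by_cases hi : i = j
    · subst hi; simp [pairVec, hj]
    · simp [pairVec, hi]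
  have hprod : ∀ f : I → ℤˣ, ∏ i, f i = f r * f j := fun f =>
    Fintype.prod_eq_mul r j hj.symm fun i hi => absurd (hI' i) (by tauto)
  rw [V.tensD_pure (V.pairVec_mem r j hx hy hz),
    Fintype.sum_eq_add r j hj.symm fun i hi => absurd (hI' i) (by tauto), h1, h2, smul_add,
    smul_smul, smul_smul, smul_smul, hprod, hprod]
  congr 2
  · rw [← Int.cast_mul, ← Units.val_mul]
    congr 2
    rcases lt_or_gt_of_ne hj with h | h
    · simp [h, hj, pairSign, Koszul.swapSign, add_mul, Int.negOnePow_add]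
    · simp [h.not_gt, pairSign]
  · rw [← Int.cast_mul, ← Int.cast_mul, ← Units.val_mul, ← Units.val_mul]
    congr 2
    rcases lt_or_gt_of_ne hj with h | h
    · simp [h, h.not_gt, pairSign, Koszul.swapSign, mul_add, Int.negOnePow_add]
      rw [mul_left_comm, Int.units_mul_self, mul_one]
    · simp [h, h.not_gt, pairSign]

open Classical in
theorem d_braceGamma_one {x y : V} {a b : ℤ} (hx : x ∈ V.gr a) (hy : y ∈ V.gr b) :
    V.Gamma.d (V.braceGamma x ![y] ![1] V.admissible_one) =
      V.braceGamma (V.d x) ![y] ![1] V.admissible_one +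
      ((a.negOnePow : ℤ) : K) • V.braceGamma x ![V.d y] ![1] V.admissible_one := by
  refine V.gamma_ext fun m T => ?_
  rw [ev_d, V.ev_braceGamma_one hx hy _ 0, map_add, map_smul,
    V.ev_braceGamma_one (V.d_mem hx) hy _ 0, V.ev_braceGamma_one hx (V.d_mem hy) _ 0,
    map_sum, Finset.smul_sum, ← Finset.sum_add_distrib]
  refine Finset.sum_congr rfl fun j _ => ?_
  split_ifs with h
  · rw [map_smul]
    exact tensD_pairVec hx hy (zero_mem _) h.2.1 h.2.2
  · simp

open Classical in
theorem braceGamma_zero {x z : V} {a : ℤ} (hx : x ∈ V.gr a) (hz : z ∈ V.gr 0) :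
    V.braceGamma x ![z] ![0] (V.admissible_single hz 0) = V.eta x := by
  refine V.gamma_ext fun m T => ?_
  rw [V.ev_braceGamma_single hx hz, V.ev_eta]
  by_cases h : Fintype.card (Fin m) = 1
  · rw [if_pos h, if_pos ⟨fun v => Fintype.card_le_one_iff.1 h.le _ _, h⟩]
    refine congrArg V.pure (funext fun i => if_pos ?_)
    exact Fintype.card_le_one_iff.1 h.le _ _
  · rw [if_neg h, if_neg fun h' => h h'.2]

end

end DGModule

/-! ### Identities of weighted braces in an algebra over the monad -/

namespace GammaPreLie

section

variable {K : Type u} [CommRing K] (L : GammaPreLie.{u, v} K)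

theorem brace_eq {p : ℕ} {x : L.carrier} {y : Fin p → L.carrier} {r : Fin p → ℕ}
    (h : L.Admissible y r) : L.brace x y r = L.l.toLinearMap (L.braceGamma x y r h) :=
  dif_pos h

/-- This is the associativity axiom of the algebra: a brace of elements `l X`, `l Y` can be computed
by multiplying in the free algebra first. Each tree identity is transferred to `L` through it. -/
theorem brace_l {p : ℕ} {x : L.carrier} {y : Fin p → L.carrier} {r : Fin p → ℕ} {X : L.Gamma}
    {Y : Fin p → L.Gamma} (h : L.Gamma.Admissible Y r) (h' : L.Admissible y r)
    (hx : x = L.l.toLinearMap X) (hy : ∀ i, y i = L.l.toLinearMap (Y i)) :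
    L.brace x y r = L.l.toLinearMap (L.mu (L.Gamma.braceGamma X Y r h)) := by
  subst hx
  obtain rfl : y = fun i => L.l.toLinearMap (Y i) := funext hy
  rw [L.brace_eq h', L.l_mu, DGModule.gammaMap_braceGamma L.l X Y r h h']

theorem brace_single_mem {x z : L.carrier} {a : ℤ} (hx : x ∈ L.gr a) (hz : z ∈ L.gr 0) (n : ℕ) :
    L.brace x ![z] ![n] ∈ L.gr a := by
  rw [L.brace_eq (L.admissible_single hz n)]
  exact L.l.map_mem (L.braceGamma_mem hx (by simpa using hz) _ _)

theorem brace_one_mem {x y : L.carrier} {a b : ℤ} (hx : x ∈ L.gr a) (hy : y ∈ L.gr b) :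
    L.brace x ![y] ![1] ∈ L.gr (a + b) := by
  rw [L.brace_eq L.admissible_one]
  exact L.l.map_mem (L.braceGamma_one_mem hx hy _)

theorem brace_pair_mem {x y z : L.carrier} {a b : ℤ} (hx : x ∈ L.gr a) (hy : y ∈ L.gr b)
    (hz : z ∈ L.gr 0) (n : ℕ) : L.brace x ![y, z] ![1, n] ∈ L.gr (a + b) := by
  rw [L.brace_eq (L.admissible_pair y hz n)]
  exact L.l.map_mem (L.braceGamma_pair_mem hx hy hz n _)

theorem brace_linear_left {p : ℕ} {y : Fin p → L.carrier} {r : Fin p → ℕ}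
    (h : L.Admissible y r) (s t : K) (a b : L.carrier) :
    L.brace (s • a + t • b) y r = s • L.brace a y r + t • L.brace b y r := by
  rw [L.brace_eq h, L.brace_eq h, L.brace_eq h, ← map_smul, ← map_smul, ← map_add]
  congr 1
  exact DGModule.braceElt_linear r (Fin.cons a y) 0 rfl s t a b (by simp) (by simp) (by simp) h h h

/-- The linear map `x ↦ x{y_1, …, y_p}_{r_1, …, r_p}`. -/
noncomputable def braceLeft {p : ℕ} {y : Fin p → L.carrier} {r : Fin p → ℕ}
    (h : L.Admissible y r) : L.carrier →ₗ[K] L.carrier where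
  toFun x := L.brace x y r
  map_add' a b := by simpa using L.brace_linear_left h 1 1 a b
  map_smul' s a := by simpa using L.brace_linear_left h s 0 a 0

/-- The linear map `y ↦ x{y}_1`. -/
noncomputable def braceRight (x : L.carrier) : L.carrier →ₗ[K] L.carrier :=
  have key : ∀ (s t : K) (a b : L.carrier), L.brace x ![s • a + t • b] ![1] =
      s • L.brace x ![a] ![1] + t • L.brace x ![b] ![1] := by
    intro s t a b
    rw [L.brace_eq L.admissible_one, L.brace_eq L.admissible_one, L.brace_eq L.admissible_one,
      ← map_smul, ← map_smul, ← map_add]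
    congr 1
    refine DGModule.braceElt_linear _ (Fin.cons x ![0]) 1 rfl s t a b ?_ ?_ ?_ _ _ _ <;>
    · funext i
      fin_cases i <;> rfl
  { toFun y := L.brace x ![y] ![1]
    map_add' a b := by simpa using key 1 1 a b
    map_smul' s a := by simpa using key s 0 a 0 }

/-- The linear map `y ↦ x{y, z}_{1, n}`. -/
noncomputable def bracePair (x : L.carrier) {z : L.carrier} (hz : z ∈ L.gr 0) (n : ℕ) :
    L.carrier →ₗ[K] L.carrier :=
  have key : ∀ (s t : K) (a b : L.carrier), L.brace x ![s • a + t • b, z] ![1, n] =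
      s • L.brace x ![a, z] ![1, n] + t • L.brace x ![b, z] ![1, n] := by
    intro s t a b
    rw [L.brace_eq (L.admissible_pair _ hz n), L.brace_eq (L.admissible_pair _ hz n),
      L.brace_eq (L.admissible_pair _ hz n), ← map_smul, ← map_smul, ← map_add]
    congr 1
    refine DGModule.braceElt_linear _ (Fin.cons x ![0, z]) 1 rfl s t a b ?_ ?_ ?_ _ _ _ <;>
    · funext i
      fin_cases i <;> rfl
  { toFun y := L.brace x ![y, z] ![1, n]
    map_add' a b := by simpa using key 1 1 a b
    map_smul' s a := by simpa using key s 0 a 0 }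

theorem brace_single_zero {x z : L.carrier} {a : ℤ} (hx : x ∈ L.gr a) (hz : z ∈ L.gr 0) :
    L.brace x ![z] ![0] = x := by
  rw [L.brace_eq (L.admissible_single hz 0), L.braceGamma_zero hx hz, L.l_eta]

theorem brace_congr {p : ℕ} (x : L.carrier) {y y' : Fin p → L.carrier} {r : Fin p → ℕ}
    (h : L.Admissible y r) (h' : L.Admissible y' r) (hy : ∀ i, r i ≠ 0 → y i = y' i) :
    L.brace x y r = L.brace x y' r := by
  rw [L.brace_eq h, L.brace_eq h', L.braceGamma_congr x h h' hy]

theorem brace_one_eq {x y z : L.carrier} {a b : ℤ} (hx : x ∈ L.gr a) (hy : y ∈ L.gr b)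
    (hz : z ∈ L.gr 0) : L.brace x ![y, z] ![1, 0] = L.brace x ![y] ![1] := by
  rw [L.brace_eq L.admissible_one, L.brace_eq (L.admissible_pair y hz 0),
    L.braceGamma_one_eq hx hy hz]

theorem brace_single_sum {p : ℕ} {x : L.carrier} {a : ℤ} (hx : x ∈ L.gr a)
    {y : Fin p → L.carrier} (hy : ∀ i, y i ∈ L.gr 0) (n : ℕ) :
    L.brace x ![∑ i, y i] ![n] = ∑ r ∈ Finset.piAntidiag Finset.univ n, L.brace x y r := by
  rw [L.brace_eq (L.admissible_single (sum_mem fun i _ => hy i) n), L.braceGamma_sum hx hy,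
    map_sum]
  exact Finset.sum_congr rfl fun r _ => (L.brace_eq _).symm

theorem d_brace_zero {x z : L.carrier} {a : ℤ} (hx : x ∈ L.gr a) (hz : z ∈ L.gr 0) :
    L.d (L.brace x ![z] ![0]) = L.brace (L.d x) ![z] ![0] := by
  rw [L.brace_single_zero hx hz, L.brace_single_zero (L.d_mem hx) hz]

theorem d_brace_succ {x z : L.carrier} {a : ℤ} (hx : x ∈ L.gr a) (hz : z ∈ L.gr 0) (n : ℕ) :
    L.d (L.brace x ![z] ![n + 1]) = L.brace (L.d x) ![z] ![n + 1] +
      ((a.negOnePow : ℤ) : K) • L.brace x ![L.d z, z] ![1, n] := by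
  rw [L.brace_eq (L.admissible_single hz (n + 1)), L.brace_eq (L.admissible_single hz (n + 1)),
    L.brace_eq (L.admissible_pair _ hz n), ← L.l.map_d, L.d_braceGamma_succ hx hz, map_add,
    map_smul]

theorem d_brace_one {x y : L.carrier} {a b : ℤ} (hx : x ∈ L.gr a) (hy : y ∈ L.gr b) :
    L.d (L.brace x ![y] ![1]) = L.brace (L.d x) ![y] ![1] +
      ((a.negOnePow : ℤ) : K) • L.brace x ![L.d y] ![1] := by
  rw [L.brace_eq L.admissible_one, L.brace_eq L.admissible_one,
    L.brace_eq L.admissible_one, ← L.l.map_d, L.d_braceGamma_one hx hy, map_add,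
    map_smul]

theorem brace_one_single {x y z : L.carrier} {a b : ℤ} (hx : x ∈ L.gr a) (hy : y ∈ L.gr b)
    (hz : z ∈ L.gr 0) (n : ℕ) :
    L.brace (L.brace x ![y] ![1]) ![z] ![n] =
      ∑ k ∈ Finset.HasAntidiagonal.antidiagonal n,
        L.brace x ![L.brace y ![z] ![k.1], z] ![1, k.2] := by
  rw [L.brace_l (L.Gamma.admissible_single (L.eta_mem hz) n) (L.admissible_single hz n)
    (L.brace_eq L.admissible_one) (by simp [L.l_eta])]
  have h := fun k : ℕ × ℕ => L.brace_l (x := x) (y := ![L.brace y ![z] ![k.1], z])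
    (L.Gamma.admissible_pair _ (L.eta_mem hz) k.2)
    (L.admissible_pair _ hz k.2) (L.l_eta x).symm (Y := ![_, L.eta z])
    (Fin.forall_fin_two.2 ⟨L.brace_eq (L.admissible_single hz k.1), (L.l_eta z).symm⟩)
  rw [Finset.sum_congr rfl fun k _ => h k, ← map_sum]
  congr 1
  refine L.gamma_ext fun m T => ?_
  rw [L.ev_mu, L.muAt_one_single hx hy hz, map_sum]
  exact Finset.sum_congr rfl fun k _ => (L.ev_mu T _).symm

theorem brace_single_one_succ {x y z : L.carrier} {a b : ℤ} (hx : x ∈ L.gr a) (hy : y ∈ L.gr b)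
    (hz : z ∈ L.gr 0) (n : ℕ) :
    L.brace (L.brace x ![z] ![n + 1]) ![y] ![1] = L.brace x ![y, z] ![1, n + 1] +
      L.brace x ![L.brace z ![y] ![1], z] ![1, n] := by
  rw [L.brace_l L.Gamma.admissible_one L.admissible_one
    (L.brace_eq (L.admissible_single hz (n + 1))) (Y := ![L.eta y]) (by simp [L.l_eta]),
    L.mu_single_one_succ hx hy hz, map_add, L.brace_eq (L.admissible_pair _ hz _)]
  congr 1
  exact (L.brace_l (L.Gamma.admissible_pair _ (L.eta_mem hz) n)
    (L.admissible_pair _ hz n) (L.l_eta x).symm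
    (Fin.forall_fin_two.2 ⟨L.brace_eq L.admissible_one, (L.l_eta z).symm⟩)).symm

theorem brace_one_one {x y : L.carrier} (hx : x ∈ L.gr 0) (hy : y ∈ L.gr 1) :
    L.brace (L.brace x ![y] ![1]) ![y] ![1] = L.brace x ![L.brace y ![y] ![1]] ![1] := by
  have hz : (0 : L.carrier) ∈ L.gr 0 := zero_mem _
  rw [L.brace_l L.Gamma.admissible_one L.admissible_one
    (L.brace_eq L.admissible_one) (Y := ![L.eta y]) (by simp [L.l_eta]),
    L.mu_one_one hx hy hz, ← L.brace_one_eq hx (L.brace_one_mem hy hy) hz]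
  exact (L.brace_l (L.Gamma.admissible_pair _ (L.eta_mem hz) 0)
    (L.admissible_pair _ hz 0) (L.l_eta x).symm
    (Fin.forall_fin_two.2 ⟨L.brace_eq L.admissible_one, (L.l_eta _).symm⟩)).symm

/-- The arity `k + 1` part of c_{z'} ∘ c_z = c_{z ⋆ z'}: the sum of the arguments, over all `i`, is
the expansion of z ⋆ z' = z' + ∑ z{z'}_i. -/
theorem brace_single_single {x z z' : L.carrier} {a : ℤ} (hx : x ∈ L.gr a) (hz : z ∈ L.gr 0)
    (hz' : z' ∈ L.gr 0) {N k : ℕ} (hk : k ≤ N) :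
    ∑ k ∈ Finset.HasAntidiagonal.antidiagonal k,
      L.brace (L.brace x ![z] ![k.1]) ![z'] ![k.2] =
    ∑ r ∈ weightedTuples N k, L.brace x
      (fun i : Fin N => L.brace z ![z'] ![i.1] + if i.1 = 0 then z' else 0) r := by
  have h1 : ∀ k : ℕ × ℕ, L.brace (L.brace x ![z] ![k.1]) ![z'] ![k.2] = _ := fun k =>
    L.brace_l (L.Gamma.admissible_single (L.eta_mem hz') k.2) (L.admissible_single hz' k.2)
    (L.brace_eq (L.admissible_single hz k.1)) (by simp [L.l_eta])
  have hy : ∀ i : Fin N, L.brace z ![z'] ![i.1] + (if i.1 = 0 then z' else 0) ∈ L.gr 0 := by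
    intro i
    refine add_mem (L.brace_single_mem hz hz' _) ?_
    split_ifs
    exacts [hz', zero_mem _]
  have h2 : ∀ r : Fin N → ℕ, L.brace x
      (fun i : Fin N => L.brace z ![z'] ![i.1] + if i.1 = 0 then z' else 0) r = _ := fun r =>
    L.brace_l (Y := fun i : Fin N => DGModule.treeArg hz' z i.1)
      (L.Gamma.admissible_of_mem (fun i => DGModule.treeArg_mem hz hz' i.1) r)
      (L.admissible_of_mem hy r) (L.l_eta x).symm fun i => by
        rw [DGModule.treeArg, map_add, ← L.brace_eq]
        split_ifs
        · rw [L.l_eta]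
        · rw [map_zero]
  rw [Finset.sum_congr rfl fun k _ => h1 k, Finset.sum_congr rfl fun r _ => h2 r]
  have h3 := congrArg L.l.toLinearMap (L.mu_single_single hx hz hz' hk)
  rw [map_sum, map_sum] at h3
  exact h3

end

end GammaPreLie

/-! ### Convergent series in a complete algebra -/

/-- The square of side `N` is cut along `i + j = N`. The far part will lie in `F N`, which gives
Cauchy products modulo `F N`. -/
theorem Finset.sum_range_antidiagonal_sub {M : Type*} [AddCommGroup M] (a : ℕ → ℕ → M) (N : ℕ) :
    ∑ j ∈ Finset.range N, ∑ i ∈ Finset.range N, a i j =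
      (∑ n ∈ Finset.range N, ∑ k ∈ Finset.HasAntidiagonal.antidiagonal n, a k.1 k.2) +
        ∑ k ∈ (Finset.range N ×ˢ Finset.range N).filter (fun k => N ≤ k.1 + k.2), a k.1 k.2 := by
  rw [Finset.sum_comm, ← Finset.sum_product' (f := a),
    ← Finset.sum_filter_add_sum_filter_not _ (fun k : ℕ × ℕ => k.1 + k.2 < N)]
  congr 1
  · rw [← Finset.sum_fiberwise_of_maps_to (t := Finset.range N) (g := fun k : ℕ × ℕ => k.1 + k.2)]
    · refine Finset.sum_congr rfl fun n hn => Finset.sum_congr ?_ fun _ _ => rfl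
      ext ⟨i, j⟩
      simp only [Finset.mem_range] at hn
      simp only [Finset.mem_filter, Finset.mem_product, Finset.mem_range,
        Finset.HasAntidiagonal.mem_antidiagonal]
      omega
    · intro k hk
      exact Finset.mem_range.2 (Finset.mem_filter.1 hk).2
  · simp only [not_lt]

namespace CompleteGammaPreLie

section

variable {K : Type u} [CommRing K] (L : CompleteGammaPreLie.{u, v} K)

theorem mem_F_one (x : L.carrier) : x ∈ L.F 1 := L.F_one ▸ Submodule.mem_top

theorem mem_F_zero (x : L.carrier) : x ∈ L.F 0 := L.F_anti zero_le_one (L.mem_F_one x)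

theorem induction_gr {P : L.carrier → Prop} (x : L.carrier) (h : ∀ k, ∀ x ∈ L.gr k, P x)
    (hadd : ∀ x y, P x → P y → P (x + y)) : P x := by
  have hx : x ∈ ⨆ k, L.gr k := L.isInternal.submodule_iSup_eq_top ▸ Submodule.mem_top
  induction hx using Submodule.iSup_induction' with
  | mem k x hx => exact h k x hx
  | zero => exact h 0 0 (zero_mem _)
  | add x y _ _ hx hy => exact hadd x y hx hy

/-- Separatedness is assumed in each degree only. It extends to arbitrary elements because the
homogeneous components of an element of `F n` lie in `F n`. -/
theorem eq_zero_of_mem_F {x : L.carrier} (h : ∀ n, x ∈ L.F n) : x = 0 := by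
  have h1 : L.decomp x = 0 := DFinsupp.ext fun k => Subtype.ext
    (L.separated k _ (L.decomp x k).2 fun n _ => L.F_graded n x (h n) k)
  exact L.decomp.map_eq_zero_iff.1 h1

theorem eq_of_smodEq {x y : L.carrier} (h : ∀ n, x ≡ y [SMOD L.F n]) : x = y :=
  sub_eq_zero.1 (L.eq_zero_of_mem_F fun n => SModEq.sub_mem.1 (h n))

theorem brace_mem_F {p : ℕ} {k : ℕ} {x : L.carrier} (m : Fin p → ℕ) {y : Fin p → L.carrier}
    {r : Fin p → ℕ} (hr : L.Admissible y r) (hk : 1 ≤ k) (hm : ∀ i, 1 ≤ m i)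
    (hx : x ∈ L.F k) (hy : ∀ i, y i ∈ L.F (m i)) {N : ℕ} (hN : N ≤ k + ∑ i, m i * r i) :
    L.brace x y r ∈ L.F N :=
  L.F_anti hN (L.F_brace k x m y r hk hm hr hx hy)

theorem brace_single_mem_F {k N : ℕ} {x z : L.carrier} (hk : 1 ≤ k) (hx : x ∈ L.F k)
    (hz : z ∈ L.gr 0) (n : ℕ) (hN : N ≤ k + n) : L.brace x ![z] ![n] ∈ L.F N :=
  L.brace_mem_F ![1] (L.admissible_single hz n) hk (by simp) hx (by simp [L.mem_F_one])
    (by simpa using hN)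

theorem brace_one_mem_F {k m N : ℕ} {x y : L.carrier} (hk : 1 ≤ k) (hm : 1 ≤ m) (hx : x ∈ L.F k)
    (hy : y ∈ L.F m) (hN : N ≤ k + m) : L.brace x ![y] ![1] ∈ L.F N :=
  L.brace_mem_F ![m] L.admissible_one hk (by simpa using hm) hx (by simpa using hy)
    (by simpa using hN)

theorem brace_pair_mem_F {k m N : ℕ} {x y z : L.carrier} (hk : 1 ≤ k) (hm : 1 ≤ m)
    (hx : x ∈ L.F k) (hy : y ∈ L.F m) (hz : z ∈ L.gr 0) (n : ℕ) (hN : N ≤ k + m + n) :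
    L.brace x ![y, z] ![1, n] ∈ L.F N :=
  L.brace_mem_F ![m, 1] (L.admissible_pair y hz n) hk (Fin.forall_fin_two.2 ⟨hm, le_rfl⟩) hx
    (Fin.forall_fin_two.2 ⟨hy, L.mem_F_one z⟩) (by simp [Fin.sum_univ_two]; omega)

theorem exists_sum (b : ℤ) (s : ℕ → L.carrier) (hs : ∀ n, s n ∈ L.gr b) (hF : ∀ n, s n ∈ L.F n) :
    ∃ y ∈ L.gr b, ∀ N, y ≡ ∑ i ∈ Finset.range N, s i [SMOD L.F N] := by
  obtain ⟨y, hy, h⟩ := L.complete b (fun n => ∑ i ∈ Finset.range n, s i)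
    (fun n => sum_mem fun i _ => hs i) fun n _ => by
      rw [Finset.sum_range_succ, add_sub_cancel_left]
      exact hF n
  refine ⟨y, hy, fun N => SModEq.sub_mem.2 ?_⟩
  rcases Nat.eq_zero_or_pos N with rfl | hN
  · exact L.mem_F_zero _
  · exact h N hN

/-- The sum of a series of linear maps which raise the filtration more and more. -/
theorem exists_sumHom (b : ℤ) (φ : ℕ → L.carrier →ₗ[K] L.carrier)
    (hφ : ∀ n k x, x ∈ L.gr k → φ n x ∈ L.gr (k + b)) (hF : ∀ n x, φ n x ∈ L.F n) :
    ∃ f : L.carrier →ₗ[K] L.carrier, (∀ k x, x ∈ L.gr k → f x ∈ L.gr (k + b)) ∧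
      ∀ x N, f x ≡ ∑ i ∈ Finset.range N, φ i x [SMOD L.F N] := by
  have h : ∀ x, ∃ y, ∀ N, y ≡ ∑ i ∈ Finset.range N, φ i x [SMOD L.F N] := by
    intro x
    refine L.induction_gr (P := fun x => ∃ y, ∀ N, y ≡ ∑ i ∈ Finset.range N, φ i x [SMOD L.F N]) x
      (fun k x hx => ?_) ?_
    · obtain ⟨y, -, hy⟩ := L.exists_sum (k + b) (fun n => φ n x) (fun n => hφ n k x hx)
        fun n => hF n x
      exact ⟨y, hy⟩
    · rintro x x' ⟨y, hy⟩ ⟨y', hy'⟩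
      refine ⟨y + y', fun N => ?_⟩
      simpa only [map_add, Finset.sum_add_distrib] using (hy N).add (hy' N)
  -- Limits exist for all elements because each is a finite sum of homogeneous ones. They are
  -- unique, which makes the chosen function linear.
  choose f hf using h
  refine ⟨{ toFun := f, map_add' := fun x y => ?_, map_smul' := fun c x => ?_ }, ?_, hf⟩
  · refine L.eq_of_smodEq fun N => (hf _ N).trans ?_
    simpa only [map_add, Finset.sum_add_distrib] using ((hf x N).add (hf y N)).symm
  · refine L.eq_of_smodEq fun N => (hf _ N).trans ?_
    simpa only [map_smul, ← Finset.smul_sum, RingHom.id_apply] using ((hf x N).smul c).symm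
  · intro k x hx
    obtain ⟨y, hy, h⟩ := L.exists_sum (k + b) (fun n => φ n x) (fun n => hφ n k x hx)
        fun n => hF n x
    have : f x = y := L.eq_of_smodEq fun N => (hf x N).trans (h N).symm
    change f x ∈ _
    rw [this]
    exact hy

theorem exists_circHom (μ : L.gr 0) : ∃ f : L.carrier →ₗ[K] L.carrier,
    (∀ k x, x ∈ L.gr k → f x ∈ L.gr k) ∧
      ∀ x N, f x ≡ ∑ i ∈ Finset.range N, L.brace x ![μ.1] ![i] [SMOD L.F N] := by
  simpa only [add_zero] using! L.exists_sumHom 0 (fun n => L.braceLeft (L.admissible_single μ.2 n))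
    (fun n k x hx => (add_zero k).symm ▸ L.brace_single_mem hx μ.2 n)
    fun n x => L.brace_single_mem_F le_rfl (L.mem_F_one x) μ.2 n (by omega)

/-- The linear map `x ↦ x ⊚ (1 + μ)`. -/
noncomputable def circHom (μ : L.gr 0) : L.carrier →ₗ[K] L.carrier := (L.exists_circHom μ).choose

theorem circHom_mem (μ : L.gr 0) {k : ℤ} {x : L.carrier} (hx : x ∈ L.gr k) :
    L.circHom μ x ∈ L.gr k :=
  (L.exists_circHom μ).choose_spec.1 k x hx

theorem circHom_smodEq (μ : L.gr 0) (x : L.carrier) (N : ℕ) :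
    L.circHom μ x ≡ ∑ i ∈ Finset.range N, L.brace x ![μ.1] ![i] [SMOD L.F N] :=
  (L.exists_circHom μ).choose_spec.2 x N

theorem exists_derHom (μ : L.gr 0) {b : ℤ} {y : L.carrier} (hy : y ∈ L.gr b) :
    ∃ f : L.carrier →ₗ[K] L.carrier, (∀ k x, x ∈ L.gr k → f x ∈ L.gr (k + b)) ∧
      ∀ x N, f x ≡ ∑ i ∈ Finset.range N, L.brace x ![y, μ.1] ![1, i] [SMOD L.F N] :=
  L.exists_sumHom b (fun n => L.braceLeft (L.admissible_pair y μ.2 n))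
    (fun n _ _ hx => L.brace_pair_mem hx hy μ.2 n)
    fun n x => L.brace_pair_mem_F le_rfl le_rfl (L.mem_F_one x) (L.mem_F_one y) μ.2 n (by omega)

open Classical in
/-- The sum `∑ n, x{y, μ}_{1, n}`, for a homogeneous element `x`. -/
noncomputable def der (μ : L.gr 0) (x y : L.carrier) : L.carrier :=
  if h : ∃ z, ∀ N, z ≡ ∑ i ∈ Finset.range N, L.brace x ![y, μ.1] ![1, i] [SMOD L.F N] then
    h.choose else 0

theorem der_smodEq (μ : L.gr 0) (x : L.carrier) {b : ℤ} {y : L.carrier} (hy : y ∈ L.gr b) (N : ℕ) :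
    L.der μ x y ≡ ∑ i ∈ Finset.range N, L.brace x ![y, μ.1] ![1, i] [SMOD L.F N] := by
  obtain ⟨f, -, hf⟩ := L.exists_derHom μ hy
  have h : ∃ z, ∀ N, z ≡ ∑ i ∈ Finset.range N, L.brace x ![y, μ.1] ![1, i] [SMOD L.F N] :=
    ⟨f x, hf x⟩
  rw [der, dif_pos h]
  exact h.choose_spec N

theorem der_add (μ : L.gr 0) (x : L.carrier) {b : ℤ} {y y' : L.carrier} (hy : y ∈ L.gr b)
    (hy' : y' ∈ L.gr b) : L.der μ x (y + y') = L.der μ x y + L.der μ x y' := by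
  refine L.eq_of_smodEq fun N => (L.der_smodEq μ x (add_mem hy hy') N).trans ?_
  refine SModEq.trans ?_ ((L.der_smodEq μ x hy N).add (L.der_smodEq μ x hy' N)).symm
  rw [← Finset.sum_add_distrib]
  exact (Finset.sum_congr rfl fun i _ => (L.bracePair x μ.2 i).map_add y y') ▸ SModEq.rfl

theorem der_sub (μ : L.gr 0) (x : L.carrier) {b : ℤ} {y y' : L.carrier} (hy : y ∈ L.gr b)
    (hy' : y' ∈ L.gr b) : L.der μ x (y - y') = L.der μ x y - L.der μ x y' := by
  rw [eq_sub_iff_add_eq, ← L.der_add μ x (sub_mem hy hy') hy', sub_add_cancel]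

theorem circHom_mem_F (μ : L.gr 0) {k : ℕ} {x : L.carrier} (hx : x ∈ L.F k) :
    L.circHom μ x ∈ L.F k := by
  rcases Nat.eq_zero_or_pos k with rfl | hk
  · exact L.mem_F_zero _
  rw [← SModEq.zero]
  refine (L.circHom_smodEq μ x k).trans (SModEq.zero.2 ?_)
  exact sum_mem fun i _ => L.brace_single_mem_F hk hx μ.2 i (by omega)

theorem circHom_congr (μ : L.gr 0) {k : ℕ} {x y : L.carrier} (h : x ≡ y [SMOD L.F k]) :
    L.circHom μ x ≡ L.circHom μ y [SMOD L.F k] := by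
  rw [SModEq.sub_mem, ← map_sub]
  exact L.circHom_mem_F μ (SModEq.sub_mem.1 h)

theorem brace_single_zero' (x : L.carrier) {z : L.carrier} (hz : z ∈ L.gr 0) :
    L.brace x ![z] ![0] = x := by
  refine L.induction_gr (P := fun x => L.brace x ![z] ![0] = x) x
    (fun k x hx => L.brace_single_zero hx hz) fun x y hx hy => ?_
  exact ((L.braceLeft (L.admissible_single hz 0)).map_add x y).trans (congrArg₂ (· + ·) hx hy)

/-- The term of index 0 is `x` and the others gain at least one filtration step. Injectivity and
surjectivity of `circHom` both come from this. -/
theorem circHom_sub_mem_F (μ : L.gr 0) {k : ℕ} (hk : 1 ≤ k) {x : L.carrier} (hx : x ∈ L.F k) :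
    L.circHom μ x - x ∈ L.F (k + 1) := by
  rw [← SModEq.sub_mem]
  refine (L.circHom_smodEq μ x (k + 1)).trans (SModEq.sub_mem.2 ?_)
  rw [Finset.sum_range_succ', L.brace_single_zero' x μ.2, add_sub_cancel_right]
  exact sum_mem fun i _ => L.brace_single_mem_F hk hx μ.2 (i + 1) (by omega)

theorem circHom_zero (x : L.carrier) : L.circHom 0 x = x := by
  refine L.eq_of_smodEq fun N => ?_
  refine ((L.circHom_smodEq 0 x (N + 1)).mono (L.F_anti N.le_succ)).trans (SModEq.sub_mem.2 ?_)
  rw [Finset.sum_range_succ', L.brace_single_zero' x (0 : L.gr 0).2, add_sub_cancel_right]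
  -- Braces of higher weight are not linear in their argument. Instead, zero is regarded as an
  -- element of `F (N + 1)`, which makes the terms of positive weight arbitrarily small.
  refine sum_mem fun i _ => L.brace_mem_F ![N + 1] (L.admissible_single (zero_mem _) _) le_rfl
    (by simp) (L.mem_F_one x) (by simp) ?_
  simp
  nlinarith

/-! ### Identities for the circular product -/

/-- Summation of `d_brace_succ` over `n`. -/
theorem d_circHom (μ : L.gr 0) {a : ℤ} {x : L.carrier} (hx : x ∈ L.gr a) :
    L.d (L.circHom μ x) =
      L.circHom μ (L.d x) + ((a.negOnePow : ℤ) : K) • L.der μ x (L.d μ.1) := by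
  refine L.eq_of_smodEq fun N => ?_
  -- One more term is kept because the derivative of x{μ}_{n+1} yields the term of index `n` of
  -- `der`.
  have h1 : L.d (L.circHom μ x) ≡ L.d (∑ i ∈ Finset.range (N + 1), L.brace x ![μ.1] ![i])
      [SMOD L.F N] := by
    rw [SModEq.sub_mem, ← map_sub]
    exact L.F_anti N.le_succ (L.F_d _ _ (SModEq.sub_mem.1 (L.circHom_smodEq μ x (N + 1))))
  refine h1.trans (SModEq.trans ?_ (((L.circHom_smodEq μ (L.d x) (N + 1)).mono
    (L.F_anti N.le_succ)).add ((L.der_smodEq μ x (L.d_mem μ.2) N).smul _)).symm)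
  rw [map_sum, Finset.sum_range_succ', Finset.sum_range_succ', L.d_brace_zero hx μ.2,
    Finset.sum_congr rfl fun i _ => L.d_brace_succ hx μ.2 i, Finset.sum_add_distrib,
    Finset.smul_sum, add_right_comm]

theorem smodEq_sum_antidiagonal {a : ℕ → ℕ → L.carrier} (ha : ∀ i j, a i j ∈ L.F (i + j)) (N : ℕ) :
    ∑ n ∈ Finset.range N, ∑ k ∈ Finset.HasAntidiagonal.antidiagonal n, a k.1 k.2 ≡
      ∑ j ∈ Finset.range N, ∑ i ∈ Finset.range N, a i j [SMOD L.F N] := by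
  rw [Finset.sum_range_antidiagonal_sub, SModEq.comm, SModEq.sub_mem, add_sub_cancel_left]
  exact sum_mem fun k hk => L.F_anti (Finset.mem_filter.1 hk).2 (ha _ _)

/-- Summing (x{y}){μ}_n = ∑ x{y{μ}_i, μ}_{1, j} over `n` gives a double series. The sum over `i` can
be taken inside, because x{-, μ}_{1, j} is linear and respects the filtration. -/
theorem circHom_brace_one (μ : L.gr 0) {a b : ℤ} {x y : L.carrier} (hx : x ∈ L.gr a)
    (hy : y ∈ L.gr b) :
    L.circHom μ (L.brace x ![y] ![1]) = L.der μ x (L.circHom μ y) := by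
  refine L.eq_of_smodEq fun N => (L.circHom_smodEq μ _ N).trans (SModEq.trans ?_
    (L.der_smodEq μ x (L.circHom_mem μ hy) N).symm)
  rw [Finset.sum_congr rfl fun n _ => L.brace_one_single hx hy μ.2 n]
  refine (L.smodEq_sum_antidiagonal (a := fun i j => L.brace x ![L.brace y ![μ.1] ![i], μ.1] ![1, j])
    (fun i j => L.brace_pair_mem_F (k := 1) (m := 1 + i) le_rfl (by omega) (L.mem_F_one x)
      (L.brace_single_mem_F le_rfl (L.mem_F_one y) μ.2 i le_rfl) μ.2 j (by omega)) N).trans ?_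
  refine SModEq.sum fun j _ => ?_
  have h1 := (L.bracePair x μ.2 j).map_sub (L.circHom μ y)
    (∑ i ∈ Finset.range N, L.brace y ![μ.1] ![i])
  rw [map_sum (L.bracePair x μ.2 j)] at h1
  refine SModEq.symm (SModEq.sub_mem.2 ?_)
  change _ = L.brace x ![L.circHom μ y, μ.1] ![1, j] -
    ∑ i ∈ Finset.range N, L.brace x ![L.brace y ![μ.1] ![i], μ.1] ![1, j] at h1
  rw [← h1]
  rcases Nat.eq_zero_or_pos N with rfl | hN
  · exact L.mem_F_zero _
  exact L.brace_pair_mem_F (k := 1) le_rfl hN (L.mem_F_one x)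
    (SModEq.sub_mem.1 (L.circHom_smodEq μ y N)) μ.2 j (by omega)

/-- Summation of `brace_single_one_succ`. The term x{y} coming from x{μ}_0 = x supplies the missing
term of index 0 of the first series, so that series is truncated one step later than the second. -/
theorem brace_circHom_one (μ : L.gr 0) {a b : ℤ} {x y : L.carrier} (hx : x ∈ L.gr a)
    (hy : y ∈ L.gr b) :
    L.brace (L.circHom μ x) ![y] ![1] =
      L.der μ x y + L.der μ x (L.brace μ.1 ![y] ![1]) := by
  refine L.eq_of_smodEq fun N => ?_
  have h1 : L.brace (L.circHom μ x) ![y] ![1] ≡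
      L.brace (∑ i ∈ Finset.range (N + 1), L.brace x ![μ.1] ![i]) ![y] ![1] [SMOD L.F N] := by
    rw [SModEq.sub_mem]
    have h2 := (L.braceLeft (L.admissible_one (y := y))).map_sub (L.circHom μ x)
      (∑ i ∈ Finset.range (N + 1), L.brace x ![μ.1] ![i])
    refine (congrArg (· ∈ L.F N) h2).mp ?_
    exact L.brace_one_mem_F (k := N + 1) (m := 1) (by omega) le_rfl
      (SModEq.sub_mem.1 (L.circHom_smodEq μ x (N + 1))) (L.mem_F_one y) (by omega)
  have h3 := map_sum (L.braceLeft (L.admissible_one (y := y)))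
    (fun i => L.brace x ![μ.1] ![i]) (Finset.range (N + 1))
  change L.brace _ _ _ = ∑ i ∈ Finset.range (N + 1), L.brace (L.brace x ![μ.1] ![i]) ![y] ![1] at h3
  refine h1.trans (SModEq.trans ?_ (((L.der_smodEq μ x hy (N + 1)).mono
    (L.F_anti N.le_succ)).add (L.der_smodEq μ x (L.brace_one_mem μ.2 hy) N)).symm)
  rw [h3, Finset.sum_range_succ', Finset.sum_range_succ' _ N, L.brace_single_zero hx μ.2,
    L.brace_one_eq hx hy μ.2, Finset.sum_congr rfl fun i _ => L.brace_single_one_succ hx hy μ.2 i,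
    Finset.sum_add_distrib, add_right_comm]

end

end CompleteGammaPreLie

/-! ### Composition of circular products and inverses -/

theorem sum_le_sum_weighted {N : ℕ} (r : Fin N → ℕ) : ∑ i, r i ≤ ∑ i, (i.1 + 1) * r i :=
  Finset.sum_le_sum fun _ _ => Nat.le_mul_of_pos_left _ (Nat.succ_pos _)

/-- Two truncations of a series over weights are compared: by total weight, as in the expansion of
x{∑ y_i}_n, and by filtration, with y_i in `F (i + 1)`. The second region lies inside the first, and
the difference is negligible modulo `F N`. -/
theorem sum_piAntidiag_sub {M : Type*} [AddCommGroup M] {N : ℕ} (f : (Fin N → ℕ) → M) :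
    ∃ A : Finset (Fin N → ℕ), (∀ r ∈ A, N ≤ ∑ i, (i.1 + 1) * r i) ∧
      ∑ n ∈ Finset.range N, ∑ r ∈ Finset.piAntidiag Finset.univ n, f r =
        (∑ k ∈ Finset.range N, ∑ r ∈ weightedTuples N k, f r) + ∑ r ∈ A, f r := by
  classical
  set B : Finset (Fin N → ℕ) := (Finset.range N).biUnion (Finset.piAntidiag Finset.univ) with hB
  have hmem : ∀ r, r ∈ B ↔ ∑ i, r i < N := by
    intro r
    simp [hB, Finset.mem_piAntidiag]
  refine ⟨B.filter fun r => ¬ ∑ i, (i.1 + 1) * r i < N,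
    fun r hr => not_lt.1 (Finset.mem_filter.1 hr).2, ?_⟩
  have h1 : ∑ n ∈ Finset.range N, ∑ r ∈ Finset.piAntidiag Finset.univ n, f r = ∑ r ∈ B, f r := by
    rw [hB, Finset.sum_biUnion]
    intro m _ n _ hmn
    refine Finset.disjoint_left.2 fun r hm hn => hmn ?_
    rw [← (Finset.mem_piAntidiag.1 hm).1, (Finset.mem_piAntidiag.1 hn).1]
  have h2 : ∑ k ∈ Finset.range N, ∑ r ∈ weightedTuples N k, f r =
      ∑ r ∈ B.filter fun r => ∑ i, (i.1 + 1) * r i < N, f r := by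
    rw [← Finset.sum_fiberwise_of_maps_to (t := Finset.range N)
      (g := fun r : Fin N → ℕ => ∑ i, (i.1 + 1) * r i)
      fun r hr => Finset.mem_range.2 (Finset.mem_filter.1 hr).2]
    refine Finset.sum_congr rfl fun k hk => Finset.sum_congr ?_ fun _ _ => rfl
    ext r
    have := sum_le_sum_weighted r
    rw [Finset.mem_range] at hk
    simp only [mem_weightedTuples, Finset.mem_filter, hmem]
    constructor
    · intro h
      refine ⟨⟨?_, ?_⟩, h⟩ <;> omega
    · exact fun h => h.2
  rw [h1, h2, Finset.sum_filter_add_sum_filter_not]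

namespace CompleteGammaPreLie

section

variable {K : Type u} [CommRing K] (L : CompleteGammaPreLie.{u, v} K)

/-- Since the brace is not additive in `z`, one writes z = z' + ε and expands. Terms in which ε has
positive weight lie in `F N`, and the others do not depend on ε. -/
theorem brace_single_congr {a : ℤ} {x z z' : L.carrier} (hx : x ∈ L.gr a) (hz : z ∈ L.gr 0)
    (hz' : z' ∈ L.gr 0) {N : ℕ} (h : z ≡ z' [SMOD L.F N]) (n : ℕ) :
    L.brace x ![z] ![n] ≡ L.brace x ![z'] ![n] [SMOD L.F N] := by
  rcases Nat.eq_zero_or_pos N with rfl | hN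
  · exact SModEq.sub_mem.2 (L.mem_F_zero _)
  have hy : ∀ ε, ε ∈ L.gr 0 → ∀ i, ![z', ε] i ∈ L.gr 0 := fun ε hε =>
    Fin.forall_fin_two.2 ⟨hz', hε⟩
  have hadd : ∀ ε, ε ∈ L.gr 0 → L.brace x ![z' + ε] ![n] =
      ∑ r ∈ Finset.piAntidiag Finset.univ n, L.brace x ![z', ε] r := by
    intro ε hε
    have := L.brace_single_sum hx (hy ε hε) n
    rwa [Fin.sum_univ_two] at this
  have h1 := hadd _ (sub_mem hz hz')
  -- Taking ε = 0 writes x{z'}_n over the same set of weights, so the two expansions can be compared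
  -- term by term.
  have h2 := hadd 0 (zero_mem _)
  rw [add_sub_cancel] at h1
  rw [add_zero] at h2
  rw [h1, h2]
  refine SModEq.sum fun r _ => ?_
  by_cases hr : r 1 = 0
  · rw [L.brace_congr x (L.admissible_of_mem (hy _ (sub_mem hz hz')) r)
      (L.admissible_of_mem (hy _ (zero_mem _)) r) (Fin.forall_fin_two.2
        ⟨fun _ => rfl, fun h => absurd hr h⟩)]
  · have h3 : ∀ ε, ε ∈ L.gr 0 → ε ∈ L.F N → L.brace x ![z', ε] r ∈ L.F N := fun ε hε hF =>
      L.brace_mem_F ![1, N] (L.admissible_of_mem (hy ε hε) r) le_rfl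
        (Fin.forall_fin_two.2 ⟨le_rfl, hN⟩) (L.mem_F_one x)
        (Fin.forall_fin_two.2 ⟨L.mem_F_one z', hF⟩) (by
          rw [Fin.sum_univ_two]
          have := Nat.le_mul_of_pos_right N (Nat.pos_of_ne_zero hr)
          simp only [Matrix.cons_val_zero, Matrix.cons_val_one]
          omega)
    exact (SModEq.zero.2 (h3 _ (sub_mem hz hz') (SModEq.sub_mem.1 h))).trans
      (SModEq.zero.2 (h3 0 (zero_mem _) (zero_mem _))).symm

/-- The product `(1 + μ) ⊚ (1 + ν) = 1 + (ν + μ ⊚ (1 + ν))`. -/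
noncomputable def star (μ ν : L.gr 0) : L.gr 0 :=
  ⟨ν.1 + L.circHom ν μ.1, add_mem ν.2 (L.circHom_mem ν μ.2)⟩

/-- Modulo `F N` both sides are sums of braces x{y_0, …, y_{N-1}}_r, where y_i = μ{ν}_i, with ν
added for `i = 0`. The left is truncated by ∑ (i + 1) r_i and the right by ∑ r_i, as ∑ y_i is
congruent to μ ⋆ ν. -/
theorem circHom_circHom (μ ν : L.gr 0) {a : ℤ} {x : L.carrier} (hx : x ∈ L.gr a) :
    L.circHom ν (L.circHom μ x) = L.circHom (L.star μ ν) x := by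
  refine L.eq_of_smodEq fun N => ?_
  rcases Nat.eq_zero_or_pos N with rfl | hN
  · exact SModEq.sub_mem.2 (L.mem_F_zero _)
  set y : Fin N → L.carrier := fun i =>
    L.brace μ.1 ![ν.1] ![i.1] + if i.1 = 0 then ν.1 else 0 with hy
  have hy0 : ∀ i, y i ∈ L.gr 0 := by
    intro i
    refine add_mem (L.brace_single_mem μ.2 ν.2 _) ?_
    split_ifs
    exacts [ν.2, zero_mem _]
  have hyF : ∀ i : Fin N, y i ∈ L.F (i.1 + 1) := by
    intro i
    refine add_mem (L.brace_single_mem_F le_rfl (L.mem_F_one _) ν.2 _ (by omega)) ?_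
    split_ifs with h
    · rw [h]
      exact L.mem_F_one _
    · exact zero_mem _
  have hlhs : L.circHom ν (L.circHom μ x) ≡
      ∑ k ∈ Finset.range N, ∑ r ∈ weightedTuples N k, L.brace x y r [SMOD L.F N] := by
    refine (L.circHom_congr ν (L.circHom_smodEq μ x N)).trans ((L.circHom_smodEq ν _ N).trans ?_)
    have h1 : ∀ j, L.brace (∑ i ∈ Finset.range N, L.brace x ![μ.1] ![i]) ![ν.1] ![j] =
        ∑ i ∈ Finset.range N, L.brace (L.brace x ![μ.1] ![i]) ![ν.1] ![j] := fun j =>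
      map_sum (L.braceLeft (L.admissible_single ν.2 j)) _ _
    rw [Finset.sum_congr rfl fun j _ => h1 j]
    refine (L.smodEq_sum_antidiagonal
      (a := fun i j => L.brace (L.brace x ![μ.1] ![i]) ![ν.1] ![j]) (fun i j =>
        L.brace_single_mem_F (k := i + 1) (by omega) (L.brace_single_mem_F le_rfl (L.mem_F_one x)
          μ.2 i (by omega)) ν.2 j (by omega)) N).symm.trans ?_
    rw [Finset.sum_congr rfl fun k hk =>
      L.brace_single_single hx μ.2 ν.2 (Finset.mem_range.1 hk).le]
  have hsum : (L.star μ ν).1 ≡ ∑ i, y i [SMOD L.F N] := by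
    have h1 : ∑ i, y i = ∑ i ∈ Finset.range N, L.brace μ.1 ![ν.1] ![i] + ν.1 := by
      rw [hy, Finset.sum_add_distrib, Fin.sum_univ_eq_sum_range (fun i => L.brace μ.1 ![ν.1] ![i]),
        Fin.sum_univ_eq_sum_range (fun i => if i = 0 then ν.1 else 0), Finset.sum_ite_eq',
        if_pos (Finset.mem_range.2 hN)]
    rw [h1, add_comm]
    exact SModEq.rfl.add (L.circHom_smodEq ν μ.1 N)
  have hrhs : L.circHom (L.star μ ν) x ≡
      ∑ n ∈ Finset.range N, ∑ r ∈ Finset.piAntidiag Finset.univ n, L.brace x y r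
        [SMOD L.F N] := by
    refine (L.circHom_smodEq _ x N).trans (SModEq.sum fun n _ => ?_)
    rw [← L.brace_single_sum hx hy0]
    exact L.brace_single_congr hx (L.star μ ν).2 (sum_mem fun i _ => hy0 i) hsum n
  obtain ⟨A, hA, h⟩ := sum_piAntidiag_sub (N := N) fun r => L.brace x y r
  rw [h] at hrhs
  refine hlhs.trans (hrhs.trans (SModEq.sub_mem.2 ?_)).symm
  rw [add_sub_cancel_left]
  exact sum_mem fun r hr => L.brace_mem_F (fun i => i.1 + 1) (L.admissible_of_mem hy0 r) le_rfl
    (by simp) (L.mem_F_one x) hyF ((hA r hr).trans (Nat.le_add_left _ _))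

theorem star_assoc (μ ν ρ : L.gr 0) : L.star (L.star μ ν) ρ = L.star μ (L.star ν ρ) := by
  refine Subtype.ext ?_
  change ρ.1 + L.circHom ρ (ν.1 + L.circHom ν μ.1) =
    (ρ.1 + L.circHom ρ ν.1) + L.circHom (L.star ν ρ) μ.1
  rw [map_add, L.circHom_circHom ν ρ μ.2, add_assoc]

theorem zero_star (μ : L.gr 0) : L.star 0 μ = μ := by
  refine Subtype.ext ?_
  change μ.1 + L.circHom μ 0 = μ.1
  rw [map_zero, add_zero]

/-- Neumann series: the operator id - c_μ raises the filtration, so its powers applied to `z` have a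
convergent sum, which is a preimage of `z`. -/
theorem exists_circHom_eq (μ : L.gr 0) {z : L.carrier} {a : ℤ} (hz : z ∈ L.gr a) :
    ∃ x ∈ L.gr a, L.circHom μ x = z := by
  set t : ℕ → L.carrier := fun n => (fun x => x - L.circHom μ x)^[n] z with ht
  have hsucc : ∀ n, t (n + 1) = t n - L.circHom μ (t n) := fun n =>
    Function.iterate_succ_apply' _ _ _
  have hgr : ∀ n, t n ∈ L.gr a := by
    intro n
    induction n with
    | zero => exact hz
    | succ n ih => exact hsucc n ▸ sub_mem ih (L.circHom_mem μ ih)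
  have hF : ∀ n, t n ∈ L.F (n + 1) := by
    intro n
    induction n with
    | zero => exact L.mem_F_one z
    | succ n ih =>
      rw [hsucc, ← neg_sub]
      exact neg_mem (L.circHom_sub_mem_F μ (by omega) ih)
  obtain ⟨x, hx, h⟩ := L.exists_sum a t hgr fun n => L.F_anti n.le_succ (hF n)
  refine ⟨x, hx, L.eq_of_smodEq fun N => (L.circHom_congr μ (h N)).trans ?_⟩
  -- As c_μ(t_i) = t_i - t_{i+1}, the sum telescopes.
  have h1 : L.circHom μ (∑ i ∈ Finset.range N, t i) = z - t N := by
    rw [map_sum, Finset.sum_congr rfl fun i _ =>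
      (by rw [hsucc, sub_sub_cancel] : L.circHom μ (t i) = t i - t (i + 1)),
      Finset.sum_range_sub']
    rfl
  rw [h1, SModEq.comm, SModEq.sub_mem, sub_sub_cancel]
  exact L.F_anti N.le_succ (hF N)

theorem exists_star_eq_zero (μ : L.gr 0) : ∃ ν, L.star ν μ = 0 := by
  obtain ⟨x, hx, h⟩ := L.exists_circHom_eq μ (neg_mem μ.2)
  refine ⟨⟨x, hx⟩, Subtype.ext ?_⟩
  change μ.1 + L.circHom μ x = 0
  rw [h, add_neg_cancel]

/-- If c_μ(x) = 0 then x = -(c_μ(x) - x) lies one filtration step deeper than it was known to, hence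
in every `F n`. -/
theorem circHom_injective (μ : L.gr 0) {x : L.carrier} (h : L.circHom μ x = 0) : x = 0 := by
  have hF : ∀ n, x ∈ L.F (n + 1) := by
    intro n
    induction n with
    | zero => exact L.mem_F_one x
    | succ n ih =>
      have := L.circHom_sub_mem_F μ (by omega) ih
      rw [h, zero_sub] at this
      exact neg_mem_iff.1 this
  exact L.eq_zero_of_mem_F fun n => L.F_anti n.le_succ (hF n)

/-! ### The action on Maurer-Cartan elements -/

/-- The element `α + μ{α}_1 - d μ`. -/
noncomputable def twist (μ : L.gr 0) (α : L.carrier) : L.carrier :=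
  α + L.brace μ.1 ![α] ![1] - L.d μ.1

theorem brace_zero_one_mem (μ : L.gr 0) {α : L.carrier} (hα : α ∈ L.gr 1) :
    L.brace μ.1 ![α] ![1] ∈ L.gr 1 :=
  (zero_add (1 : ℤ)) ▸ L.brace_one_mem μ.2 hα

theorem d_zero_mem (μ : L.gr 0) : L.d μ.1 ∈ L.gr 1 := (zero_add (1 : ℤ)) ▸ L.d_mem μ.2

theorem twist_mem (μ : L.gr 0) {α : L.carrier} (hα : α ∈ L.gr 1) : L.twist μ α ∈ L.gr 1 :=
  sub_mem (add_mem hα (L.brace_zero_one_mem μ hα)) (L.d_zero_mem μ)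

/-- The terms D_x(α) and D_x(μ{α}) recombine to c_μ(x){α}. This is the reason for the form of the
twisted element. -/
theorem der_twist (μ : L.gr 0) {α x : L.carrier} {a : ℤ} (hx : x ∈ L.gr a) (hα : α ∈ L.gr 1) :
    L.der μ x (L.twist μ α) =
      L.brace (L.circHom μ x) ![α] ![1] - L.der μ x (L.d μ.1) := by
  rw [twist, L.der_sub μ x (add_mem hα (L.brace_zero_one_mem μ hα)) (L.d_zero_mem μ),
    L.der_add μ x hα (L.brace_zero_one_mem μ hα), L.brace_circHom_one μ hx hα]

/-- Applying c_μ to dβ + β{β} gives dT + T{α} with T = T_μ(α), the two terms D_β(dμ) having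
cancelled. In the expansion dμ{α} cancels as well, and what remains is the expression dα + α{α} plus
its image under μ{-}. -/
theorem mem_mc_of_circHom_eq_twist (μ : L.gr 0) {α β : L.carrier} (hα : α ∈ L.mc)
    (hβ : β ∈ L.gr 1) (h : L.circHom μ β = L.twist μ α) : β ∈ L.mc := by
  refine ⟨hβ, L.circHom_injective μ ?_⟩
  obtain ⟨hα1, hα2⟩ := hα
  have h1 := L.d_circHom μ hβ
  have h2 : L.circHom μ (L.brace β ![β] ![1]) = _ := L.circHom_brace_one μ hβ hβ
  rw [h, L.der_twist μ hβ hα1, h] at h2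
  rw [h] at h1
  have h3 : L.d (L.twist μ α) = L.d α + (L.brace (L.d μ.1) ![α] ![1] +
      L.brace μ.1 ![L.d α] ![1]) := by
    rw [twist, map_sub, map_add, L.d_d, sub_zero, L.d_brace_one μ.2 hα1]
    simp
  have h4 : L.brace (L.twist μ α) ![α] ![1] = L.brace α ![α] ![1] +
      L.brace (L.brace μ.1 ![α] ![1]) ![α] ![1] - L.brace (L.d μ.1) ![α] ![1] := by
    have := (L.braceLeft (L.admissible_one (y := α))).map_sub (α + L.brace μ.1 ![α] ![1])
      (L.d μ.1)
    rw [map_add] at this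
    exact this
  have h5 : L.brace μ.1 ![L.d α] ![1] + L.brace μ.1 ![L.brace α ![α] ![1]] ![1] = 0 := by
    refine ((L.braceRight μ.1).map_add _ _).symm.trans ?_
    rw [hα2, map_zero]
  -- Rewriting μ{α}{α} as μ{α{α}} lets it combine with μ{dα}.
  rw [L.brace_one_one μ.2 hα1] at h4
  have h6 : (((1 : ℤ).negOnePow : ℤ) : K) = -1 := by simp
  rw [h6, h3, neg_one_smul] at h1
  rw [h4] at h2
  rw [map_add, h2, eq_sub_of_add_eq h1.symm]
  refine Eq.trans ?_ ((congrArg₂ (· + ·) hα2 h5).trans (add_zero 0))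
  abel

theorem twist_zero (α : L.carrier) : L.twist 0 α = α := by
  have h1 : L.brace (0 : L.carrier) ![α] ![1] = 0 :=
    (L.braceLeft (L.admissible_one (y := α))).map_zero
  change α + L.brace 0 ![α] ![1] - L.d 0 = α
  rw [h1, map_zero, sub_zero, add_zero]

/-- With β and γ the images of α and β, c_μ(T_ν(β)) = T_μ(α) + D_ν(T_μ(α)) - c_μ(dν). Replacing
D_ν(T_μ(α)) by c_μ(ν){α} - D_ν(dμ) and recognising d c_μ(ν) gives T for ν ⋆ μ = μ + c_μ(ν). -/
theorem circHom_star_eq_twist (μ ν : L.gr 0) {α β γ : L.carrier} (hα : α ∈ L.gr 1)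
    (hβ : β ∈ L.gr 1) (hγ : γ ∈ L.gr 1)
    (h : L.circHom μ β = L.twist μ α) (h' : L.circHom ν γ = L.twist ν β) :
    L.circHom (L.star ν μ) γ = L.twist (L.star ν μ) α := by
  rw [← L.circHom_circHom ν μ hγ, h', twist, map_sub, map_add, h, L.circHom_brace_one μ ν.2 hβ, h,
    L.der_twist μ ν.2 hα]
  have h1 := L.d_circHom μ ν.2
  simp only [Int.negOnePow_zero, Units.val_one, Int.cast_one, one_smul] at h1
  have h2 : L.brace (L.star ν μ).1 ![α] ![1] = L.brace μ.1 ![α] ![1] +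
      L.brace (L.circHom μ ν.1) ![α] ![1] :=
    (L.braceLeft (L.admissible_one (y := α))).map_add _ _
  have h3 : L.d (L.star ν μ).1 = L.d μ.1 + L.d (L.circHom μ ν.1) := map_add _ _ _
  rw [twist, twist, h2, h3, h1]
  abel

end

end CompleteGammaPreLie

/-! ### The gauge group and its action -/

namespace CompleteGammaPreLie

section

variable {K : Type u} [CommRing K] (L : CompleteGammaPreLie.{u, v} K)

/-! ### Convergence in `L_+` -/

theorem hasSum_unique {s : ℕ → L.Plus} {a b : L.Plus} (ha : L.HasSum s a) (hb : L.HasSum s b) :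
    a = b := by
  have h : ∀ N, ∃ x ∈ L.F N, a - b = L.incl x := by
    intro N
    obtain ⟨m, hm⟩ := ha N
    obtain ⟨n, hn⟩ := hb N
    obtain ⟨x, hx, hx'⟩ := hm (max m n) (le_max_left _ _)
    obtain ⟨y, hy, hy'⟩ := hn (max m n) (le_max_right _ _)
    refine ⟨x - y, sub_mem hx hy, ?_⟩
    rw [hx', hy', add_sub_add_left_eq_sub, Prod.mk_sub_mk, sub_zero]
  rw [← sub_eq_zero]
  refine Prod.ext ?_ (L.eq_zero_of_mem_F fun N => ?_)
  · obtain ⟨x, -, hx⟩ := h 0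
    rw [hx]
    rfl
  · obtain ⟨x, hx, hx'⟩ := h N
    rw [hx']
    exact hx

theorem tsum_eq {s : ℕ → L.Plus} {a : L.Plus} (ha : L.HasSum s a) : L.tsum s = a := by
  have h : ∃ a, L.HasSum s a := ⟨a, ha⟩
  rw [tsum, dif_pos h]
  exact L.hasSum_unique h.choose_spec ha

theorem sum_oneBrace (y : L.carrier) {n : ℕ} (hn : 2 ≤ n) :
    ∑ i ∈ Finset.range n, L.oneBrace ![y] ![i] = (1, y) := by
  obtain ⟨n, rfl⟩ := Nat.exists_eq_add_of_le' hn
  rw [Finset.sum_range_succ', Finset.sum_range_succ', Finset.sum_eq_zero]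
  · simp [oneBrace]
  · intro i _
    simp [oneBrace]

theorem hasSum_circ (a : L.Plus) (μ : L.gr 0) :
    L.HasSum (fun n => L.plusBrace a ![μ.1] ![n]) (a.1, a.1 • μ.1 + L.circHom μ a.2) := by
  -- Two terms exhaust the part coming from the unit, and `N` terms bring the part in `L` within `F
  -- N`.
  refine fun N => ⟨max 2 N, fun n hn => ⟨L.circHom μ a.2 -
    ∑ i ∈ Finset.range n, L.brace a.2 ![μ.1] ![i], L.F_anti ((le_max_right _ _).trans hn)
      (SModEq.sub_mem.1 (L.circHom_smodEq μ a.2 n)), ?_⟩⟩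
  simp only [plusBrace]
  rw [Finset.sum_add_distrib, ← Finset.smul_sum, L.sum_oneBrace _ ((le_max_left _ _).trans hn)]
  refine Prod.ext ?_ ?_
  · simp [Prod.fst_sum]
  · simp [Prod.snd_sum]

theorem circ_eq (a : L.Plus) (μ : L.gr 0) :
    L.circ a μ.1 = (a.1, a.1 • μ.1 + L.circHom μ a.2) :=
  L.tsum_eq (L.hasSum_circ a μ)

/-! ### The gauge group -/

/-- The elements `1 + μ` correspond to the elements `μ` of `L^0`. -/
def gaugeEquiv : L.gauge ≃ L.gr 0 where
  toFun g := ⟨g.1.2, g.2.2⟩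
  invFun μ := ⟨(1, μ.1), rfl, μ.2⟩
  left_inv g := Subtype.ext (Prod.ext g.2.1.symm rfl)
  right_inv _ := rfl

/-- The gauge group. -/
@[reducible]
noncomputable def gaugeGroup : Group L.gauge :=
  letI : Mul L.gauge := ⟨fun g h => L.gaugeEquiv.symm (L.star (L.gaugeEquiv g) (L.gaugeEquiv h))⟩
  letI : One L.gauge := ⟨L.gaugeEquiv.symm 0⟩
  letI : Inv L.gauge :=
    ⟨fun g => L.gaugeEquiv.symm (L.exists_star_eq_zero (L.gaugeEquiv g)).choose⟩
  -- Left unit and left inverses suffice. The inverse of 1 + μ comes from solving c_μ(x) = -μ.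
  Group.ofLeftAxioms
    (fun _ _ _ => congrArg L.gaugeEquiv.symm (L.star_assoc _ _ _))
    (fun g => (congrArg L.gaugeEquiv.symm (L.zero_star _)).trans (L.gaugeEquiv.symm_apply_apply g))
    fun g => congrArg L.gaugeEquiv.symm (L.exists_star_eq_zero (L.gaugeEquiv g)).choose_spec

attribute [local instance] gaugeGroup

theorem gaugeEquiv_mul (g h : L.gauge) :
    L.gaugeEquiv (g * h) = L.star (L.gaugeEquiv g) (L.gaugeEquiv h) := rfl

theorem gaugeEquiv_one : L.gaugeEquiv 1 = 0 := rfl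

theorem coe_gauge_mul (g h : L.gauge) : ((g * h : L.gauge) : L.Plus) = L.circ g.1 h.1.2 := by
  refine Eq.trans ?_ (L.circ_eq g.1 (L.gaugeEquiv h)).symm
  rw [g.2.1, one_smul]
  rfl

/-- The gauge action `(α + μ{α}_1 - d μ) ⊚ (1 + μ)⁻¹`. -/
noncomputable def gaugeAct (g : L.gauge) (α : L.carrier) : L.carrier :=
  L.circHom (L.gaugeEquiv g⁻¹) (L.twist (L.gaugeEquiv g) α)

theorem gaugeAct_mem (g : L.gauge) {α : L.carrier} (hα : α ∈ L.gr 1) : L.gaugeAct g α ∈ L.gr 1 :=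
  L.circHom_mem _ (L.twist_mem _ hα)

theorem circHom_gaugeAct (g : L.gauge) {α : L.carrier} (hα : α ∈ L.gr 1) :
    L.circHom (L.gaugeEquiv g) (L.gaugeAct g α) = L.twist (L.gaugeEquiv g) α := by
  rw [gaugeAct, L.circHom_circHom _ _ (L.twist_mem _ hα), ← gaugeEquiv_mul, inv_mul_cancel,
    gaugeEquiv_one, circHom_zero]

/-- By injectivity of `circHom`, the equation c_μ(β) = T_μ(α) characterises the action without
mentioning inverses. The laws of an action are verified in this form. -/
theorem eq_gaugeAct (g : L.gauge) {α β : L.carrier} (hα : α ∈ L.gr 1)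
    (h : L.circHom (L.gaugeEquiv g) β = L.twist (L.gaugeEquiv g) α) : β = L.gaugeAct g α := by
  refine sub_eq_zero.1 (L.circHom_injective (L.gaugeEquiv g) ?_)
  rw [map_sub, h, L.circHom_gaugeAct g hα, sub_self]

/-- The action of the gauge group on the Maurer-Cartan set. -/
@[reducible]
noncomputable def gaugeMulAction : MulAction L.gauge L.mc where
  smul g α := ⟨L.gaugeAct g α.1, L.mem_mc_of_circHom_eq_twist _ α.2 (L.gaugeAct_mem g α.2.1)
    (L.circHom_gaugeAct g α.2.1)⟩
  one_smul α := Subtype.ext (L.eq_gaugeAct 1 α.2.1 (by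
    rw [gaugeEquiv_one, circHom_zero, twist_zero])).symm
  mul_smul g h α := Subtype.ext (L.eq_gaugeAct (g * h) α.2.1
    (L.circHom_star_eq_twist _ _ α.2.1 (L.gaugeAct_mem h α.2.1)
      (L.gaugeAct_mem g (L.gaugeAct_mem h α.2.1)) (L.circHom_gaugeAct h α.2.1)
      (L.circHom_gaugeAct g (L.gaugeAct_mem h α.2.1)))).symm

end

end CompleteGammaPreLie

theorem theoremA {K : Type u} [CommRing K] (L : CompleteGammaPreLie.{u, v} K) :
    (∀ (a : L.Plus) (μ : L.carrier), μ ∈ L.gr 0 →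
      (∃! s : L.Plus, L.HasSum (fun n => L.plusBrace a ![μ] ![n]) s) ∧
        L.HasSum (fun n => L.plusBrace a ![μ] ![n]) (L.circ a μ)) ∧
    ∃ _ : Group L.gauge,
      (∀ g h : L.gauge, ((g * h : L.gauge) : L.Plus) = L.circ g.1 h.1.2) ∧
      ((1 : L.gauge) : L.Plus) = (1, 0) ∧
      ∃ _ : MulAction L.gauge L.mc, ∀ (g : L.gauge) (α : L.mc),
        L.incl (g • α : L.mc) =
          L.circ (L.incl (α.1 + L.brace g.1.2 ![α.1] ![1] - L.d g.1.2)) (g⁻¹ : L.gauge).1.2 := by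
  refine ⟨fun a μ hμ => ?_, L.gaugeGroup, L.coe_gauge_mul, rfl, L.gaugeMulAction, fun g α => ?_⟩
  · have h := L.hasSum_circ a ⟨μ, hμ⟩
    refine ⟨⟨_, h, fun s hs => L.hasSum_unique hs h⟩, ?_⟩
    rw [L.circ_eq a ⟨μ, hμ⟩]
    exact h
  · let _ := L.gaugeGroup
    refine Eq.trans ?_ (L.circ_eq _ (L.gaugeEquiv g⁻¹)).symm
    rw [zero_smul, zero_add]
    rfl
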